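/- **Theorem.** Let $(\Pi A, d_A)$ be a (super) Lie algebroid: $A$ is a super vector bundle over a supermanifold, $\Pi A$ is its parity reversion, with adapted local coordinates $(x^a,\xi^\alpha)$ in which the base coordinates $x^a$ have weight $0$ and the linear fibre coordinates $\xi^\alpha$ have weight $1$, and $d_A$ is an odd vector field on $\Pi A$ of weight $1$ with $d_A^2=0$. Let $\Pi T\Pi A$ be the antitangent bundle of $\Pi A$, with coordinates $(x^a,\xi^\alpha,dx^a,d\xi^\alpha)$ of bi-weights $(0,0),(0,1),(1,0),(1,1)$. Let $d=dx^a\,\partial/\partial x^a+d\xi^\alpha\,\partial/\partial\xi^\alpha$ be the de Rham differential, and let $L_{d_A}=[d,i_{d_A}]$ be the Lie derivative, where $i_X=(-1)^{\tilde X}X^c\,\partial/\partial(dy^c)$ for a vector field $X=X^c\,\partial/\partial y^c$ of parity $\tilde X$ on $\Pi A$, with $y=(x,\xi)$. Then $(\Pi T\Pi A, L_{d_A}, d)$ is a double Lie algebroid, that is, $\Pi T\Pi A$ is (the total space of) a double vector bundle and $L_{d_A}$ and $d$ are commuting homological vector fields on it, of bi-weights $(0,1)$ and $(1,0)$; hence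 $Q=L_{d_A}+d$ is a homological vector field. This double Lie algebroid is unimodular, i.e. its modular class vanishes: Berezin volumes exist on $\Pi T\Pi A$, and for every Berezin volume $\rho$ the function $\mathrm{Div}_\rho Q$ is $Q$-closed and equal to $Q(g)$ for some even function $g$. More precisely, the coordinate volumes $D[x,\xi,dx,d\xi]$ agree on overlaps of charts and so form a global Berezin volume on $\Pi T\Pi A$, and the divergence of $Q$ with respect to it is zero. Here a Berezin volume is given in local coordinates $z$ by $D[z]\rho(z)$ with $\rho$ even and invertible and $D[z']=D[z]\,\mathrm{Ber}(\partial z'/\partial z)$, and for a homogeneous vector field $X=X^c\,\partial/\partial z^c$ $$\mathrm{Div}_\rho X=\sum_c(-1)^{\tilde c(\tilde X+1)}\rho^{-1}\frac{\partial (X^c\rho)}{\partial z^c}.$$ -/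

import Mathlib

open scoped ContDiff

noncomputable section

namespace Super

universe u

/-! ## Grassmann algebras

Local coordinates of a supermanifold are indexed by `E ⊕ O`: the coordinates in `E` are even,
those in `O` are odd. -/

/-- The real Grassmann algebra with one generator for each element of `O`. -/
abbrev Gr (O : Type*) : Type _ := ExteriorAlgebra ℝ (O → ℝ)

instance instFiniteGr (O : Type*) [Fintype O] : Module.Finite ℝ (Gr O) := by
  classical
  let _ : LinearOrder O := LinearOrder.lift' (Fintype.equivFin O) (Fintype.equivFin O).injective
  exact Module.Finite.of_basis (Pi.basisFun ℝ O).ExteriorAlgebra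

/-- A norm on the finite-dimensional space `Gr O`. It only serves to give `Gr O` its (unique)
vector space topology, so that derivatives of `Gr O`-valued maps make sense. -/
instance instNormedGr (O : Type*) [Fintype O] : NormedAddCommGroup (Gr O) :=
  NormedAddCommGroup.induced (Gr O) (Fin (Module.finrank ℝ (Gr O)) → ℝ)
    (Module.finBasis ℝ (Gr O)).equivFun.toLinearMap
    (Module.finBasis ℝ (Gr O)).equivFun.injective

instance instNormedSpaceGr (O : Type*) [Fintype O] : NormedSpace ℝ (Gr O) :=
  NormedSpace.induced ℝ (Gr O) (Fin (Module.finrank ℝ (Gr O)) → ℝ)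
    (Module.finBasis ℝ (Gr O)).equivFun.toLinearMap

/-- The elements of `Gr O` of parity `p`. -/
abbrev parityPart (O : Type*) (p : ZMod 2) : Submodule ℝ (Gr O) :=
  CliffordAlgebra.evenOdd (0 : QuadraticForm ℝ (O → ℝ)) p

/-- The even subalgebra of `Gr O`. -/
abbrev GrEven (O : Type*) : Subalgebra ℝ (Gr O) :=
  CliffordAlgebra.even (0 : QuadraticForm ℝ (O → ℝ))

theorem even_mul_comm {O : Type*} (a : Gr O) (ha : a ∈ parityPart O 0) (b : Gr O) :
    a * b = b * a := by
  have anti : ∀ m n : O → ℝ, ExteriorAlgebra.ι ℝ m * ExteriorAlgebra.ι ℝ n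
      = -(ExteriorAlgebra.ι ℝ n * ExteriorAlgebra.ι ℝ m) := fun m n =>
    eq_neg_of_add_eq_zero_left (ExteriorAlgebra.ι_add_mul_swap m n)
  have key : ∀ m n : O → ℝ, ∀ c : Gr O,
      (ExteriorAlgebra.ι ℝ m * ExteriorAlgebra.ι ℝ n) * c
        = c * (ExteriorAlgebra.ι ℝ m * ExteriorAlgebra.ι ℝ n) := by
    intro m n c
    induction c using ExteriorAlgebra.induction with
    | algebraMap r => exact (Algebra.commutes r _).symm
    | ι v =>
      rw [mul_assoc, anti n v, mul_neg, ← mul_assoc, anti m v, neg_mul, neg_neg, mul_assoc]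
    | mul x y hx hy => rw [← mul_assoc, hx, mul_assoc, hy, mul_assoc]
    | add x y hx hy => rw [mul_add, add_mul, hx, hy]
  induction a, ha using CliffordAlgebra.even_induction with
  | algebraMap r => exact Algebra.commutes r b
  | add x y _ _ hx hy => rw [add_mul, mul_add, hx, hy]
  | ι_mul_ι_mul m n x _ hx =>
    have h := key m n b
    calc _ = (ExteriorAlgebra.ι ℝ m * ExteriorAlgebra.ι ℝ n) * (x * b) := mul_assoc _ _ _
      _ = ((ExteriorAlgebra.ι ℝ m * ExteriorAlgebra.ι ℝ n) * b) * x := by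
        rw [hx, ← mul_assoc]
      _ = b * ((ExteriorAlgebra.ι ℝ m * ExteriorAlgebra.ι ℝ n) * x) := by rw [h, mul_assoc]

instance instCommRingGrEven (O : Type*) : CommRing (GrEven O) :=
  { (inferInstance : Ring (GrEven O)) with
    mul_comm := fun a b => Subtype.ext (even_mul_comm a.1 a.2 b.1) }

open Classical in
/-- An even element of `Gr O`, seen in the even subalgebra (and `0` for other elements). -/
def toEven {O : Type*} (a : Gr O) : GrEven O := if h : a ∈ GrEven O then ⟨a, h⟩ else 0

/-- The real number that remains when all odd generators are set to zero. -/
def body {O : Type*} (a : Gr O) : ℝ := ExteriorAlgebra.algebraMapInv a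

/-- The sign `(-1)^p`. -/
def sgn (p : ZMod 2) : ℝ := (-1) ^ p.val

/-! ## Superfunctions on superdomains -/

/-- Superfunctions in the coordinates `E ⊕ O`, that is, elements of `C^∞(U) ⊗ Λ(O)`. They are
represented by total functions on `E → ℝ`, of which only the values on the open set `U` matter. -/
abbrev SFun (E O : Type*) : Type _ := (E → ℝ) → Gr O

section Local

variable {E O E' O' : Type*} [Fintype E] [DecidableEq E] [Fintype O] [DecidableEq O]
  [Fintype E'] [DecidableEq E'] [Fintype O'] [DecidableEq O']

/-- The parity of a coordinate. -/
def par : E ⊕ O → ZMod 2 := Sum.elim (fun _ => 0) (fun _ => 1)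

/-- The coordinates, as superfunctions. -/
def coord : E ⊕ O → SFun E O
  | .inl e => fun x => algebraMap ℝ (Gr O) (x e)
  | .inr o => fun _ => ExteriorAlgebra.ι ℝ (Pi.single o 1)

/-- The (left) partial derivative with respect to a coordinate. -/
def pd : E ⊕ O → SFun E O → SFun E O
  | .inl e => fun f x => fderiv ℝ f x (Pi.single e 1)
  | .inr o => fun f x =>
      CliffordAlgebra.contractLeft (Q := (0 : QuadraticForm ℝ (O → ℝ))) (LinearMap.proj o) (f x)

/-- One step of the Taylor expansion along the nilpotent parts of the even elements `a e`. -/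
def taylorStep (a : E' → Gr O) (G : (E' → ℝ) → Gr O) : (E' → ℝ) → Gr O := fun y =>
  ∑ e, (a e - algebraMap ℝ (Gr O) (body (a e))) * fderiv ℝ G y (Pi.single e 1)

open Classical in
/-- The algebra homomorphism `Gr O' → Gr O` that sends the generator with index `o` to `b o`. It
exists when the `b o` anticommute, in particular when they are odd; other `b` give `0`. -/
def oddSubst (b : O' → Gr O) : Gr O' →ₗ[ℝ] Gr O :=
  if h : ∀ v, Fintype.linearCombination ℝ b v * Fintype.linearCombination ℝ b v = 0 then
    (ExteriorAlgebra.lift ℝ ⟨Fintype.linearCombination ℝ b, h⟩).toLinearMap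
  else 0

/-- The value of the superfunction `F` when elements `a c` of `Gr O` (even for `c` in `E'`, odd for
`c` in `O'`) are substituted for the coordinates: odd coordinates are substituted algebraically,
even ones by Taylor expansion around the bodies. The nilpotent part of an even element is a sum of
products of at least two generators, so that all terms of order above `card O` vanish. -/
def subst (a : E' ⊕ O' → Gr O) (F : SFun E' O') : Gr O :=
  ∑ k ∈ Finset.range (Fintype.card O + 1), ((k.factorial : ℝ)⁻¹) •
    ((taylorStep fun e => a (.inl e))^[k] fun y => oddSubst (fun o => a (.inr o)) (F y))
      fun e => body (a (.inl e))

/-- Pullback of superfunctions by the map with coordinate expressions `φ`. -/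
def pull (φ : E' ⊕ O' → SFun E O) (F : SFun E' O') : SFun E O := fun x => subst (fun c => φ c x) F

/-- The map of reduced domains underlying the map with coordinate expressions `φ`. -/
def bodyMap (φ : E' ⊕ O' → SFun E O) : (E → ℝ) → (E' → ℝ) := fun x e => body (φ (.inl e) x)

/-- The Jacobian matrix; rows are indexed by the coordinates of differentiation. -/
def jac (φ : E ⊕ O → SFun E O) (x : E → ℝ) : Matrix (E ⊕ O) (E ⊕ O) (Gr O) :=
  .of fun a b => pd a (φ b) x

/-- The Berezinian `det (A - B D⁻¹ C) (det D)⁻¹` of an even supermatrix with blocks `A B C D`. -/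
def ber (M : Matrix (E ⊕ O) (E ⊕ O) (Gr O)) : GrEven O :=
  let Dinv : Matrix O O (GrEven O) := (M.toBlocks₂₂.map toEven)⁻¹
  ((M.toBlocks₁₁ - M.toBlocks₁₂ * Dinv.map Subtype.val * M.toBlocks₂₁).map toEven).det * Dinv.det

/-! ### Vector fields in coordinates -/

variable (E O) in
/-- The components `X^a` of a vector field `X = X^a ∂/∂x^a`. -/
abbrev VField : Type _ := E ⊕ O → SFun E O

/-- The action of a vector field on superfunctions. -/
def act (X : VField E O) (f : SFun E O) : SFun E O := fun x => ∑ c, X c x * pd c f x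

/-- The supercommutator of vector fields `X`, `Y` of parities `p`, `q`, in components:
`[X, Y]^c = X(Y^c) - (-1)^{pq} Y(X^c)`. -/
def bracket (p q : ZMod 2) (X Y : VField E O) : VField E O := fun c =>
  act X (Y c) - sgn (p * q) • act Y (X c)

/-- The divergence of a vector field of parity `p` with respect to the Berezin volume `D[x] ρ`. -/
def divergence (p : ZMod 2) (ρ : SFun E O) (X : VField E O) : SFun E O := fun x =>
  ∑ c, sgn (par c * (p + 1)) • (Ring.inverse (ρ x) * pd c (fun y => X c y * ρ y) x)

/-- The Euler vector field that gives the coordinate `c` the weight `w c`. -/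
def euler (w : E ⊕ O → ℕ) : VField E O := fun c => w c • coord c

end Local

/-! ## Supermanifolds -/

/-- Gluing data for a supermanifold with local coordinates `E ⊕ O`: superdomains, their overlaps,
and the coordinates of chart `j` as superfunctions of those of chart `i`. -/
structure SuperAtlas (E O : Type*) where
  /-- the charts -/
  Idx : Type u
  /-- the image of the chart `i` -/
  dom : Idx → Set (E → ℝ)
  /-- the part of `dom i` that is also covered by the chart `j` -/
  overlap : Idx → Idx → Set (E → ℝ)
  /-- `trans i j c` is the coordinate `c` of chart `j` in terms of the coordinates of chart `i` -/
  trans : Idx → Idx → E ⊕ O → SFun E O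

variable {E O : Type*} [Fintype E] [DecidableEq E] [Fintype O] [DecidableEq O]

/-- The reduced space: the reduced domains, glued along the bodies of the coordinate changes. -/
def SuperAtlas.Reduced (M : SuperAtlas.{u} E O) : Type _ :=
  Quot fun (p q : Σ i, M.dom i) =>
    p.2.1 ∈ M.overlap p.1 q.1 ∧ bodyMap (M.trans p.1 q.1) p.2.1 = q.2.1

instance instTopologicalSpaceReduced (M : SuperAtlas.{u} E O) : TopologicalSpace M.Reduced :=
  inferInstanceAs (TopologicalSpace (Quot _))

/-- The gluing data define a (smooth, Hausdorff, second countable) supermanifold. -/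
structure IsSupermanifold (M : SuperAtlas.{u} E O) : Prop where
  isOpen_dom : ∀ i, IsOpen (M.dom i)
  isOpen_overlap : ∀ i j, IsOpen (M.overlap i j)
  overlap_subset : ∀ i j, M.overlap i j ⊆ M.dom i
  overlap_self : ∀ i, M.overlap i i = M.dom i
  mapsTo : ∀ i j, Set.MapsTo (bodyMap (M.trans i j)) (M.overlap i j) (M.overlap j i)
  smooth : ∀ i j c, ContDiffOn ℝ ∞ (M.trans i j c) (M.overlap i j)
  parity : ∀ i j c, ∀ x ∈ M.overlap i j, M.trans i j c x ∈ parityPart O (par c)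
  trans_self : ∀ i c, ∀ x ∈ M.dom i, M.trans i i c x = coord c x
  cocycle : ∀ i j k, ∀ x ∈ M.overlap i j, bodyMap (M.trans i j) x ∈ M.overlap j k →
    x ∈ M.overlap i k ∧ ∀ c, M.trans i k c x = pull (M.trans i j) (M.trans j k c) x
  t2 : T2Space M.Reduced
  secondCountable : SecondCountableTopology M.Reduced

/-- The family `f` of superfunctions on the charts is a function of parity `p` on `M`. -/
structure IsFunction (M : SuperAtlas.{u} E O) (p : ZMod 2) (f : M.Idx → SFun E O) : Prop where
  smooth : ∀ i, ContDiffOn ℝ ∞ (f i) (M.dom i)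
  parity : ∀ i, ∀ x ∈ M.dom i, f i x ∈ parityPart O p
  compat : ∀ i j, ∀ x ∈ M.overlap i j, f i x = pull (M.trans i j) (f j) x

/-- The family `X` of vector fields on the charts is a vector field of parity `p` on `M`. -/
structure IsVectorField (M : SuperAtlas.{u} E O) (p : ZMod 2) (X : M.Idx → VField E O) : Prop where
  smooth : ∀ i c, ContDiffOn ℝ ∞ (X i c) (M.dom i)
  parity : ∀ i c, ∀ x ∈ M.dom i, X i c x ∈ parityPart O (p + par c)
  compat : ∀ i j c, ∀ x ∈ M.overlap i j,
    act (X i) (M.trans i j c) x = pull (M.trans i j) (X j c) x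

/-- `Q` is a homological vector field on `M`: it is odd and squares to zero. -/
structure IsHomological (M : SuperAtlas.{u} E O) (Q : M.Idx → VField E O) : Prop where
  isVectorField : IsVectorField M 1 Q
  sq_zero : ∀ i c, ∀ x ∈ M.dom i, act (Q i) (Q i c) x = 0

/-- The vector fields `X`, `Y` of parities `p`, `q` supercommute on `M`. -/
def Commute (M : SuperAtlas.{u} E O) (p q : ZMod 2) (X Y : M.Idx → VField E O) : Prop :=
  ∀ i c, ∀ x ∈ M.dom i, bracket p q (X i) (Y i) c x = 0

/-! ## Berezin volumes and the modular class -/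

/-- The local expressions `D[x] ρ` define a Berezin volume on `M`: `ρ` is even and invertible, and
`D[x'] = D[x] Ber(∂x'/∂x)`. -/
structure IsBerezinVolume (M : SuperAtlas.{u} E O) (ρ : M.Idx → SFun E O) : Prop where
  smooth : ∀ i, ContDiffOn ℝ ∞ (ρ i) (M.dom i)
  even : ∀ i, ∀ x ∈ M.dom i, ρ i x ∈ parityPart O 0
  isUnit : ∀ i, ∀ x ∈ M.dom i, IsUnit (ρ i x)
  compat : ∀ i j, ∀ x ∈ M.overlap i j,
    ρ i x = (ber (jac (M.trans i j) x) : Gr O) * pull (M.trans i j) (ρ j) x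

/-- The coordinate volume `D[x]` of every chart. -/
def coordVolume (M : SuperAtlas.{u} E O) : M.Idx → SFun E O := fun _ _ => 1

/-- The divergence of a vector field of parity `p` on `M`. -/
def Div (M : SuperAtlas.{u} E O) (p : ZMod 2) (ρ : M.Idx → SFun E O) (X : M.Idx → VField E O) :
    M.Idx → SFun E O := fun i => divergence p (ρ i) (X i)

/-- `f` is a `Q`-closed function of parity `p`. -/
structure IsCocycle (M : SuperAtlas.{u} E O) (Q : M.Idx → VField E O) (p : ZMod 2)
    (f : M.Idx → SFun E O) : Prop where
  isFunction : IsFunction M p f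
  closed : ∀ i, ∀ x ∈ M.dom i, act (Q i) (f i) x = 0

/-- `f = Q(g)` for a function `g` of parity `p + 1`. -/
def IsCoboundary (M : SuperAtlas.{u} E O) (Q : M.Idx → VField E O) (p : ZMod 2)
    (f : M.Idx → SFun E O) : Prop :=
  ∃ g, IsFunction M (p + 1) g ∧ ∀ i, ∀ x ∈ M.dom i, f i x = act (Q i) (g i) x

/-- The modular class of the Q-manifold `(M, Q)`, the class of `Div_ρ Q` in the standard cohomology,
vanishes. The class does not depend on `ρ`; here vanishing is required for every `ρ`, along with
the existence of a Berezin volume. -/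
def IsUnimodular (M : SuperAtlas.{u} E O) (Q : M.Idx → VField E O) : Prop :=
  (∃ ρ, IsBerezinVolume M ρ) ∧ ∀ ρ, IsBerezinVolume M ρ →
    IsCocycle M Q 1 (Div M 1 ρ Q) ∧ IsCoboundary M Q 1 (Div M 1 ρ Q)

/-! ## Vector bundles, Lie algebroids, double Lie algebroids -/

/-- A vector bundle structure on `M`, in terms of an adapted atlas: coordinates of weight `0` are
base coordinates, those of weight `1` are linear coordinates in the fibres. Domains contain full
fibres, and coordinate changes preserve the weights, so that base coordinates change among
themselves and fibre coordinates change linearly. -/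
structure IsVectorBundle (M : SuperAtlas.{u} E O) (w : E ⊕ O → ℕ) : Prop where
  weight_le : ∀ c, w c ≤ 1
  dom_full : ∀ i, ∀ x ∈ M.dom i, ∀ y : E → ℝ, (∀ e, w (.inl e) = 0 → y e = x e) → y ∈ M.dom i
  overlap_full : ∀ i j, ∀ x ∈ M.overlap i j, ∀ y : E → ℝ,
    (∀ e, w (.inl e) = 0 → y e = x e) → y ∈ M.overlap i j
  homogeneous : ∀ i j c, ∀ x ∈ M.overlap i j,
    act (euler w) (M.trans i j c) x = w c • M.trans i j c x

/-- The vector field `X` of parity `p` has weight `k`: `[Euler, X] = k X`. -/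
def HasWeight (M : SuperAtlas.{u} E O) (w : E ⊕ O → ℕ) (p : ZMod 2) (k : ℕ)
    (X : M.Idx → VField E O) : Prop :=
  ∀ i c, ∀ x ∈ M.dom i, bracket 0 p (euler w) (X i) c x = k • X i c x

/-- `(M, Q)` is a (super) Lie algebroid `(ΠA, d_A)`: `M = ΠA` is the total space of a super vector
bundle, with fibre coordinates marked by `w`, and `Q = d_A` is a homological vector field of
weight `1`. -/
structure IsLieAlgebroid (M : SuperAtlas.{u} E O) (w : E ⊕ O → ℕ) (Q : M.Idx → VField E O) :
    Prop where
  isSupermanifold : IsSupermanifold M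
  isVectorBundle : IsVectorBundle M w
  isHomological : IsHomological M Q
  weight : HasWeight M w 1 1 Q

/-- `(M, Q₀₁, Q₁₀)` is a double Lie algebroid: `M` is the total space of a double vector bundle
(a coordinate `c` has bi-weight `(w₁ c, w₂ c)`), and `Q₀₁`, `Q₁₀` are commuting homological vector
fields of bi-weights `(0, 1)` and `(1, 0)`. -/
structure IsDoubleLieAlgebroid (M : SuperAtlas.{u} E O) (w₁ w₂ : E ⊕ O → ℕ)
    (Q₀₁ Q₁₀ : M.Idx → VField E O) : Prop where
  isSupermanifold : IsSupermanifold M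
  isVectorBundle₁ : IsVectorBundle M w₁
  isVectorBundle₂ : IsVectorBundle M w₂
  homological₀₁ : IsHomological M Q₀₁
  homological₁₀ : IsHomological M Q₁₀
  commute : Commute M 1 1 Q₀₁ Q₁₀
  weight₀₁ : HasWeight M w₁ 1 0 Q₀₁ ∧ HasWeight M w₂ 1 1 Q₀₁
  weight₁₀ : HasWeight M w₁ 1 1 Q₁₀ ∧ HasWeight M w₂ 1 0 Q₁₀

/-! ## The antitangent bundle

The coordinates of `ΠTM` are the coordinates `x^a` of `M` together with `dx^a`, of opposite parity.
So the even ones are indexed by `E ⊕ O` (`x^e` and `dx^o`) and the odd ones by `O ⊕ E` (`x^o` and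
`dx^e`). -/

/-- The index of `x^a` among the coordinates of `ΠTM`. -/
def baseIdx : E ⊕ O → (E ⊕ O) ⊕ (O ⊕ E)
  | .inl e => .inl (.inl e)
  | .inr o => .inr (.inl o)

/-- The index of `dx^a` among the coordinates of `ΠTM`. -/
def diffIdx : E ⊕ O → (E ⊕ O) ⊕ (O ⊕ E)
  | .inl e => .inr (.inr e)
  | .inr o => .inl (.inr o)

/-- The family with the value `s a` at `x^a` and `t a` at `dx^a`. -/
def antiElim {α : Type*} (s t : E ⊕ O → α) : (E ⊕ O) ⊕ (O ⊕ E) → α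
  | .inl (.inl e) => s (.inl e)
  | .inl (.inr o) => t (.inr o)
  | .inr (.inl o) => s (.inr o)
  | .inr (.inr e) => t (.inl e)

/-- Superfunctions in the coordinates of `M`, seen as superfunctions in those of `ΠTM`. -/
def incl (f : SFun E O) : SFun (E ⊕ O) (O ⊕ E) := fun y =>
  ExteriorAlgebra.map
    (LinearMap.pi (Sum.elim (fun o => LinearMap.proj o) (fun _ => 0)) :
      (O → ℝ) →ₗ[ℝ] (O ⊕ E → ℝ)) (f fun e => y (.inl e))

variable (E O) in
/-- The de Rham differential `d = dx^a ∂/∂x^a` in coordinates. -/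
def deRhamLocal : VField (E ⊕ O) (O ⊕ E) := antiElim (fun c => coord (diffIdx c)) (fun _ => 0)

/-- The interior derivative `i_X = (-1)^p X^a ∂/∂(dx^a)` of a vector field of parity `p`. -/
def interiorLocal (p : ZMod 2) (X : VField E O) : VField (E ⊕ O) (O ⊕ E) :=
  antiElim (fun _ => 0) (fun c => sgn p • incl (X c))

/-- The antitangent bundle `ΠTM`: `dx'^b = dx^a ∂x'^b/∂x^a` under changes of coordinates. -/
def antitangent (M : SuperAtlas.{u} E O) : SuperAtlas.{u} (E ⊕ O) (O ⊕ E) where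
  Idx := M.Idx
  dom i := {y | (fun e => y (.inl e)) ∈ M.dom i}
  overlap i j := {y | (fun e => y (.inl e)) ∈ M.overlap i j}
  trans i j := antiElim (fun c => incl (M.trans i j c))
    (fun c => act (deRhamLocal E O) (incl (M.trans i j c)))

/-- The de Rham differential on `ΠTM`. -/
def deRham (M : SuperAtlas.{u} E O) : (antitangent M).Idx → VField (E ⊕ O) (O ⊕ E) :=
  fun _ => deRhamLocal E O

/-- The interior derivative `i_X` of a vector field of parity `p` on `M`. -/
def interior (M : SuperAtlas.{u} E O) (p : ZMod 2) (X : M.Idx → VField E O) :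
    (antitangent M).Idx → VField (E ⊕ O) (O ⊕ E) :=
  fun i => interiorLocal p (X i)

/-- The Lie derivative `L_X = [d, i_X]` of a vector field of parity `p` on `M`, as a vector field
on `ΠTM`. -/
def lieDerivative (M : SuperAtlas.{u} E O) (p : ZMod 2) (X : M.Idx → VField E O) :
    (antitangent M).Idx → VField (E ⊕ O) (O ⊕ E) :=
  fun i => bracket 1 (p + 1) (deRham M i) (interior M p X i)

variable (E O) in
/-- The weight of `ΠTM → M`: `x^a` has weight `0` and `dx^a` has weight `1`. -/
def formWeight : (E ⊕ O) ⊕ (O ⊕ E) → ℕ := antiElim (fun _ => 0) (fun _ => 1)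

/-- The weight on `ΠTM` induced by a weight on `M`: `x^a` and `dx^a` both have the weight
of `x^a`. -/
def liftWeight (w : E ⊕ O → ℕ) : (E ⊕ O) ⊕ (O ⊕ E) → ℕ := antiElim w w

end Super

end

open scoped ContDiff

noncomputable section

set_option linter.unusedSectionVars false

namespace Super

universe u

/-! ## Signs and Grassmann algebras -/

section Grassmann

/-! Let `J` be the Jacobian matrix of a coordinate change of ΠA. On ΠTΠA the new `x'` do not involve
`dx`, and `dx'^b = dx^a ∂x'^b/∂x^a`. In the order `(x, dx)` the Jacobian matrix is therefore block
triangular with `J` twice on the diagonal, the second time with all parities reversed. Reversing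
parities inverts the Berezinian, so the total Berezinian is `1` (`IsMorphism.ber_antitangentMap`),
and the coordinate volumes agree on overlaps.

If `J` has the blocks `a b c d`, the claim amounts to `det (a - b d⁻¹ c) * det (d - c a⁻¹ b) = det a
* det d`. Taking out `a` and `d` leaves `det (1 - pq) * det (1 - qp) = 1` for matrices `p`, `q` of
odd elements (`det_one_sub_mul_det_one_sub`). There `det (1 - tpq) * det (1 - tqp)` has derivative
zero in `t`, by Jacobi's formula and `tr (pq) = -tr (qp)`.

The Lie derivative along an odd field `X` has the components `X^c` along `x^c` and `-d(X^c)` along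
`dx^c`. The `dx^c`-derivative of the latter is `-∂_c X^c`, which cancels the `x^c`-derivative of the
former. The differential `d` contributes nothing, so `Q` has divergence zero. As all Berezinians are
`1`, the density `ρ` of any other volume is a global even invertible function, and `Div_ρ Q = ρ⁻¹
Q(ρ) = Q(log |ρ|)`. This is exact, and closed because `Q² = 0`.

The double Lie algebroid axioms follow from `d² = 0`, from the naturality of `d` under antitangent
maps, and from the commutators of `d` with the Lie derivative and with the Euler fields. It suffices
to check them on the coordinates `x` and `dx`.

Most of the work is the calculus underneath: the pullback, a finite Taylor sum, has to be
multiplicative, functorial and subject to the chain rule. Only the chain rule for odd derivatives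
(`oddD_subst`) is read off the Taylor sum. The rest uses that an element of a Grassmann algebra
vanishes when its body and all its odd derivatives do (`eq_zero_of_oddD_eq_zero`). For identities
quantified over all smooth `F` this becomes an induction (`family_eq_zero`): the defect for `F` has
no body, and its odd derivatives are combinations of defects for derivatives of `F`. So the defects
lie ever deeper in a nilpotent filtration. -/

theorem sgn_zero : sgn 0 = 1 := by simp [sgn]

theorem sgn_one : sgn 1 = -1 := by simp [sgn, ZMod.val_one]

theorem zmod_two_cases (p : ZMod 2) : p = 0 ∨ p = 1 := by
  fin_cases p
  · exact Or.inl rfl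
  · exact Or.inr rfl

theorem one_add_one_zmod_two : (1 + 1 : ZMod 2) = 0 := rfl

theorem sgn_add (p q : ZMod 2) : sgn (p + q) = sgn p * sgn q := by
  rcases zmod_two_cases p with rfl | rfl <;> rcases zmod_two_cases q with rfl | rfl <;>
    simp [sgn_zero, sgn_one, one_add_one_zmod_two]

theorem sgn_mul_self (p : ZMod 2) : sgn p * sgn p = 1 := by
  rcases zmod_two_cases p with rfl | rfl <;> simp [sgn_zero, sgn_one]

/-! ### Parity and the grading involution -/

variable {O O' : Type*}

/-- The power `p` of the grading involution. -/
def twist (p : ZMod 2) : Gr O →ₐ[ℝ] Gr O :=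
  if p = 0 then AlgHom.id ℝ (Gr O) else CliffordAlgebra.involute

theorem twist_zero (a : Gr O) : twist 0 a = a := by simp [twist]

theorem twist_one_ι (v : O → ℝ) :
    twist 1 (ExteriorAlgebra.ι ℝ v) = -ExteriorAlgebra.ι ℝ v := by
  rw [twist, if_neg one_ne_zero]
  exact CliffordAlgebra.involute_ι v

theorem twist_of_mem {p q : ZMod 2} {a : Gr O} (ha : a ∈ parityPart O q) :
    twist p a = sgn (p * q) • a := by
  rcases zmod_two_cases p with rfl | rfl
  · simp [twist_zero, sgn_zero]
  · rw [one_mul]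
    rcases zmod_two_cases q with rfl | rfl
    · rw [sgn_zero, one_smul]
      induction a, ha using CliffordAlgebra.even_induction with
      | algebraMap r => exact AlgHom.commutes _ r
      | add x y _ _ hx hy => rw [map_add, hx, hy]
      | ι_mul_ι_mul m n x _ hx =>
        have h := fun v : O → ℝ => twist_one_ι v
        rw [map_mul, map_mul, hx]
        erw [h m, h n]
        rw [neg_mul_neg]
    · rw [sgn_one, neg_one_smul]
      induction a, ha using CliffordAlgebra.odd_induction with
      | ι v => exact twist_one_ι v
      | add x y _ _ hx hy => rw [map_add, hx, hy, neg_add]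
      | ι_mul_ι_mul m n x _ hx =>
        have h := fun v : O → ℝ => twist_one_ι v
        rw [map_mul, map_mul, hx]
        erw [h m, h n]
        rw [neg_mul_neg, mul_neg]

/-- The eigenvalue equation kills the component of the wrong parity, since `2` is invertible. Parity
thus becomes an equation for `twist 1`, and an operation respects parity as soon as it commutes with
`twist 1` up to sign. -/
theorem mem_parityPart_of_twist_one {q : ZMod 2} {a : Gr O} (h : twist 1 a = sgn q • a) :
    a ∈ parityPart O q := by
  have htop : a ∈ parityPart O 0 ⊔ parityPart O 1 := by
    rw [(CliffordAlgebra.evenOdd_isCompl (0 : QuadraticForm ℝ (O → ℝ))).sup_eq_top]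
    exact Submodule.mem_top
  obtain ⟨y, hy, z, hz, rfl⟩ := Submodule.mem_sup.1 htop
  rw [map_add, twist_of_mem hy, twist_of_mem hz] at h
  rcases zmod_two_cases q with rfl | rfl
  · simp only [mul_zero, mul_one, sgn_zero, sgn_one, one_smul, neg_one_smul] at h
    have h2 : (2 : ℝ) • z = 0 := by
      have := add_left_cancel h
      rw [two_smul]; nth_rewrite 1 [← this]; simp
    rw [(smul_eq_zero.1 h2).resolve_left two_ne_zero, add_zero]; exact hy
  · simp only [mul_zero, mul_one, sgn_zero, sgn_one, one_smul, neg_one_smul, neg_add] at h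
    have h2 : (2 : ℝ) • y = 0 := by
      have := add_right_cancel h
      rw [two_smul]; nth_rewrite 1 [this]; simp
    rw [(smul_eq_zero.1 h2).resolve_left two_ne_zero, zero_add]; exact hz

theorem mem_parityPart_iff {q : ZMod 2} {a : Gr O} :
    a ∈ parityPart O q ↔ twist 1 a = sgn q • a :=
  ⟨fun h => by rw [twist_of_mem h, one_mul], mem_parityPart_of_twist_one⟩

theorem mul_mem_parityPart {p q : ZMod 2} {a b : Gr O} (ha : a ∈ parityPart O p)
    (hb : b ∈ parityPart O q) : a * b ∈ parityPart O (p + q) :=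
  CliffordAlgebra.evenOdd_mul_le _ p q (Submodule.mul_mem_mul ha hb)

theorem algebraMap_mem_parityPart (r : ℝ) : algebraMap ℝ (Gr O) r ∈ parityPart O 0 :=
  mem_parityPart_iff.2 (by rw [AlgHom.commutes, sgn_zero, one_smul])

theorem ι_mem_parityPart (v : O → ℝ) : ExteriorAlgebra.ι ℝ v ∈ parityPart O 1 :=
  mem_parityPart_iff.2 (by rw [twist_one_ι, sgn_one, neg_one_smul])

theorem ι_mul_eq (v : O → ℝ) (a : Gr O) :
    ExteriorAlgebra.ι ℝ v * a = twist 1 a * ExteriorAlgebra.ι ℝ v := by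
  induction a using ExteriorAlgebra.induction with
  | algebraMap r => rw [AlgHom.commutes]; exact (Algebra.commutes r _).symm
  | ι w =>
    rw [twist_one_ι, neg_mul]
    exact eq_neg_of_add_eq_zero_left (ExteriorAlgebra.ι_add_mul_swap v w)
  | mul x y hx hy => rw [← mul_assoc, hx, mul_assoc, hy, ← mul_assoc, map_mul]
  | add x y hx hy => rw [mul_add, hx, hy, map_add, add_mul]

/-- Supercommutation. -/
theorem mul_eq_twist_mul {p : ZMod 2} {a : Gr O} (ha : a ∈ parityPart O p) (b : Gr O) :
    a * b = twist p b * a := by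
  rcases zmod_two_cases p with rfl | rfl
  · rw [twist_zero, even_mul_comm a ha]
  · induction a, ha using CliffordAlgebra.odd_induction with
    | ι v => exact ι_mul_eq v b
    | add x y _ _ hx hy => rw [add_mul, hx, hy, mul_add]
    | ι_mul_ι_mul m n x _ hx =>
      rw [mul_assoc, hx, ← mul_assoc, even_mul_comm _
        (CliffordAlgebra.ι_mul_ι_mem_evenOdd_zero _ m n) (twist 1 b), mul_assoc]

theorem mul_comm_of_mem {p q : ZMod 2} {a b : Gr O} (ha : a ∈ parityPart O p)
    (hb : b ∈ parityPart O q) : a * b = sgn (p * q) • (b * a) := by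
  rw [mul_eq_twist_mul ha, twist_of_mem hb, smul_mul_assoc]

theorem mul_self_of_odd {a : Gr O} (ha : a ∈ parityPart O 1) : a * a = 0 := by
  have h := mul_comm_of_mem ha ha
  rw [mul_one, sgn_one, neg_one_smul] at h
  have h2 : (2 : ℝ) • (a * a) = 0 := by rw [two_smul]; nth_rewrite 1 [h]; simp
  exact (smul_eq_zero.1 h2).resolve_left two_ne_zero

/-! ### The body -/

/-- The body, as a homomorphism of algebras. -/
abbrev bodyHom (O : Type*) : Gr O →ₐ[ℝ] ℝ := ExteriorAlgebra.algebraMapInv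

theorem body_mul (a b : Gr O) : body (a * b) = body a * body b := map_mul (bodyHom O) a b

theorem body_add (a b : Gr O) : body (a + b) = body a + body b := map_add (bodyHom O) a b

theorem body_sub (a b : Gr O) : body (a - b) = body a - body b := map_sub (bodyHom O) a b

theorem body_smul (r : ℝ) (a : Gr O) : body (r • a) = r * body a := map_smul (bodyHom O) r a

theorem body_sum {ι : Type*} (s : Finset ι) (f : ι → Gr O) :
    body (∑ i ∈ s, f i) = ∑ i ∈ s, body (f i) := map_sum (bodyHom O) f s

theorem body_algebraMap (r : ℝ) : body (algebraMap ℝ (Gr O) r) = r :=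
  ExteriorAlgebra.algebraMap_leftInverse _ r

theorem body_ι (v : O → ℝ) : body (ExteriorAlgebra.ι ℝ v) = 0 := by
  simp [body, ExteriorAlgebra.algebraMapInv]

theorem body_twist (p : ZMod 2) (a : Gr O) : body (twist p a) = body a := by
  induction a using ExteriorAlgebra.induction with
  | algebraMap r => rw [AlgHom.commutes]
  | ι w =>
    rw [twist_of_mem (ι_mem_parityPart w), body_smul, body_ι, mul_zero]
  | mul x y hx hy => rw [map_mul, body_mul, hx, hy, body_mul]
  | add x y hx hy => rw [map_add, body_add, hx, hy, body_add]

theorem body_of_odd {a : Gr O} (ha : a ∈ parityPart O 1) : body a = 0 := by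
  have h := body_twist 1 a
  rw [twist_of_mem ha, one_mul, sgn_one, body_smul] at h
  linarith

theorem body_map (f : (O → ℝ) →ₗ[ℝ] (O' → ℝ)) (a : Gr O) :
    body (ExteriorAlgebra.map f a) = body a := by
  induction a using ExteriorAlgebra.induction with
  | algebraMap r => rw [AlgHom.commutes, body_algebraMap, body_algebraMap]
  | ι w => rw [ExteriorAlgebra.map_apply_ι, body_ι, body_ι]
  | mul x y hx hy => rw [map_mul, body_mul, hx, hy, body_mul]
  | add x y hx hy => rw [map_add, body_add, hx, hy, body_add]

theorem twist_map (p : ZMod 2) (f : (O → ℝ) →ₗ[ℝ] (O' → ℝ)) (a : Gr O) :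
    twist p (ExteriorAlgebra.map f a) = ExteriorAlgebra.map f (twist p a) := by
  induction a using ExteriorAlgebra.induction with
  | algebraMap r => simp only [AlgHom.commutes]
  | ι w =>
    rw [twist_of_mem (ι_mem_parityPart w), ExteriorAlgebra.map_apply_ι,
      twist_of_mem (ι_mem_parityPart _), map_smul, ExteriorAlgebra.map_apply_ι]
  | mul x y hx hy => simp only [map_mul, hx, hy]
  | add x y hx hy => simp only [map_add, hx, hy]

theorem map_mem_parityPart {p : ZMod 2} (f : (O → ℝ) →ₗ[ℝ] (O' → ℝ)) {a : Gr O}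
    (ha : a ∈ parityPart O p) : ExteriorAlgebra.map f a ∈ parityPart O' p := by
  rw [mem_parityPart_iff] at *
  rw [twist_map, ha, map_smul]

/-! ### Odd derivatives -/

/-- The contraction with a covector, as a linear endomorphism. -/
def contr (d : Module.Dual ℝ (O → ℝ)) : Gr O →ₗ[ℝ] Gr O :=
  CliffordAlgebra.contractLeft (Q := (0 : QuadraticForm ℝ (O → ℝ))) d

/-- The left derivative with respect to an odd generator. -/
def oddD (o : O) : Gr O →ₗ[ℝ] Gr O := contr (LinearMap.proj o)

theorem contr_algebraMap (d : Module.Dual ℝ (O → ℝ)) (r : ℝ) :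
    contr d (algebraMap ℝ (Gr O) r) = 0 :=
  CliffordAlgebra.contractLeft_algebraMap (0 : QuadraticForm ℝ (O → ℝ)) d r

theorem contr_ι (d : Module.Dual ℝ (O → ℝ)) (v : O → ℝ) :
    contr d (ExteriorAlgebra.ι ℝ v) = algebraMap ℝ (Gr O) (d v) :=
  CliffordAlgebra.contractLeft_ι (0 : QuadraticForm ℝ (O → ℝ)) d v

theorem contr_mul (d : Module.Dual ℝ (O → ℝ)) (a b : Gr O) :
    contr d (a * b) = contr d a * b + twist 1 a * contr d b := by
  induction a using CliffordAlgebra.left_induction generalizing b with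
  | algebraMap r =>
    have h1 : contr d (algebraMap ℝ (Gr O) r) = 0 := contr_algebraMap d r
    have h2 : twist 1 (algebraMap ℝ (Gr O) r) = algebraMap ℝ (Gr O) r := AlgHom.commutes _ r
    have h3 : contr d (algebraMap ℝ (Gr O) r * b) = algebraMap ℝ (Gr O) r * contr d b :=
      CliffordAlgebra.contractLeft_algebraMap_mul _ _ _
    erw [h1, h2, h3]; simp
  | add x y hx hy => rw [add_mul, map_add, hx, hy, map_add, map_add]; noncomm_ring
  | ι_mul x m hx =>
    have h : ∀ c : Gr O, contr d (CliffordAlgebra.ι 0 m * c)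
        = d m • c - CliffordAlgebra.ι 0 m * contr d c :=
      fun c => CliffordAlgebra.contractLeft_ι_mul (Q := (0 : QuadraticForm ℝ (O → ℝ))) d m c
    have h' : twist 1 (CliffordAlgebra.ι (0 : QuadraticForm ℝ (O → ℝ)) m)
      = -CliffordAlgebra.ι (0 : QuadraticForm ℝ (O → ℝ)) m := twist_one_ι m
    rw [mul_assoc, h, hx, h, map_mul, h', sub_mul, smul_mul_assoc]
    noncomm_ring

theorem oddD_algebraMap (o : O) (r : ℝ) : oddD o (algebraMap ℝ (Gr O) r) = 0 :=
  contr_algebraMap _ r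

theorem oddD_mul (o : O) (a b : Gr O) :
    oddD o (a * b) = oddD o a * b + twist 1 a * oddD o b := contr_mul _ a b

theorem oddD_comm (o o' : O) (a : Gr O) : oddD o (oddD o' a) = -oddD o' (oddD o a) :=
  CliffordAlgebra.contractLeft_comm _ _ _

theorem oddD_oddD_self (o : O) (a : Gr O) : oddD o (oddD o a) = 0 :=
  CliffordAlgebra.contractLeft_contractLeft _ _

theorem twist_contr (d : Module.Dual ℝ (O → ℝ)) (a : Gr O) :
    contr d (twist 1 a) = -twist 1 (contr d a) := by
  induction a using ExteriorAlgebra.induction with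
  | algebraMap r => rw [AlgHom.commutes, contr_algebraMap, map_zero, neg_zero]
  | ι w => rw [twist_one_ι, map_neg, contr_ι, AlgHom.commutes]
  | mul x y hx hy =>
    rw [map_mul, contr_mul, contr_mul, hx, hy, map_add, map_mul, map_mul]; noncomm_ring
  | add x y hx hy => rw [map_add, map_add, hx, hy, map_add, map_add]; abel

theorem oddD_twist (o : O) (p : ZMod 2) (a : Gr O) :
    oddD o (twist p a) = sgn p • twist p (oddD o a) := by
  rcases zmod_two_cases p with rfl | rfl
  · simp [twist_zero, sgn_zero]
  · rw [sgn_one, neg_one_smul]; exact twist_contr _ a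

theorem oddD_mem {p : ZMod 2} (o : O) {a : Gr O} (ha : a ∈ parityPart O p) :
    oddD o a ∈ parityPart O (p + 1) := by
  rw [mem_parityPart_iff] at *
  have h := oddD_twist o 1 a
  rw [ha, map_smul, sgn_one, neg_one_smul] at h
  rw [← neg_eq_iff_eq_neg.2 h, sgn_add, sgn_one, mul_neg_one, neg_smul]

theorem oddD_mem_of_odd (o : O) {a : Gr O} (ha : a ∈ parityPart O 1) :
    oddD o a ∈ parityPart O 0 := by
  have h := oddD_mem o ha
  rwa [one_add_one_zmod_two] at h

theorem oddD_mem_of_even (o : O) {a : Gr O} (ha : a ∈ parityPart O 0) :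
    oddD o a ∈ parityPart O 1 := by
  have h := oddD_mem o ha
  rwa [zero_add] at h

theorem contr_map (f : (O → ℝ) →ₗ[ℝ] (O' → ℝ)) (d : Module.Dual ℝ (O' → ℝ)) (a : Gr O) :
    contr d (ExteriorAlgebra.map f a) = ExteriorAlgebra.map f (contr (d ∘ₗ f) a) := by
  induction a using ExteriorAlgebra.induction with
  | algebraMap r => rw [AlgHom.commutes, contr_algebraMap, contr_algebraMap, map_zero]
  | ι w => rw [ExteriorAlgebra.map_apply_ι, contr_ι, contr_ι, AlgHom.commutes]; rfl
  | mul x y hx hy => simp only [map_mul, map_add, contr_mul, hx, hy, twist_map]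
  | add x y hx hy => simp only [map_add, hx, hy]

/-! ### Elements determined by their body and their odd derivatives -/

section

variable [DecidableEq O]

theorem oddD_ι_single (o o' : O) :
    oddD o (ExteriorAlgebra.ι ℝ (Pi.single o' 1 : O → ℝ)) = if o = o' then 1 else 0 := by
  rw [oddD, contr_ι, LinearMap.proj_apply, Pi.single_apply]
  split_ifs <;> simp

/-- The linear map that sets the coordinates in `s` to zero. -/
def maskMap (s : Finset O) : (O → ℝ) →ₗ[ℝ] (O → ℝ) :=
  LinearMap.pi fun o => if o ∈ s then 0 else LinearMap.proj o

theorem maskMap_apply (s : Finset O) (v : O → ℝ) (o : O) :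
    maskMap s v o = if o ∈ s then 0 else v o := by
  simp only [maskMap, LinearMap.pi_apply]
  split_ifs <;> rfl

/-- This is the Taylor formula in a single odd variable `ξ`, exact at first order because `ξ² = 0`.
-/
theorem map_maskMap_singleton_add (o : O) (g : Gr O) :
    ExteriorAlgebra.map (maskMap {o}) g
      + ExteriorAlgebra.ι ℝ (Pi.single o 1 : O → ℝ) * oddD o g = g := by
  induction g using CliffordAlgebra.left_induction with
  | algebraMap r =>
    have h1 : oddD o (algebraMap ℝ (Gr O) r) = 0 := oddD_algebraMap o r
    have h2 : ExteriorAlgebra.map (maskMap {o}) (algebraMap ℝ (Gr O) r) = algebraMap ℝ (Gr O) r :=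
      AlgHom.commutes _ r
    erw [h1, h2]; rw [mul_zero, add_zero]
  | add x y hx hy =>
    nth_rewrite 3 [← hx]
    nth_rewrite 3 [← hy]
    rw [map_add, map_add, mul_add]; abel
  | ι_mul x m hx =>
    change ExteriorAlgebra.map (maskMap {o}) (ExteriorAlgebra.ι ℝ m * x)
      + ExteriorAlgebra.ι ℝ (Pi.single o 1 : O → ℝ) * oddD o (ExteriorAlgebra.ι ℝ m * x)
      = ExteriorAlgebra.ι ℝ m * x
    have hm : maskMap {o} m = m - m o • (Pi.single o 1 : O → ℝ) := by
      ext o'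
      rw [maskMap_apply]
      by_cases h : o' = o
      · subst h; simp
      · simp [h]
    have ho : oddD o (ExteriorAlgebra.ι ℝ m) = algebraMap ℝ (Gr O) (m o) := contr_ι _ m
    set ξ := ExteriorAlgebra.ι ℝ (Pi.single o 1 : O → ℝ) with hξ
    have hsq : ξ * ξ = 0 := ExteriorAlgebra.ι_sq_zero _
    have hanti : ξ * ExteriorAlgebra.ι ℝ m = -(ExteriorAlgebra.ι ℝ m * ξ) :=
      eq_neg_of_add_eq_zero_left (ExteriorAlgebra.ι_add_mul_swap _ _)
    rw [map_mul, ExteriorAlgebra.map_apply_ι, hm, oddD_mul, ho, twist_one_ι, map_sub, map_smul,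
      ← hξ, ← Algebra.smul_def, mul_add, mul_smul_comm, neg_mul, mul_neg, ← mul_assoc, hanti,
      neg_mul, neg_neg, sub_mul, smul_mul_assoc]
    -- `x` differs from its masked version by a multiple of `ξ`, which `ξ` annihilates.
    have hξx : ξ * x = ξ * ExteriorAlgebra.map (maskMap {o}) x := by
      conv_lhs => rw [← hx]
      rw [mul_add, ← mul_assoc ξ ξ, hsq, zero_mul, add_zero]
    conv_rhs => rw [← hx]
    rw [hξx, mul_add, mul_assoc]
    abel

theorem map_maskMap_of_oddD_eq_zero {g : Gr O} (hg : ∀ o, oddD o g = 0) (s : Finset O) :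
    ExteriorAlgebra.map (maskMap s) g = g := by
  induction s using Finset.induction_on with
  | empty =>
    have : maskMap (∅ : Finset O) = LinearMap.id := by
      ext v o; simp [maskMap]
    rw [this, ExteriorAlgebra.map_id]; rfl
  | insert o s _ ih =>
    have : maskMap (insert o s) = maskMap {o} ∘ₗ maskMap s := by
      apply LinearMap.ext; intro v; ext o'
      rw [LinearMap.comp_apply, maskMap_apply, maskMap_apply, maskMap_apply]
      by_cases h : o' = o <;> simp [h]
    have h1 := map_maskMap_singleton_add o g
    rw [hg o, mul_zero, add_zero] at h1
    rw [this, ← ExteriorAlgebra.map_comp_map, AlgHom.comp_apply, ih, h1]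

/-- With vanishing derivatives, the Taylor formula shows that setting generators to zero one after
another changes nothing. Once all of them are zero, only the body remains. -/
theorem eq_zero_of_oddD_eq_zero [Fintype O] {g : Gr O} (hb : body g = 0)
    (hg : ∀ o, oddD o g = 0) : g = 0 := by
  have h := map_maskMap_of_oddD_eq_zero hg Finset.univ
  have h0 : ∀ a : Gr O, ExteriorAlgebra.map (maskMap Finset.univ) a
      = algebraMap ℝ (Gr O) (body a) := by
    intro a
    induction a using ExteriorAlgebra.induction with
    | algebraMap r => rw [AlgHom.commutes, body_algebraMap]
    | ι w =>
      rw [ExteriorAlgebra.map_apply_ι, body_ι, map_zero,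
        show maskMap Finset.univ w = 0 from by ext o; simp [maskMap_apply], map_zero]
    | mul x y hx hy => rw [map_mul, hx, hy, body_mul, map_mul]
    | add x y hx hy => rw [map_add, hx, hy, body_add, map_add]
  rw [← h, h0, hb, map_zero]

end

/-- The filtration of the Grassmann algebra by the number of generators. -/
def filt : ℕ → Submodule ℝ (Gr O)
  | 0 => ⊤
  | k + 1 => LinearMap.ker (bodyHom O).toLinearMap ⊓ ⨅ o, (filt k).comap (oddD o)

/-- For finite `O`, level `k` consists of the combinations of products of at least `k` generators.
The description by derivatives is the one that inductions can use. -/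
theorem mem_filt_succ {k : ℕ} {g : Gr O} :
    g ∈ filt (k + 1) ↔ body g = 0 ∧ ∀ o, oddD o g ∈ filt k := by
  simp only [filt, Submodule.mem_inf, Submodule.mem_iInf, Submodule.mem_comap, LinearMap.mem_ker]
  rfl

theorem mem_filt_zero (g : Gr O) : g ∈ filt 0 := Submodule.mem_top

theorem mem_filt_one {g : Gr O} : g ∈ filt 1 ↔ body g = 0 := by
  rw [mem_filt_succ]; simp [filt]

theorem filt_succ_le (k : ℕ) : (filt (k + 1) : Submodule ℝ (Gr O)) ≤ filt k := by
  induction k with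
  | zero => exact fun g _ => mem_filt_zero g
  | succ k ih =>
    intro g hg
    rw [mem_filt_succ] at hg ⊢
    exact ⟨hg.1, fun o => ih (hg.2 o)⟩

theorem filt_antitone : Antitone (filt : ℕ → Submodule ℝ (Gr O)) :=
  antitone_nat_of_succ_le filt_succ_le

theorem mul_mem_filt {k : ℕ} {g : Gr O} (a : Gr O) (hg : g ∈ filt k) : a * g ∈ filt k := by
  induction k generalizing a g with
  | zero => exact mem_filt_zero _
  | succ k ih =>
    have hg' := filt_succ_le k hg
    rw [mem_filt_succ] at hg ⊢
    refine ⟨by rw [body_mul, hg.1, mul_zero], fun o => ?_⟩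
    rw [oddD_mul]
    exact add_mem (ih _ hg') (ih _ (hg.2 o))

theorem twist_mem_filt {k : ℕ} {g : Gr O} (p : ZMod 2) (hg : g ∈ filt k) : twist p g ∈ filt k := by
  induction k generalizing g with
  | zero => exact mem_filt_zero _
  | succ k ih =>
    rw [mem_filt_succ] at hg ⊢
    refine ⟨by rw [body_twist, hg.1], fun o => ?_⟩
    rw [oddD_twist]
    exact Submodule.smul_mem _ _ (ih (hg.2 o))

theorem mul_mem_filt_add {j k : ℕ} {a g : Gr O} (ha : a ∈ filt j) (hg : g ∈ filt k) :
    a * g ∈ filt (j + k) := by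
  induction hn : j + k generalizing j k a g with
  | zero => exact mem_filt_zero _
  | succ n ih =>
    rcases j with _ | j
    · rw [zero_add] at hn; subst hn; exact mul_mem_filt a hg
    rcases k with _ | k
    -- With `g` at level `0`, its derivative is again at level `0`. In the Leibniz term that
    -- differentiates `g`, it is enough to know `a` one level lower.
    · rw [mem_filt_succ]
      have hj : j = n := by omega
      subst hj
      have ha' := ha
      rw [mem_filt_succ] at ha
      refine ⟨by rw [body_mul, ha.1, zero_mul], fun o => ?_⟩
      rw [oddD_mul]
      refine add_mem (ih (ha.2 o) (mem_filt_zero _) rfl) ?_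
      exact ih (twist_mem_filt 1 (filt_succ_le _ ha')) (mem_filt_zero _) rfl
    · have ha' := ha
      have hg' := hg
      rw [mem_filt_succ] at ha hg ⊢
      refine ⟨by rw [body_mul, ha.1, zero_mul], fun o => ?_⟩
      rw [oddD_mul]
      exact add_mem (ih (ha.2 o) hg' (by omega)) (ih (twist_mem_filt 1 ha') (hg.2 o) (by omega))

section

variable [DecidableEq O] [Fintype O]

/-- Here `s` contains all generators on which `g` depends. Each derivative removes one of them while
lowering the level by one, so the level is still positive when none is left. -/
theorem eq_zero_of_mem_filt {g : Gr O} (s : Finset O) (hs : ∀ o, o ∉ s → oddD o g = 0)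
    (hg : g ∈ filt (s.card + 1)) : g = 0 := by
  induction hn : s.card generalizing s g with
  | zero =>
    refine eq_zero_of_oddD_eq_zero (mem_filt_succ.1 hg).1 fun o => hs o ?_
    rw [Finset.card_eq_zero.1 hn]; exact Finset.notMem_empty o
  | succ n ih =>
    refine eq_zero_of_oddD_eq_zero (mem_filt_succ.1 hg).1 fun o => ?_
    by_cases ho : o ∈ s
    · have hc : (s.erase o).card = n := by rw [Finset.card_erase_of_mem ho]; omega
      refine ih (s.erase o) (fun o' ho' => ?_) ?_ hc
      · by_cases h : o' = o
        · rw [h, oddD_oddD_self]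
        · rw [oddD_comm, hs o' fun hmem => ho' (Finset.mem_erase.2 ⟨h, hmem⟩), map_zero, neg_zero]
      · rw [hc, ← hn]; exact (mem_filt_succ.1 hg).2 o
    · exact hs o ho

theorem eq_zero_of_mem_filt_card {g : Gr O} (hg : g ∈ filt (Fintype.card O + 1)) : g = 0 :=
  eq_zero_of_mem_filt Finset.univ (fun o ho => absurd (Finset.mem_univ o) ho) hg

theorem eq_zero_of_forall_mem_filt {g : Gr O} (hg : ∀ k, g ∈ filt k) : g = 0 :=
  eq_zero_of_mem_filt_card (hg _)

/-- A family of elements without body whose odd derivatives are combinations of members of the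
family vanishes. -/
theorem family_eq_zero {ι : Type*} (Δ : ι → Gr O) (hb : ∀ i, body (Δ i) = 0)
    (hd : ∀ k : ℕ, (∀ i, Δ i ∈ filt k) → ∀ i o, oddD o (Δ i) ∈ filt k) (i : ι) : Δ i = 0 := by
  -- The whole family climbs the filtration together: if all members are at level `k`, so are their
  -- derivatives, and as the bodies vanish all members are at level `k + 1`.
  have h : ∀ k, ∀ i, Δ i ∈ filt k := by
    intro k
    induction k with
    | zero => exact fun i => mem_filt_zero _
    | succ k ih => exact fun i => mem_filt_succ.2 ⟨hb i, hd k ih i⟩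
  exact eq_zero_of_forall_mem_filt fun k => h k i

/-- The element is an invertible real number plus a nilpotent: the `k`-th power of the part without
body is at level `k` of the filtration. -/
theorem isUnit_of_body_ne_zero {a : Gr O} (ha : body a ≠ 0) : IsUnit a := by
  have hn : (a - algebraMap ℝ (Gr O) (body a)) ∈ filt 1 := by
    rw [mem_filt_one, body_sub, body_algebraMap, sub_self]
  have hp : ∀ k, (a - algebraMap ℝ (Gr O) (body a)) ^ k ∈ filt k := by
    intro k
    induction k with
    | zero => exact mem_filt_zero _
    | succ k ih => rw [pow_succ']; rw [add_comm k]; exact mul_mem_filt_add hn ih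
  have hnil : IsNilpotent (a - algebraMap ℝ (Gr O) (body a)) :=
    ⟨_, eq_zero_of_mem_filt_card (hp _)⟩
  have hu : IsUnit (algebraMap ℝ (Gr O) (body a)) := (IsUnit.mk0 _ ha).map _
  have := hnil.isUnit_add_left_of_commute hu (Algebra.commutes _ _).symm
  rwa [add_sub_cancel] at this

theorem isUnit_iff_body_ne_zero {a : Gr O} : IsUnit a ↔ body a ≠ 0 :=
  ⟨fun h => (h.map (bodyHom O)).ne_zero, isUnit_of_body_ne_zero⟩

end

end Grassmann

/-! ## Calculus of superfunctions -/

section Calculus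

open Filter Topology

variable {E O E' O' : Type*} [Fintype E] [DecidableEq E] [Fintype O] [DecidableEq O]
  [Fintype E'] [DecidableEq E'] [Fintype O'] [DecidableEq O']
  {W : Type*} [NormedAddCommGroup W] [NormedSpace ℝ W]

/-- Multiplication of `Gr O` as a continuous bilinear map. -/
def mulL (O : Type*) [Fintype O] : Gr O →L[ℝ] Gr O →L[ℝ] Gr O :=
  LinearMap.toContinuousLinearMap
    (LinearMap.toContinuousLinearMap.toLinearMap ∘ₗ LinearMap.mul ℝ (Gr O))

theorem mulL_apply (a b : Gr O) : mulL O a b = a * b := rfl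

theorem contDiffOn_mul {n : WithTop ℕ∞} {V : Set W} {F G : W → Gr O}
    (hF : ContDiffOn ℝ n F V) (hG : ContDiffOn ℝ n G V) :
    ContDiffOn ℝ n (fun x => F x * G x) V :=
  (mulL O).isBoundedBilinearMap.contDiff.comp_contDiffOn (hF.prodMk hG)

theorem contDiffOn_linear {n : WithTop ℕ∞} {V : Set W} {F : W → Gr O}
    (L : Gr O →ₗ[ℝ] Gr O') (hF : ContDiffOn ℝ n F V) :
    ContDiffOn ℝ n (fun x => L (F x)) V :=
  (LinearMap.toContinuousLinearMap L).contDiff.comp_contDiffOn hF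

theorem contDiffOn_body {n : WithTop ℕ∞} {V : Set W} {F : W → Gr O}
    (hF : ContDiffOn ℝ n F V) : ContDiffOn ℝ n (fun x => body (F x)) V :=
  (LinearMap.toContinuousLinearMap (bodyHom O).toLinearMap).contDiff.comp_contDiffOn hF

theorem contDiffOn_algebraMap {n : WithTop ℕ∞} {V : Set W} {f : W → ℝ}
    (hf : ContDiffOn ℝ n f V) : ContDiffOn ℝ n (fun x => algebraMap ℝ (Gr O) (f x)) V :=
  (LinearMap.toContinuousLinearMap (Algebra.linearMap ℝ (Gr O))).contDiff.comp_contDiffOn hf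

theorem fderiv_mul_apply {F G : W → Gr O} {x : W} (hF : DifferentiableAt ℝ F x)
    (hG : DifferentiableAt ℝ G x) (v : W) :
    fderiv ℝ (fun y => F y * G y) x v = fderiv ℝ F x v * G x + F x * fderiv ℝ G x v := by
  have h := ((mulL O).isBoundedBilinearMap.hasFDerivAt (F x, G x)).comp x
    (hF.hasFDerivAt.prodMk hG.hasFDerivAt)
  have h' : HasFDerivAt (fun y => F y * G y) _ x := h
  rw [h'.fderiv]
  simp [mulL_apply, add_comm]

theorem fderiv_linear_apply {F : W → Gr O} {x : W} (L : Gr O →ₗ[ℝ] Gr O')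
    (hF : DifferentiableAt ℝ F x) (v : W) :
    fderiv ℝ (fun y => L (F y)) x v = L (fderiv ℝ F x v) := by
  have h := ((LinearMap.toContinuousLinearMap L).hasFDerivAt (x := F x)).comp x hF.hasFDerivAt
  have h' : HasFDerivAt (fun y => L (F y)) _ x := h
  rw [h'.fderiv]; rfl

theorem differentiableAt_of_contDiffOn {Z : Type*} [NormedAddCommGroup Z] [NormedSpace ℝ Z]
    {V : Set W} {F : W → Z} {x : W} (hV : IsOpen V) (hF : ContDiffOn ℝ ∞ F V) (hx : x ∈ V) :
    DifferentiableAt ℝ F x :=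
  (hF.contDiffAt (hV.mem_nhds hx)).differentiableAt (by simp)

theorem contDiffOn_fderiv_apply {Z : Type*} [NormedAddCommGroup Z] [NormedSpace ℝ Z]
    {V : Set W} {F : W → Z} (hV : IsOpen V) (hF : ContDiffOn ℝ ∞ F V) (v : W) :
    ContDiffOn ℝ ∞ (fun x => fderiv ℝ F x v) V :=
  (hF.fderiv_of_isOpen hV (by simp)).clm_apply contDiffOn_const

theorem fderiv_fderiv_comm {Z : Type*} [NormedAddCommGroup Z] [NormedSpace ℝ Z]
    {V : Set W} {F : W → Z} {x : W} (hV : IsOpen V) (hF : ContDiffOn ℝ ∞ F V) (hx : x ∈ V)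
    (v w : W) :
    fderiv ℝ (fun y => fderiv ℝ F y v) x w = fderiv ℝ (fun y => fderiv ℝ F y w) x v := by
  have hd : DifferentiableAt ℝ (fderiv ℝ F) x :=
    differentiableAt_of_contDiffOn hV (hF.fderiv_of_isOpen hV (by simp)) hx
  have h1 : ∀ v w : W, fderiv ℝ (fun y => fderiv ℝ F y v) x w = fderiv ℝ (fderiv ℝ F) x w v := by
    intro v w
    rw [fderiv_clm_apply hd (differentiableAt_const v)]
    simp
  have hs : IsSymmSndFDerivAt ℝ F x :=
    (hF.contDiffAt (hV.mem_nhds hx)).isSymmSndFDerivAt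
      (by
        rw [minSmoothness_of_isRCLikeNormedField]
        exact WithTop.coe_le_coe.2 (le_top : (2 : ℕ∞) ≤ ⊤))
  rw [h1, h1]; exact hs w v

/-! ### Partial derivatives of superfunctions -/

theorem pd_inl (e : E) (F : SFun E O) (x : E → ℝ) :
    pd (.inl e) F x = fderiv ℝ F x (Pi.single e 1) := rfl

theorem pd_inr (o : O) (F : SFun E O) (x : E → ℝ) : pd (.inr o) F x = oddD o (F x) := rfl

theorem par_inl (e : E) : par (.inl e : E ⊕ O) = 0 := rfl

theorem par_inr (o : O) : par (.inr o : E ⊕ O) = 1 := rfl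

theorem pd_congr {F G : SFun E O} {x : E → ℝ} (c : E ⊕ O) (h : F =ᶠ[𝓝 x] G) :
    pd c F x = pd c G x := by
  rcases c with e | o
  · rw [pd_inl, pd_inl, h.fderiv_eq]
  · rw [pd_inr, pd_inr, h.self_of_nhds]

theorem eventuallyEq_of_eqOn {Z : Type*} {V : Set W} {F G : W → Z} {x : W} (hV : IsOpen V)
    (h : Set.EqOn F G V) (hx : x ∈ V) : F =ᶠ[𝓝 x] G :=
  Filter.eventuallyEq_of_mem (hV.mem_nhds hx) h

theorem pd_add {F G : SFun E O} {x : E → ℝ} (c : E ⊕ O) (hF : DifferentiableAt ℝ F x)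
    (hG : DifferentiableAt ℝ G x) : pd c (F + G) x = pd c F x + pd c G x := by
  rcases c with e | o
  · simp only [pd_inl]; rw [fderiv_add hF hG]; rfl
  · simp only [pd_inr, Pi.add_apply, map_add]

theorem pd_sum {ι : Type*} {s : Finset ι} {F : ι → SFun E O} {x : E → ℝ} (c : E ⊕ O)
    (hF : ∀ i ∈ s, DifferentiableAt ℝ (F i) x) :
    pd c (fun y => ∑ i ∈ s, F i y) x = ∑ i ∈ s, pd c (F i) x := by
  rcases c with e | o
  · simp only [pd_inl]
    rw [fderiv_fun_sum hF, sum_apply]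
  · simp only [pd_inr, map_sum]

theorem pd_smul {F : SFun E O} {x : E → ℝ} (c : E ⊕ O) (r : ℝ) (hF : DifferentiableAt ℝ F x) :
    pd c (r • F) x = r • pd c F x := by
  rcases c with e | o
  · simp only [pd_inl]; rw [fderiv_const_smul hF]; rfl
  · simp only [pd_inr, Pi.smul_apply, map_smul]

theorem pd_neg (F : SFun E O) (x : E → ℝ) (c : E ⊕ O) :
    pd c (-F) x = -pd c F x := by
  rcases c with e | o
  · simp only [pd_inl]; rw [fderiv_neg]; rfl
  · simp only [pd_inr, Pi.neg_apply, map_neg]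

theorem pd_mul {F G : SFun E O} {x : E → ℝ} (c : E ⊕ O) (hF : DifferentiableAt ℝ F x)
    (hG : DifferentiableAt ℝ G x) :
    pd c (fun y => F y * G y) x = pd c F x * G x + twist (par c) (F x) * pd c G x := by
  rcases c with e | o
  · simp only [pd_inl, par_inl, twist_zero]; exact fderiv_mul_apply hF hG _
  · simp only [pd_inr, par_inr, oddD_mul]

theorem pd_twist {F : SFun E O} {x : E → ℝ} (p : ZMod 2) (c : E ⊕ O)
    (hF : DifferentiableAt ℝ F x) :
    pd c (fun y => twist p (F y)) x = sgn (p * par c) • twist p (pd c F x) := by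
  rcases c with e | o
  · simp only [pd_inl, par_inl, mul_zero, sgn_zero, one_smul]
    exact fderiv_linear_apply (twist p).toLinearMap hF _
  · simp only [pd_inr, par_inr, mul_one, oddD_twist]

theorem pd_const (c : E ⊕ O) (r : ℝ) (x : E → ℝ) :
    pd c (fun _ => algebraMap ℝ (Gr O) r : SFun E O) x = 0 := by
  rcases c with e | o
  · simp [pd_inl]
  · simp only [pd_inr, oddD_algebraMap]

theorem pd_zero (c : E ⊕ O) (x : E → ℝ) : pd c (0 : SFun E O) x = 0 := by
  have h := pd_const (E := E) c 0 x
  rwa [map_zero] at h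

theorem contDiff_coord (c : E ⊕ O) : ContDiff ℝ ∞ (coord c : SFun E O) := by
  rcases c with e | o
  · exact ((LinearMap.toContinuousLinearMap (Algebra.linearMap ℝ (Gr O))).comp
      (ContinuousLinearMap.proj (R := ℝ) (φ := fun _ : E => ℝ) e)).contDiff
  · exact contDiff_const

theorem differentiableAt_coord (c : E ⊕ O) (x : E → ℝ) :
    DifferentiableAt ℝ (coord c : SFun E O) x :=
  (contDiff_coord c).differentiable (by simp) x

theorem coord_mem (c : E ⊕ O) (x : E → ℝ) : coord c x ∈ parityPart O (par c) := by
  rcases c with e | o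
  · exact algebraMap_mem_parityPart _
  · exact ι_mem_parityPart _

theorem pd_coord (a c : E ⊕ O) (x : E → ℝ) :
    pd a (coord c) x = if a = c then 1 else 0 := by
  rcases a with e | o <;> rcases c with e' | o'
  · have h : HasFDerivAt (coord (.inl e' : E ⊕ O))
      ((LinearMap.toContinuousLinearMap (Algebra.linearMap ℝ (Gr O))).comp
      (ContinuousLinearMap.proj (R := ℝ) (φ := fun _ : E => ℝ) e')) x :=
      ((LinearMap.toContinuousLinearMap (Algebra.linearMap ℝ (Gr O))).comp
      (ContinuousLinearMap.proj (R := ℝ) (φ := fun _ : E => ℝ) e')).hasFDerivAt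
    rw [pd_inl, h.fderiv]
    by_cases hee : e = e'
    · subst hee; simp
    · simp [hee, Ne.symm hee]
  · simp [pd_inl, coord]
  · simp [pd_inr, coord, oddD_algebraMap]
  · simp only [pd_inr, coord, oddD_ι_single, Sum.inr.injEq]

theorem pd_contDiffOn {V : Set (E → ℝ)} {F : SFun E O} (hV : IsOpen V) (hF : ContDiffOn ℝ ∞ F V)
    (c : E ⊕ O) : ContDiffOn ℝ ∞ (pd c F) V := by
  rcases c with e | o
  · exact contDiffOn_fderiv_apply hV hF _
  · exact contDiffOn_linear (oddD o) hF

/-- Even derivatives commute by the symmetry of second derivatives, and odd ones anticommute as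
contractions. An odd derivative is a constant linear map on values, so it commutes with even
derivatives. -/
theorem pd_comm {V : Set (E → ℝ)} {F : SFun E O} {x : E → ℝ} (hV : IsOpen V)
    (hF : ContDiffOn ℝ ∞ F V) (hx : x ∈ V) (a b : E ⊕ O) :
    pd a (pd b F) x = sgn (par a * par b) • pd b (pd a F) x := by
  have hd := differentiableAt_of_contDiffOn hV hF hx
  rcases a with e | o <;> rcases b with e' | o' <;>
    simp only [par_inl, par_inr, mul_zero, mul_one, sgn_zero, sgn_one, one_smul,
      neg_one_smul]
  · exact fderiv_fderiv_comm hV hF hx _ _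
  · exact fderiv_linear_apply (oddD o') hd _
  · exact (fderiv_linear_apply (oddD o) hd _).symm
  · exact oddD_comm _ _ _

theorem pd_mem {V : Set (E → ℝ)} {F : SFun E O} {x : E → ℝ} (hV : IsOpen V)
    (hF : ContDiffOn ℝ ∞ F V) {p : ZMod 2} (hp : ∀ y ∈ V, F y ∈ parityPart O p) (hx : x ∈ V)
    (c : E ⊕ O) : pd c F x ∈ parityPart O (p + par c) := by
  rw [mem_parityPart_iff]
  have hd := differentiableAt_of_contDiffOn hV hF hx
  have h1 := pd_twist 1 c hd
  have h2 : pd c (fun y => twist 1 (F y)) x = pd c (sgn p • F) x :=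
    pd_congr c (eventuallyEq_of_eqOn hV (fun y hy => mem_parityPart_iff.1 (hp y hy)) hx)
  rw [h2, pd_smul c _ hd, one_mul] at h1
  rw [sgn_add, mul_comm, mul_smul, h1, smul_smul, sgn_mul_self, one_smul]

/-! ### Vector fields -/

theorem act_congr (X : VField E O) {F G : SFun E O} {x : E → ℝ} (h : F =ᶠ[𝓝 x] G) :
    act X F x = act X G x := by
  simp only [act, pd_congr _ h]

theorem act_congr_field {X Y : VField E O} {x : E → ℝ} (F : SFun E O)
    (h : ∀ c, X c x = Y c x) : act X F x = act Y F x := by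
  simp only [act, h]

theorem act_coord (X : VField E O) (c : E ⊕ O) (x : E → ℝ) : act X (coord c) x = X c x := by
  simp only [act, pd_coord]
  simp

theorem act_smul (X : VField E O) (r : ℝ) {F : SFun E O} {x : E → ℝ}
    (hF : DifferentiableAt ℝ F x) : act X (r • F) x = r • act X F x := by
  simp only [act, pd_smul _ r hF, Finset.smul_sum, mul_smul_comm]

theorem act_nsmul (X : VField E O) (n : ℕ) {F : SFun E O} {x : E → ℝ}
    (hF : DifferentiableAt ℝ F x) : act X (n • F) x = n • act X F x := by
  have h := act_smul X (n : ℝ) hF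
  rw [Nat.cast_smul_eq_nsmul, Nat.cast_smul_eq_nsmul] at h
  exact h

theorem act_neg (X : VField E O) (F : SFun E O) (x : E → ℝ) :
    act X (-F) x = -act X F x := by
  simp only [act, pd_neg, mul_neg, Finset.sum_neg_distrib]

theorem act_add (X : VField E O) {F G : SFun E O} {x : E → ℝ} (hF : DifferentiableAt ℝ F x)
    (hG : DifferentiableAt ℝ G x) : act X (F + G) x = act X F x + act X G x := by
  simp only [act, pd_add _ hF hG, mul_add, Finset.sum_add_distrib]

theorem act_zero (X : VField E O) (x : E → ℝ) : act X (0 : SFun E O) x = 0 := by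
  simp only [act, pd_zero, mul_zero, Finset.sum_const_zero]

theorem act_add_field (X Y : VField E O) (F : SFun E O) (x : E → ℝ) :
    act (X + Y) F x = act X F x + act Y F x := by
  simp only [act, Pi.add_apply, add_mul, Finset.sum_add_distrib]

theorem act_contDiffOn {V : Set (E → ℝ)} {X : VField E O} {F : SFun E O} (hV : IsOpen V)
    (hX : ∀ c, ContDiffOn ℝ ∞ (X c) V) (hF : ContDiffOn ℝ ∞ F V) :
    ContDiffOn ℝ ∞ (act X F) V :=
  ContDiffOn.sum fun c _ => contDiffOn_mul (hX c) (pd_contDiffOn hV hF c)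

theorem act_mem {V : Set (E → ℝ)} {X : VField E O} {F : SFun E O} {x : E → ℝ} (hV : IsOpen V)
    {p q : ZMod 2} (hX : ∀ c, X c x ∈ parityPart O (p + par c)) (hF : ContDiffOn ℝ ∞ F V)
    (hq : ∀ y ∈ V, F y ∈ parityPart O q) (hx : x ∈ V) : act X F x ∈ parityPart O (p + q) := by
  refine Submodule.sum_mem _ fun c _ => ?_
  have h := mul_mem_parityPart (hX c) (pd_mem hV hF hq hx c)
  have h2 : p + par c + (q + par c) = p + q := by
    have : par c + par c = 0 := by rcases zmod_two_cases (par c) with h | h <;> rw [h] <;> rfl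
    linear_combination this
  rwa [h2] at h

/-- The second order part of the composition of two vector fields. -/
theorem act_act {V : Set (E → ℝ)} {X Y : VField E O} {F : SFun E O} {x : E → ℝ} (hV : IsOpen V)
    {q : ZMod 2} (hY : ∀ c, ContDiffOn ℝ ∞ (Y c) V) (hF : ContDiffOn ℝ ∞ F V)
    (hYp : ∀ c, Y c x ∈ parityPart O (q + par c)) (hx : x ∈ V) :
    act X (act Y F) x = act (fun c => act X (Y c)) F x
      + ∑ a, ∑ b, sgn (par a * (q + par b)) • (X a x * Y b x * pd a (pd b F) x) := by
  have h1 : ∀ a, pd a (act Y F) x = ∑ b, (pd a (Y b) x * pd b F x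
      + sgn (par a * (q + par b)) • (Y b x * pd a (pd b F) x)) := by
    intro a
    have := pd_sum (s := Finset.univ) (F := fun b y => Y b y * pd b F y) (x := x) a fun b _ =>
      differentiableAt_of_contDiffOn hV (contDiffOn_mul (hY b) (pd_contDiffOn hV hF b)) hx
    rw [show act Y F = fun y => ∑ b, Y b y * pd b F y from rfl, this]
    refine Finset.sum_congr rfl fun b _ => ?_
    rw [pd_mul a (differentiableAt_of_contDiffOn hV (hY b) hx)
      (differentiableAt_of_contDiffOn hV (pd_contDiffOn hV hF b) hx), twist_of_mem (hYp b),
      smul_mul_assoc]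
  have h0 : act X (act Y F) x = ∑ a, X a x * pd a (act Y F) x := rfl
  rw [h0]
  simp only [h1, Finset.mul_sum, mul_add, Finset.sum_add_distrib, mul_smul_comm]
  congr 1
  · rw [Finset.sum_comm]
    simp only [act, Finset.sum_mul, mul_assoc]
  · simp only [mul_assoc]

/-- The supercommutator of vector fields acts as the supercommutator of the actions. -/
theorem act_bracket {V : Set (E → ℝ)} {X Y : VField E O} {F : SFun E O} {x : E → ℝ}
    (hV : IsOpen V) {p q : ZMod 2} (hX : ∀ c, ContDiffOn ℝ ∞ (X c) V)
    (hY : ∀ c, ContDiffOn ℝ ∞ (Y c) V) (hF : ContDiffOn ℝ ∞ F V)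
    (hXp : ∀ c, X c x ∈ parityPart O (p + par c)) (hYp : ∀ c, Y c x ∈ parityPart O (q + par c))
    (hx : x ∈ V) :
    act X (act Y F) x - sgn (p * q) • act Y (act X F) x = act (bracket p q X Y) F x := by
  rw [act_act hV hY hF hYp hx, act_act hV hX hF hXp hx]
  -- The second-order parts of the two compositions cancel. Exchanging the summation indices, the
  -- coefficients and the two derivatives produces exactly the sign `(-1)^(pq)`.
  have h : sgn (p * q) • ∑ a, ∑ b, sgn (par a * (p + par b)) • (Y a x * X b x * pd a (pd b F) x)
      = ∑ a, ∑ b, sgn (par a * (q + par b)) • (X a x * Y b x * pd a (pd b F) x) := by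
    rw [Finset.sum_comm, Finset.smul_sum]
    refine Finset.sum_congr rfl fun a _ => ?_
    rw [Finset.smul_sum]
    refine Finset.sum_congr rfl fun b _ => ?_
    rw [mul_comm_of_mem (hYp b) (hXp a), pd_comm hV hF hx b a]
    simp only [smul_mul_assoc, mul_smul_comm, smul_smul, ← sgn_add]
    congr 2
    -- The sign exponents on the two sides differ by an even number.
    have h2 : (2 : ZMod 2) = 0 := rfl
    linear_combination (p * q + par b * p + par a * par b) * h2
  rw [smul_add, h]
  have h3 : act (bracket p q X Y) F x = act (fun c => act X (Y c)) F x
      - sgn (p * q) • act (fun c => act Y (X c)) F x := by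
    simp only [act, bracket, Pi.sub_apply, Pi.smul_apply, sub_mul, Finset.sum_sub_distrib,
      Finset.smul_sum]
    simp only [← Finset.smul_sum, smul_mul_assoc]
  rw [h3]; abel

/-- The square of an odd vector field acts as a vector field. -/
theorem act_act_self_of_odd {V : Set (E → ℝ)} {X : VField E O} {F : SFun E O} {x : E → ℝ}
    (hV : IsOpen V) (hX : ∀ c, ContDiffOn ℝ ∞ (X c) V) (hF : ContDiffOn ℝ ∞ F V)
    (hXp : ∀ c, X c x ∈ parityPart O (1 + par c)) (hx : x ∈ V) :
    act X (act X F) x = act (fun c => act X (X c)) F x := by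
  have h := act_bracket hV hX hX hF hXp hXp hx
  have hb : act (bracket 1 1 X X) F x = (2 : ℝ) • act (fun c => act X (X c)) F x := by
    rw [two_smul, ← act_add_field]
    refine act_congr_field F fun c => ?_
    simp [bracket, sgn_one]
  rw [hb, mul_one, sgn_one, neg_one_smul, sub_neg_eq_add, ← two_smul ℝ] at h
  exact smul_right_injective _ (two_ne_zero (α := ℝ)) h

end Calculus

/-! ## Substitution at a point -/

section Substitution

variable {E O E' O' : Type*} [Fintype E] [DecidableEq E] [Fintype O] [DecidableEq O]
  [Fintype E'] [DecidableEq E'] [Fintype O'] [DecidableEq O']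

/-! ### Substitution of odd elements for the generators -/

theorem linearCombination_odd {b : O' → Gr O} (hb : ∀ o, b o ∈ parityPart O 1) (v : O' → ℝ) :
    Fintype.linearCombination ℝ b v ∈ parityPart O 1 := by
  rw [Fintype.linearCombination_apply]
  exact Submodule.sum_mem _ fun o _ => Submodule.smul_mem _ _ (hb o)

theorem oddSubst_spec {b : O' → Gr O} (hb : ∀ o, b o ∈ parityPart O 1) :
    ∃ β : Gr O' →ₐ[ℝ] Gr O, (∀ w, oddSubst b w = β w) ∧
      ∀ v, β (ExteriorAlgebra.ι ℝ v) = Fintype.linearCombination ℝ b v := by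
  have h : ∀ v, Fintype.linearCombination ℝ b v * Fintype.linearCombination ℝ b v = 0 :=
    fun v => mul_self_of_odd (linearCombination_odd hb v)
  refine ⟨ExteriorAlgebra.lift ℝ ⟨Fintype.linearCombination ℝ b, h⟩, fun w => ?_, fun v => ?_⟩
  · rw [oddSubst, dif_pos h]; rfl
  · exact ExteriorAlgebra.lift_ι_apply ℝ _ h v

theorem oddSubst_mul {b : O' → Gr O} (hb : ∀ o, b o ∈ parityPart O 1) (x y : Gr O') :
    oddSubst b (x * y) = oddSubst b x * oddSubst b y := by
  obtain ⟨β, h, -⟩ := oddSubst_spec hb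
  simp only [h, map_mul]

theorem oddSubst_algebraMap {b : O' → Gr O} (hb : ∀ o, b o ∈ parityPart O 1) (r : ℝ) :
    oddSubst b (algebraMap ℝ (Gr O') r) = algebraMap ℝ (Gr O) r := by
  obtain ⟨β, h, -⟩ := oddSubst_spec hb
  rw [h, AlgHom.commutes]

theorem oddSubst_ι {b : O' → Gr O} (hb : ∀ o, b o ∈ parityPart O 1) (v : O' → ℝ) :
    oddSubst b (ExteriorAlgebra.ι ℝ v) = Fintype.linearCombination ℝ b v := by
  obtain ⟨β, h, h'⟩ := oddSubst_spec hb
  rw [h, h']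

theorem twist_oddSubst {b : O' → Gr O} (hb : ∀ o, b o ∈ parityPart O 1) (w : Gr O') :
    twist 1 (oddSubst b w) = oddSubst b (twist 1 w) := by
  induction w using ExteriorAlgebra.induction with
  | algebraMap r => simp only [AlgHom.commutes, oddSubst_algebraMap hb]
  | ι v =>
    rw [twist_one_ι, map_neg, oddSubst_ι hb, twist_of_mem (linearCombination_odd hb v), one_mul,
      sgn_one, neg_one_smul]
  | mul x y hx hy => simp only [map_mul, oddSubst_mul hb, hx, hy]
  | add x y hx hy => simp only [map_add, hx, hy]

theorem body_oddSubst {b : O' → Gr O} (hb : ∀ o, b o ∈ parityPart O 1) (w : Gr O') :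
    body (oddSubst b w) = body w := by
  induction w using ExteriorAlgebra.induction with
  | algebraMap r => simp only [body_algebraMap, oddSubst_algebraMap hb]
  | ι v => rw [oddSubst_ι hb, body_of_odd (linearCombination_odd hb v), body_ι]
  | mul x y hx hy => simp only [body_mul, oddSubst_mul hb, hx, hy]
  | add x y hx hy => simp only [map_add, body_add, hx, hy]

/-- Both sides obey the same twisted Leibniz rule along `oddSubst b`, so generators decide. The
coefficients `oddD o (b o')` are derivatives of odd elements, hence even, and move freely past the
other factors. -/
theorem oddD_oddSubst {b : O' → Gr O} (hb : ∀ o, b o ∈ parityPart O 1) (o : O) (w : Gr O') :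
    oddD o (oddSubst b w) = ∑ o', oddD o (b o') * oddSubst b (oddD o' w) := by
  induction w using ExteriorAlgebra.induction with
  | algebraMap r => simp only [oddSubst_algebraMap hb, oddD_algebraMap, map_zero, mul_zero,
      Finset.sum_const_zero]
  | ι v =>
    rw [oddSubst_ι hb, Fintype.linearCombination_apply, map_sum]
    refine Finset.sum_congr rfl fun o' _ => ?_
    have h : oddD o' (ExteriorAlgebra.ι ℝ v) = algebraMap ℝ (Gr O') (v o') := contr_ι _ v
    rw [h, oddSubst_algebraMap hb, map_smul, ← Algebra.commutes, Algebra.smul_def]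
  | mul x y hx hy =>
    rw [oddSubst_mul hb, oddD_mul, hx, hy, Finset.sum_mul, Finset.mul_sum,
      ← Finset.sum_add_distrib]
    refine Finset.sum_congr rfl fun o' _ => ?_
    rw [oddD_mul, map_add, oddSubst_mul hb, oddSubst_mul hb, mul_add, ← twist_oddSubst hb,
      ← mul_assoc, ← mul_assoc, ← mul_assoc]
    congr 2
    exact (even_mul_comm _ (oddD_mem_of_odd o (hb o')) _).symm
  | add x y hx hy => simp only [map_add, hx, hy, mul_add, Finset.sum_add_distrib]

/-! ### Derivatives with coefficients in a Grassmann algebra -/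

/-- The derivative in the direction with the components `n e`. -/
def dirD (n : E' → Gr O) (G : (E' → ℝ) → Gr O) : (E' → ℝ) → Gr O := fun y =>
  ∑ e, n e * fderiv ℝ G y (Pi.single e 1)

theorem taylorStep_eq (a : E' → Gr O) :
    taylorStep a = dirD fun e => a e - algebraMap ℝ (Gr O) (body (a e)) := rfl

variable {V : Set (E' → ℝ)} {G H : (E' → ℝ) → Gr O} {n m : E' → Gr O} {y : E' → ℝ}

theorem dirD_contDiffOn (hV : IsOpen V) (hG : ContDiffOn ℝ ∞ G V) (n : E' → Gr O) :
    ContDiffOn ℝ ∞ (dirD n G) V :=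
  ContDiffOn.sum fun _ _ => contDiffOn_mul contDiffOn_const (contDiffOn_fderiv_apply hV hG _)

theorem dirD_iterate_contDiffOn (hV : IsOpen V) (hG : ContDiffOn ℝ ∞ G V) (n : E' → Gr O)
    (k : ℕ) : ContDiffOn ℝ ∞ ((dirD n)^[k] G) V := by
  induction k with
  | zero => exact hG
  | succ k ih => rw [Function.iterate_succ_apply']; exact dirD_contDiffOn hV ih n

theorem dirD_congr (hV : IsOpen V) (h : Set.EqOn G H V) (n : E' → Gr O) :
    Set.EqOn (dirD n G) (dirD n H) V := fun y hy => by
  simp only [dirD, (eventuallyEq_of_eqOn hV h hy).fderiv_eq]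

theorem dirD_iterate_congr (hV : IsOpen V) (h : Set.EqOn G H V) (n : E' → Gr O) (k : ℕ) :
    Set.EqOn ((dirD n)^[k] G) ((dirD n)^[k] H) V := by
  induction k with
  | zero => exact h
  | succ k ih => simp only [Function.iterate_succ_apply']; exact dirD_congr hV ih n

/-- An operation that commutes with `dirD n` commutes with its iterates. -/
theorem dirD_iterate_comm (hV : IsOpen V) (n : E' → Gr O)
    (T : ((E' → ℝ) → Gr O) → ((E' → ℝ) → Gr O))
    (hT : ∀ G, ContDiffOn ℝ ∞ G V → Set.EqOn (T (dirD n G)) (dirD n (T G)) V)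
    (hG : ContDiffOn ℝ ∞ G V) (k : ℕ) :
    Set.EqOn (T ((dirD n)^[k] G)) ((dirD n)^[k] (T G)) V := by
  induction k with
  | zero => exact fun _ _ => rfl
  | succ k ih =>
    simp only [Function.iterate_succ_apply']
    exact (hT _ (dirD_iterate_contDiffOn hV hG n k)).trans (dirD_congr hV ih n)

theorem dirD_add (hV : IsOpen V) (hG : ContDiffOn ℝ ∞ G V) (hH : ContDiffOn ℝ ∞ H V)
    (n : E' → Gr O) : Set.EqOn (dirD n (G + H)) (dirD n G + dirD n H) V := fun y hy => by
  simp only [dirD, Pi.add_apply]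
  rw [fderiv_add (differentiableAt_of_contDiffOn hV hG hy)
    (differentiableAt_of_contDiffOn hV hH hy)]
  simp only [add_apply, mul_add, Finset.sum_add_distrib]

theorem dirD_iterate_add (hV : IsOpen V) (hG : ContDiffOn ℝ ∞ G V) (hH : ContDiffOn ℝ ∞ H V)
    (n : E' → Gr O) (k : ℕ) :
    Set.EqOn ((dirD n)^[k] (G + H)) ((dirD n)^[k] G + (dirD n)^[k] H) V := by
  induction k with
  | zero => exact fun _ _ => rfl
  | succ k ih =>
    simp only [Function.iterate_succ_apply']
    exact (dirD_congr hV ih n).trans (dirD_add hV (dirD_iterate_contDiffOn hV hG n k)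
      (dirD_iterate_contDiffOn hV hH n k) n)

theorem dirD_const_mul (hV : IsOpen V) (hn : ∀ e, n e ∈ parityPart O 0) (c : Gr O)
    (hG : ContDiffOn ℝ ∞ G V) :
    Set.EqOn (fun y => c * dirD n G y) (dirD n fun y => c * G y) V := fun y hy => by
  simp only [dirD, Finset.mul_sum]
  refine Finset.sum_congr rfl fun e _ => ?_
  have h := fderiv_linear_apply (LinearMap.mulLeft ℝ c)
    (differentiableAt_of_contDiffOn hV hG hy) (Pi.single e 1)
  simp only [LinearMap.mulLeft_apply] at h
  rw [h, ← mul_assoc, ← mul_assoc, even_mul_comm _ (hn e)]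

theorem dirD_twist (hV : IsOpen V) (hn : ∀ e, n e ∈ parityPart O 0) (hG : ContDiffOn ℝ ∞ G V) :
    Set.EqOn (fun y => twist 1 (dirD n G y)) (dirD n fun y => twist 1 (G y)) V := fun y hy => by
  simp only [dirD, map_sum, map_mul]
  refine Finset.sum_congr rfl fun e _ => ?_
  have h := fderiv_linear_apply (twist (O := O) 1).toLinearMap
    (differentiableAt_of_contDiffOn hV hG hy) (Pi.single e 1)
  simp only [AlgHom.toLinearMap_apply] at h
  rw [h, twist_of_mem (hn e), mul_zero, sgn_zero, one_smul]

theorem dirD_iterate_const_mul (hV : IsOpen V) (hn : ∀ e, n e ∈ parityPart O 0) (c : Gr O)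
    (hG : ContDiffOn ℝ ∞ G V) (k : ℕ) (hy : y ∈ V) :
    (dirD n)^[k] (fun y => c * G y) y = c * (dirD n)^[k] G y :=
  (dirD_iterate_comm hV n (fun G y => c * G y)
    (fun _ hG => dirD_const_mul hV hn c hG) hG k hy).symm

theorem dirD_iterate_sum (hV : IsOpen V) (n : E' → Gr O) {ι : Type*} (s : Finset ι)
    {F : ι → (E' → ℝ) → Gr O} (hF : ∀ i, ContDiffOn ℝ ∞ (F i) V) (k : ℕ) (hy : y ∈ V) :
    (dirD n)^[k] (fun y => ∑ i ∈ s, F i y) y = ∑ i ∈ s, (dirD n)^[k] (F i) y := by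
  classical
  induction s using Finset.induction_on with
  | empty =>
    have h : ∀ k, (dirD n)^[k] (fun _ => 0 : (E' → ℝ) → Gr O) = fun _ => 0 := by
      intro k
      induction k with
      | zero => rfl
      | succ k ih => rw [Function.iterate_succ_apply', ih]; funext y; simp [dirD]
    simp only [Finset.sum_empty, h]
  | insert i s hi ih =>
    have h0 : (fun y => ∑ j ∈ insert i s, F j y) = F i + fun y => ∑ j ∈ s, F j y :=
      funext fun y => by simp [Finset.sum_insert hi]
    rw [Finset.sum_insert hi, ← ih, h0,
      dirD_iterate_add hV (hF i) (ContDiffOn.sum (s := s) fun j _ => hF j) n k hy, Pi.add_apply]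

theorem dirD_comm (hV : IsOpen V) (hn : ∀ e, n e ∈ parityPart O 0) (m : E' → Gr O)
    (hG : ContDiffOn ℝ ∞ G V) : Set.EqOn (dirD m (dirD n G)) (dirD n (dirD m G)) V := by
  intro y hy
  have h : ∀ (n : E' → Gr O) (v : E' → ℝ), fderiv ℝ (dirD n G) y v
      = ∑ e, n e * fderiv ℝ (fun z => fderiv ℝ G z (Pi.single e 1)) y v := by
    intro n v
    have hd : ∀ e, DifferentiableAt ℝ (fun z => fderiv ℝ G z (Pi.single e 1)) y := fun e =>
      differentiableAt_of_contDiffOn hV (contDiffOn_fderiv_apply hV hG _) hy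
    have hd' : ∀ e, DifferentiableAt ℝ (fun z => n e * fderiv ℝ G z (Pi.single e 1)) y := fun e =>
      differentiableAt_of_contDiffOn hV
        (contDiffOn_mul contDiffOn_const (contDiffOn_fderiv_apply hV hG _)) hy
    have h1 : dirD n G = fun z => ∑ e, n e * fderiv ℝ G z (Pi.single e 1) := rfl
    rw [h1, fderiv_fun_sum fun e _ => hd' e, sum_apply]
    refine Finset.sum_congr rfl fun e _ => ?_
    have h2 := fderiv_linear_apply (LinearMap.mulLeft ℝ (n e)) (hd e) v
    simp only [LinearMap.mulLeft_apply] at h2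
    exact h2
  have h3 : ∀ (n : E' → Gr O) (G : (E' → ℝ) → Gr O),
    dirD n G y = ∑ e, n e * fderiv ℝ G y (Pi.single e 1) := fun _ _ => rfl
  rw [h3, h3]
  simp only [h, Finset.mul_sum]
  rw [Finset.sum_comm]
  refine Finset.sum_congr rfl fun e _ => Finset.sum_congr rfl fun e' _ => ?_
  rw [← mul_assoc, ← mul_assoc, even_mul_comm _ (hn e), fderiv_fderiv_comm hV hG hy]

theorem oddD_dirD (hV : IsOpen V) (hn : ∀ e, n e ∈ parityPart O 0) (hG : ContDiffOn ℝ ∞ G V)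
    (o : O) :
    Set.EqOn (fun y => oddD o (dirD n G y))
      (dirD (fun e => oddD o (n e)) G + dirD n fun y => oddD o (G y)) V := fun y hy => by
  simp only [dirD, Pi.add_apply, map_sum, oddD_mul]
  rw [← Finset.sum_add_distrib]
  refine Finset.sum_congr rfl fun e _ => ?_
  rw [fderiv_linear_apply (oddD o) (differentiableAt_of_contDiffOn hV hG hy),
    twist_of_mem (hn e), mul_zero, sgn_zero, one_smul]

/-- With `D = dirD n` and `D'` the derivative with the differentiated coefficients, one step reads
`∂D = D' + D∂`. Since `D'` commutes with `D`, the `D'` terms add up to `(k + 1) D^k D'`. The factor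
`k + 1` later turns `1/(k + 1)!` into the Taylor coefficient `1/k!`. -/
theorem oddD_dirD_iterate (hV : IsOpen V) (hn : ∀ e, n e ∈ parityPart O 0)
    (hG : ContDiffOn ℝ ∞ G V) (o : O) (k : ℕ) :
    Set.EqOn (fun y => oddD o ((dirD n)^[k + 1] G y))
      (((k + 1 : ℕ) : ℝ) • ((dirD n)^[k] (dirD (fun e => oddD o (n e)) G))
        + (dirD n)^[k + 1] fun y => oddD o (G y)) V := by
  set n' : E' → Gr O := fun e => oddD o (n e) with hn'
  have hG' : ContDiffOn ℝ ∞ (fun y => oddD o (G y)) V := contDiffOn_linear (oddD o) hG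
  have hcomm : ∀ k, Set.EqOn (dirD n' ((dirD n)^[k] G)) ((dirD n)^[k] (dirD n' G)) V := fun k =>
    dirD_iterate_comm hV n (dirD n') (fun G hG => dirD_comm hV hn n' hG) hG k
  induction k with
  | zero =>
    intro y hy
    simpa using oddD_dirD hV hn hG o hy
  | succ k ih =>
    intro y hy
    have h1 := oddD_dirD hV hn (dirD_iterate_contDiffOn hV hG n (k + 1)) o hy
    have hs := dirD_iterate_contDiffOn hV (dirD_contDiffOn hV hG n') n k
    have hs' : ContDiffOn ℝ ∞ (((k + 1 : ℕ) : ℝ) • ((dirD n)^[k] (dirD n' G))) V :=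
      contDiffOn_linear (((k + 1 : ℕ) : ℝ) • LinearMap.id) hs
    have h2 := dirD_congr hV ih n hy
    rw [dirD_add hV hs' (dirD_iterate_contDiffOn hV hG' n (k + 1)) n hy]
      at h2
    have h3 : dirD n (((k + 1 : ℕ) : ℝ) • ((dirD n)^[k] (dirD n' G))) y
        = ((k + 1 : ℕ) : ℝ) • dirD n ((dirD n)^[k] (dirD n' G)) y := by
      simp only [dirD, Finset.smul_sum]
      refine Finset.sum_congr rfl fun e _ => ?_
      rw [fderiv_const_smul (differentiableAt_of_contDiffOn hV hs hy), smul_apply, mul_smul_comm]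
    simp only [Function.iterate_succ_apply' _ (k + 1)]
    simp only [Pi.add_apply, Pi.smul_apply] at h1 h2 ⊢
    rw [h1, h2, h3, hcomm (k + 1) hy, Function.iterate_succ_apply' _ k,
      Nat.cast_succ (k + 1), add_smul, one_smul]
    abel

theorem dirD_iterate_mem_filt {j : ℕ} (hn : ∀ e, n e ∈ filt j) (G : (E' → ℝ) → Gr O) (k : ℕ)
    (y : E' → ℝ) : (dirD n)^[k] G y ∈ filt (j * k) := by
  have h : ∀ (i : ℕ) (H : (E' → ℝ) → Gr O), (∀ y, H y ∈ filt i) →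
      ∀ y, dirD n H y ∈ filt (j + i) := by
    intro i H hH y
    refine Submodule.sum_mem _ fun e _ => mul_mem_filt_add (hn e) ?_
    -- A derivative of a map into a subspace stays in that subspace, because the projection onto a
    -- complement annihilates the map. Where `H` is not differentiable, `fderiv` is zero by
    -- convention, so no smoothness is needed.
    by_cases hd : DifferentiableAt ℝ H y
    · have hq : ∀ y, (filt i : Submodule ℝ (Gr O)).mkQ (H y) = 0 := fun y =>
        (Submodule.Quotient.mk_eq_zero _).2 (hH y)
      obtain ⟨P, hP⟩ := (filt i : Submodule ℝ (Gr O)).exists_isCompl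
      have h0 : ∀ y, P.projectionOnto _ hP.symm (H y) = 0 := fun y =>
        (Submodule.projectionOnto_apply_eq_zero_iff hP.symm).2 (hH y)
      have h1 := fderiv_linear_apply (P.subtype ∘ₗ P.projectionOnto _ hP.symm) hd
        (Pi.single e 1)
      simp only [LinearMap.comp_apply, h0, map_zero, fderiv_const_apply, zero_apply] at h1
      rw [← Submodule.projectionOnto_apply_eq_zero_iff hP.symm]
      exact Subtype.ext h1.symm
    · rw [fderiv_zero_of_not_differentiableAt hd]; exact zero_mem _
  induction k generalizing y with
  | zero => exact mem_filt_zero _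
  | succ k ih =>
    rw [Function.iterate_succ_apply', Nat.mul_succ, add_comm]
    exact h _ _ ih y

/-! ### Properties of the substitution -/

theorem nilpotentPart_mem {a : Gr O} (ha : a ∈ parityPart O 0) :
    a - algebraMap ℝ (Gr O) (body a) ∈ parityPart O 0 :=
  Submodule.sub_mem _ ha (algebraMap_mem_parityPart _)

/-- The odd derivatives of an even element are odd and so have no body. Hence each Taylor step
raises the level by two. -/
theorem nilpotentPart_mem_filt {a : Gr O} (ha : a ∈ parityPart O 0) :
    a - algebraMap ℝ (Gr O) (body a) ∈ filt 2 := by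
  rw [mem_filt_succ]
  refine ⟨by rw [body_sub, body_algebraMap, sub_self], fun o => mem_filt_one.2 ?_⟩
  exact body_of_odd (oddD_mem_of_even o (nilpotentPart_mem ha))

/-- The reduced point of a point with values in a Grassmann algebra. -/
def bodyPt (a : E' ⊕ O' → Gr O) : E' → ℝ := fun e => body (a (.inl e))

variable {a : E' ⊕ O' → Gr O} {F F₁ F₂ : SFun E' O'}

theorem contDiffOn_oddSubst (b : O' → Gr O) (hF : ContDiffOn ℝ ∞ F V) :
    ContDiffOn ℝ ∞ (fun y => oddSubst b (F y)) V := contDiffOn_linear (oddSubst b) hF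

theorem subst_congr (hV : IsOpen V) (ha : bodyPt a ∈ V) (h : Set.EqOn F₁ F₂ V) :
    subst a F₁ = subst a F₂ := by
  refine Finset.sum_congr rfl fun k _ => ?_
  rw [taylorStep_eq]
  congr 1
  exact dirD_iterate_congr hV (fun y hy => by simp only [h hy]) _ k ha

theorem subst_add (hV : IsOpen V) (ha : bodyPt a ∈ V) (h₁ : ContDiffOn ℝ ∞ F₁ V)
    (h₂ : ContDiffOn ℝ ∞ F₂ V) : subst a (F₁ + F₂) = subst a F₁ + subst a F₂ := by
  simp only [subst, ← Finset.sum_add_distrib, ← smul_add]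
  refine Finset.sum_congr rfl fun k _ => ?_
  congr 1
  rw [taylorStep_eq]
  have h := dirD_iterate_add hV (contDiffOn_oddSubst (fun o => a (.inr o)) h₁)
    (contDiffOn_oddSubst (fun o => a (.inr o)) h₂)
    (fun e => a (.inl e) - algebraMap ℝ (Gr O) (body (a (.inl e)))) k ha
  have h0 : (fun y => oddSubst (fun o => a (.inr o)) ((F₁ + F₂) y))
      = (fun y => oddSubst (fun o => a (.inr o)) (F₁ y))
        + fun y => oddSubst (fun o => a (.inr o)) (F₂ y) :=
    funext fun y => map_add (oddSubst fun o => a (.inr o)) (F₁ y) (F₂ y)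
  rw [h0]
  exact h

theorem subst_zero : subst a (0 : SFun E' O') = 0 := by
  have h := subst_add (a := a) (F₁ := (0 : SFun E' O')) (F₂ := 0) isOpen_univ (Set.mem_univ _)
    contDiffOn_const contDiffOn_const
  rw [add_zero] at h
  exact left_eq_add.1 h

theorem subst_sum {ι : Type*} (hV : IsOpen V) (ha : bodyPt a ∈ V) (s : Finset ι)
    {F : ι → SFun E' O'} (hF : ∀ i ∈ s, ContDiffOn ℝ ∞ (F i) V) :
    subst a (fun y => ∑ i ∈ s, F i y) = ∑ i ∈ s, subst a (F i) := by
  classical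
  induction s using Finset.induction_on with
  | empty => simp only [Finset.sum_empty]; exact subst_zero
  | insert i s hi ih =>
    have hs : ∀ j ∈ s, ContDiffOn ℝ ∞ (F j) V := fun j hj => hF j (Finset.mem_insert_of_mem hj)
    rw [Finset.sum_insert hi, ← ih hs, ← subst_add hV ha (hF i (Finset.mem_insert_self i s))
      (ContDiffOn.sum hs)]
    congr 1
    funext y
    simp [Finset.sum_insert hi]

theorem body_subst (ha : ∀ c, a c ∈ parityPart O (par c)) (F : SFun E' O') :
    body (subst a F) = body (F (bodyPt a)) := by
  rw [subst, Finset.sum_range_succ', body_add, body_sum]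
  have h : ∀ k : ℕ, body (((k + 1).factorial : ℝ)⁻¹ •
      ((taylorStep fun e => a (.inl e))^[k + 1] fun y => oddSubst (fun o => a (.inr o)) (F y))
      fun e => body (a (.inl e))) = 0 := by
    intro k
    rw [body_smul, taylorStep_eq]
    have h1 := dirD_iterate_mem_filt (fun e => nilpotentPart_mem_filt (ha (.inl e)))
      (fun y => oddSubst (fun o => a (.inr o)) (F y)) (k + 1) fun e => body (a (.inl e))
    rw [mem_filt_one.1 (filt_antitone (by omega) h1), mul_zero]
  simp only [h, Finset.sum_const_zero, zero_add]
  simp only [Nat.factorial_zero, Nat.cast_one, inv_one, one_smul, Function.iterate_zero, id_eq]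
  exact body_oddSubst (fun o => ha (.inr o)) _

theorem twist_one_subst (hV : IsOpen V) (hy : bodyPt a ∈ V)
    (ha : ∀ c, a c ∈ parityPart O (par c)) (hF : ContDiffOn ℝ ∞ F V) :
    twist 1 (subst a F) = subst a fun y => twist 1 (F y) := by
  simp only [subst, map_sum, map_smul]
  refine Finset.sum_congr rfl fun k _ => ?_
  congr 1
  rw [taylorStep_eq]
  have hn : ∀ e, a (.inl e) - algebraMap ℝ (Gr O) (body (a (.inl e))) ∈ parityPart O 0 := fun e =>
    nilpotentPart_mem (ha (.inl e))
  have h := dirD_iterate_comm hV _ (fun G y => twist 1 (G y))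
    (fun G hG => dirD_twist hV hn hG) (contDiffOn_oddSubst (fun o => a (.inr o)) hF) k hy
  simp only [← twist_oddSubst fun o => ha (.inr o)]
  exact h

theorem twist_subst (hV : IsOpen V) (hy : bodyPt a ∈ V)
    (ha : ∀ c, a c ∈ parityPart O (par c)) (hF : ContDiffOn ℝ ∞ F V) (p : ZMod 2) :
    twist p (subst a F) = subst a fun y => twist p (F y) := by
  rcases zmod_two_cases p with rfl | rfl
  · simp only [twist_zero]
  · exact twist_one_subst hV hy ha hF

/-- The chain rule for odd derivatives. -/
theorem oddD_subst (hV : IsOpen V) (hy : bodyPt a ∈ V)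
    (ha : ∀ c, a c ∈ parityPart O (par c)) (hF : ContDiffOn ℝ ∞ F V) (o : O) :
    oddD o (subst a F) = ∑ c, oddD o (a c) * subst a (pd c F) := by
  set n : E' → Gr O := fun e => a (.inl e) - algebraMap ℝ (Gr O) (body (a (.inl e))) with hndef
  set b : O' → Gr O := fun o => a (.inr o) with hbdef
  have hn : ∀ e, n e ∈ parityPart O 0 := fun e => nilpotentPart_mem (ha (.inl e))
  have hb : ∀ o, b o ∈ parityPart O 1 := fun o => ha (.inr o)
  have hn' : ∀ e, oddD o (n e) = oddD o (a (.inl e)) := fun e => by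
    rw [hndef, map_sub, oddD_algebraMap, sub_zero]
  have hS : ∀ H : SFun E' O', subst a H = ∑ k ∈ Finset.range (Fintype.card O + 1),
      ((k.factorial : ℝ)⁻¹) • ((dirD n)^[k] fun y => oddSubst b (H y)) (bodyPt a) := fun _ => rfl
  have hG := contDiffOn_oddSubst b hF
  have hpd : ∀ c, ContDiffOn ℝ ∞ (fun y => oddSubst b (pd c F y)) V := fun c =>
    contDiffOn_oddSubst b (pd_contDiffOn hV hF c)
  have hmul := fun (c : Gr O) (H : (E' → ℝ) → Gr O) (k : ℕ) (hH : ContDiffOn ℝ ∞ H V) =>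
    dirD_iterate_const_mul hV hn c hH k hy
  have hA : ∀ k, (dirD n)^[k] (fun y => oddD o (oddSubst b (F y))) (bodyPt a)
      = ∑ o', oddD o (b o') * (dirD n)^[k] (fun y => oddSubst b (pd (.inr o') F y)) (bodyPt a) := by
    intro k
    have h1 : (fun y => oddD o (oddSubst b (F y)))
        = fun y => ∑ o', oddD o (b o') * oddSubst b (pd (.inr o') F y) :=
      funext fun y => oddD_oddSubst hb o (F y)
    rw [h1, dirD_iterate_sum hV n _
      (fun o' => contDiffOn_mul contDiffOn_const (hpd (.inr o'))) k hy]
    exact Finset.sum_congr rfl fun o' _ => hmul _ _ k (hpd (.inr o'))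
  have hB : ∀ k, (dirD n)^[k] (dirD (fun e => oddD o (n e)) fun y => oddSubst b (F y)) (bodyPt a)
      = ∑ e, oddD o (a (.inl e)) *
        (dirD n)^[k] (fun y => oddSubst b (pd (.inl e) F y)) (bodyPt a) := by
    intro k
    have h1 : Set.EqOn (dirD (fun e => oddD o (n e)) fun y => oddSubst b (F y))
        (fun y => ∑ e, oddD o (a (.inl e)) * oddSubst b (pd (.inl e) F y)) V := fun y hy => by
      simp only [dirD, hn', pd_inl]
      refine Finset.sum_congr rfl fun e _ => ?_
      rw [fderiv_linear_apply (oddSubst b) (differentiableAt_of_contDiffOn hV hF hy)]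
    rw [dirD_iterate_congr hV h1 n k hy,
      dirD_iterate_sum hV n _ (fun e => contDiffOn_mul contDiffOn_const (hpd (.inl e))) k hy]
    exact Finset.sum_congr rfl fun e _ => hmul _ _ k (hpd (.inl e))
  -- Differentiation lowers the order of the even Taylor steps by one, so a sum over orders below
  -- `card O` appears where `subst` goes up to `card O`. The missing term is zero: it has level `1 +
  -- 2 * card O`, the extra `1` coming from the odd factor `oddD o (a (.inl e))`.
  have hC : ∀ e, ∑ k ∈ Finset.range (Fintype.card O), ((k.factorial : ℝ)⁻¹) •
      (oddD o (a (.inl e)) * (dirD n)^[k] (fun y => oddSubst b (pd (.inl e) F y)) (bodyPt a))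
      = oddD o (a (.inl e)) * subst a (pd (.inl e) F) := by
    intro e
    rw [hS, Finset.sum_range_succ, mul_add, Finset.mul_sum]
    have h0 : oddD o (a (.inl e)) * ((((Fintype.card O).factorial : ℝ)⁻¹) •
        ((dirD n)^[Fintype.card O] fun y => oddSubst b (pd (.inl e) F y)) (bodyPt a)) = 0 := by
      rw [mul_smul_comm]
      have hf1 : oddD o (a (.inl e)) ∈ filt 1 := mem_filt_one.2
        (body_of_odd (oddD_mem_of_even o (ha (.inl e))))
      have hf2 := dirD_iterate_mem_filt (fun e => nilpotentPart_mem_filt (ha (.inl e)))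
        (fun y => oddSubst b (pd (.inl e) F y)) (Fintype.card O) (bodyPt a)
      rw [eq_zero_of_mem_filt_card (filt_antitone (by omega) (mul_mem_filt_add hf1 hf2)),
        smul_zero]
    rw [h0, add_zero]
    simp only [mul_smul_comm]
  rw [Fintype.sum_sum_type]
  have hO : ∑ o', oddD o (a (.inr o')) * subst a (pd (.inr o') F)
      = ∑ k ∈ Finset.range (Fintype.card O + 1), ((k.factorial : ℝ)⁻¹) •
        (dirD n)^[k] (fun y => oddD o (oddSubst b (F y))) (bodyPt a) := by
    simp only [hA, hS, Finset.mul_sum, Finset.smul_sum, mul_smul_comm]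
    exact Finset.sum_comm
  simp only [← hC]
  -- Order `k + 1` on the left is matched with order `k` of the even directions and order `k + 1` of
  -- the odd ones. Order `0` involves odd directions only.
  rw [hO, hS, map_sum, Finset.sum_range_succ', Finset.sum_range_succ' (n := Fintype.card O),
    Finset.sum_comm, ← add_assoc, ← Finset.sum_add_distrib]
  congr 1
  · refine Finset.sum_congr rfl fun k _ => ?_
    have hk := oddD_dirD_iterate hV hn hG o k hy
    simp only at hk
    rw [map_smul, hk, Pi.add_apply, Pi.smul_apply, hB, smul_add,
      smul_smul, Finset.smul_sum]
    congr 1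
    refine Finset.sum_congr rfl fun e _ => ?_
    congr 1
    rw [Nat.factorial_succ]
    push_cast
    field_simp
  · simp

/-- Both sides have the same body and no odd derivatives, the latter by the chain rule. This pattern
replaces direct manipulation of the Taylor sum here and in `subst_coord`. -/
theorem subst_algebraMap (ha : ∀ c, a c ∈ parityPart O (par c)) (r : ℝ) :
    subst a (fun _ => algebraMap ℝ (Gr O') r) = algebraMap ℝ (Gr O) r := by
  rw [← sub_eq_zero]
  refine eq_zero_of_oddD_eq_zero ?_ fun o => ?_
  · rw [body_sub, body_subst ha, body_algebraMap, body_algebraMap, sub_self]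
  · rw [map_sub, oddD_subst isOpen_univ (Set.mem_univ _) ha contDiffOn_const, oddD_algebraMap,
      sub_zero]
    refine Finset.sum_eq_zero fun c _ => ?_
    rw [show pd c (fun _ => algebraMap ℝ (Gr O') r : SFun E' O') = 0 from
      funext fun y => pd_const c r y, subst_zero, mul_zero]

theorem subst_one (ha : ∀ c, a c ∈ parityPart O (par c)) :
    subst a (fun _ => 1 : SFun E' O') = 1 := by
  have h := subst_algebraMap ha 1
  rwa [map_one, map_one] at h

theorem subst_coord (ha : ∀ c, a c ∈ parityPart O (par c)) (c : E' ⊕ O') :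
    subst a (coord c) = a c := by
  rw [← sub_eq_zero]
  refine eq_zero_of_oddD_eq_zero ?_ fun o => ?_
  · rw [body_sub, body_subst ha]
    rcases c with e | o
    · simp only [coord, body_algebraMap, bodyPt, sub_self]
    · rw [coord, body_ι, body_of_odd (ha (.inr o)), sub_self]
  · have h : ∀ c', pd c' (coord c : SFun E' O') = fun _ => if c' = c then 1 else 0 := fun c' =>
      funext fun y => pd_coord c' c y
    rw [map_sub, oddD_subst isOpen_univ (Set.mem_univ _) ha (contDiff_coord c).contDiffOn,
      Finset.sum_eq_single c]
    · rw [h, if_pos rfl, subst_one ha, mul_one, sub_self]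
    · intro c' _ hc
      rw [h, if_neg hc]
      change oddD o (a c') * subst a (0 : SFun E' O') = 0
      rw [subst_zero, mul_zero]
    · exact fun hc => absurd (Finset.mem_univ c) hc

/-- Substitution is multiplicative. -/
theorem subst_mul (hV : IsOpen V) (hy : bodyPt a ∈ V) (ha : ∀ c, a c ∈ parityPart O (par c))
    (h₁ : ContDiffOn ℝ ∞ F₁ V) (h₂ : ContDiffOn ℝ ∞ F₂ V) :
    subst a (fun y => F₁ y * F₂ y) = subst a F₁ * subst a F₂ := by
  -- The family is indexed by all pairs of smooth functions, because the derivative of the defect of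
  -- `(F₁, F₂)` is a combination of the defects of `(∂F₁, F₂)` and `(twist F₁, ∂F₂)`.
  let ι := {F : SFun E' O' // ContDiffOn ℝ ∞ F V}
  have key : ∀ p : ι × ι,
      subst a (fun y => p.1.1 y * p.2.1 y) - subst a p.1.1 * subst a p.2.1 = 0 := by
    refine family_eq_zero _ (fun p => ?_) fun k hk p o => ?_
    · rw [body_sub, body_mul, body_subst ha, body_subst ha, body_subst ha, body_mul, sub_self]
    · obtain ⟨⟨F₁, h₁⟩, ⟨F₂, h₂⟩⟩ := p
      have hsum : oddD o (subst a (fun y => F₁ y * F₂ y) - subst a F₁ * subst a F₂)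
          = ∑ c, oddD o (a c) *
            ((subst a (fun y => pd c F₁ y * F₂ y) - subst a (pd c F₁) * subst a F₂)
            + (subst a (fun y => twist (par c) (F₁ y) * pd c F₂ y)
              - subst a (fun y => twist (par c) (F₁ y)) * subst a (pd c F₂))) := by
        rw [map_sub, oddD_mul, oddD_subst hV hy ha (contDiffOn_mul h₁ h₂),
          oddD_subst hV hy ha h₁, oddD_subst hV hy ha h₂, Finset.sum_mul, Finset.mul_sum,
          ← Finset.sum_add_distrib, ← Finset.sum_sub_distrib]
        refine Finset.sum_congr rfl fun c _ => ?_
        have htw : ContDiffOn ℝ ∞ (fun y => twist (par c) (F₁ y)) V :=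
          contDiffOn_linear (twist (par c)).toLinearMap h₁
        have hc1 : subst a (pd c fun y => F₁ y * F₂ y)
            = subst a (fun y => pd c F₁ y * F₂ y)
              + subst a (fun y => twist (par c) (F₁ y) * pd c F₂ y) := by
          rw [← subst_add hV hy (contDiffOn_mul (pd_contDiffOn hV h₁ c) h₂)
            (contDiffOn_mul htw (pd_contDiffOn hV h₂ c))]
          refine subst_congr hV hy fun y hy => ?_
          exact pd_mul c (differentiableAt_of_contDiffOn hV h₁ hy)
            (differentiableAt_of_contDiffOn hV h₂ hy)
        have hc2 : twist 1 (subst a F₁) * oddD o (a c)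
            = oddD o (a c) * subst a (fun y => twist (par c) (F₁ y)) := by
          rw [← twist_subst hV hy ha h₁, mul_eq_twist_mul (oddD_mem o (ha c))]
          rcases zmod_two_cases (par c) with h | h <;> rw [h]
          · rw [twist_zero, zero_add]
          · rw [one_add_one_zmod_two, twist_zero]
        rw [hc1, ← mul_assoc (twist 1 _), hc2]
        noncomm_ring
      rw [hsum]
      refine Submodule.sum_mem _ fun c _ => mul_mem_filt _ (add_mem ?_ ?_)
      · exact hk (⟨pd c F₁, pd_contDiffOn hV h₁ c⟩, ⟨F₂, h₂⟩)
      · exact hk (⟨fun y => twist (par c) (F₁ y), contDiffOn_linear (twist (par c)).toLinearMap h₁⟩,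
          ⟨pd c F₂, pd_contDiffOn hV h₂ c⟩)
  exact sub_eq_zero.1 (key (⟨F₁, h₁⟩, ⟨F₂, h₂⟩))

theorem subst_mem (hV : IsOpen V) (hy : bodyPt a ∈ V) (ha : ∀ c, a c ∈ parityPart O (par c))
    (hF : ContDiffOn ℝ ∞ F V) {p : ZMod 2} (hp : ∀ y ∈ V, F y ∈ parityPart O' p) :
    subst a F ∈ parityPart O p := by
  rw [mem_parityPart_iff, twist_subst hV hy ha hF]
  have h := subst_mul (F₁ := fun _ => algebraMap ℝ (Gr O') (sgn p)) hV hy ha contDiffOn_const hF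
  rw [subst_algebraMap ha, ← Algebra.smul_def] at h
  rw [← h]
  refine subst_congr hV hy fun y hy => ?_
  rw [mem_parityPart_iff.1 (hp y hy), Algebra.smul_def]

end Substitution

/-! ## Pullbacks -/

section Pullback

open Filter Topology

variable {E O E' O' E'' O'' : Type*} [Fintype E] [DecidableEq E] [Fintype O] [DecidableEq O]
  [Fintype E'] [DecidableEq E'] [Fintype O'] [DecidableEq O']
  [Fintype E''] [DecidableEq E''] [Fintype O''] [DecidableEq O'']

/-- The functions `φ c` are the coordinate expressions of a morphism of superdomains with reduced
domains `U` and `V`. -/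
structure IsMorphism (φ : E' ⊕ O' → SFun E O) (U : Set (E → ℝ)) (V : Set (E' → ℝ)) : Prop where
  isOpen_source : IsOpen U
  isOpen_target : IsOpen V
  mapsTo : Set.MapsTo (bodyMap φ) U V
  smooth : ∀ c, ContDiffOn ℝ ∞ (φ c) U
  parity : ∀ c, ∀ x ∈ U, φ c x ∈ parityPart O (par c)

/-! ### Smoothness and algebraic properties of pullbacks -/

variable {φ : E' ⊕ O' → SFun E O} {U : Set (E → ℝ)} {V : Set (E' → ℝ)} {F G : SFun E' O'}
  {x : E → ℝ}

/-- In a pullback the point `x` enters through the Taylor coefficients, the odd substitution and the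
point of evaluation. Joint smoothness in `x` and the Taylor variable `y` survives every step, and `y
= bodyMap φ x` is inserted only at the end. -/
theorem contDiffOn_dirD_param {n : E' → (E → ℝ) → Gr O} {H : (E → ℝ) → (E' → ℝ) → Gr O}
    (hU : IsOpen U) (hV : IsOpen V) (hn : ∀ e, ContDiffOn ℝ ∞ (n e) U)
    (hH : ContDiffOn ℝ ∞ (fun p : (E → ℝ) × (E' → ℝ) => H p.1 p.2) (U ×ˢ V)) :
    ContDiffOn ℝ ∞ (fun p : (E → ℝ) × (E' → ℝ) => dirD (fun e => n e p.1) (H p.1) p.2)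
      (U ×ˢ V) := by
  have hUV : IsOpen (U ×ˢ V) := hU.prod hV
  refine ContDiffOn.sum fun e _ => contDiffOn_mul ?_ ?_
  · exact (hn e).comp contDiffOn_fst fun p hp => hp.1
  -- The partial derivative in `y` is the derivative of the joint map in the direction `(0,
  -- Pi.single e 1)`.
  · refine (contDiffOn_fderiv_apply hUV hH ((0, Pi.single e 1) : (E → ℝ) × (E' → ℝ))).congr ?_
    rintro ⟨x, y⟩ hp
    have hd := (differentiableAt_of_contDiffOn hUV hH hp).hasFDerivAt
    have h := hd.comp y (hasFDerivAt_prodMk_right x y)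
    have h' : HasFDerivAt (H x) _ y := h
    simp only
    rw [h'.fderiv]
    rfl

theorem contDiffOn_oddSubst_param {b : O' → SFun E O} (hb : ∀ o, ContDiffOn ℝ ∞ (b o) U)
    (hbp : ∀ o, ∀ x ∈ U, b o x ∈ parityPart O 1) (w : Gr O') :
    ContDiffOn ℝ ∞ (fun x => oddSubst (fun o => b o x) w) U := by
  induction w using ExteriorAlgebra.induction with
  | algebraMap r =>
    exact contDiffOn_const.congr fun x hx => oddSubst_algebraMap (fun o => hbp o x hx) r
  | ι v =>
    have h : ContDiffOn ℝ ∞ (fun x => ∑ o, v o • b o x) U :=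
      ContDiffOn.sum fun o _ => contDiffOn_linear (v o • LinearMap.id) (hb o)
    exact h.congr fun x hx => by
      rw [oddSubst_ι (fun o => hbp o x hx), Fintype.linearCombination_apply]
  | mul y z hy hz =>
    exact (contDiffOn_mul hy hz).congr fun x hx => oddSubst_mul (fun o => hbp o x hx) y z
  | add y z hy hz =>
    simp only [map_add]
    exact hy.add hz

/-- Expanding `F` in a basis of `Gr O'` separates the variables: the coefficients depend smoothly on
`y`, and the substituted basis elements smoothly on `x`. -/
theorem IsMorphism.contDiffOn_oddSubst (hφ : IsMorphism φ U V) (hF : ContDiffOn ℝ ∞ F V) :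
    ContDiffOn ℝ ∞ (fun p : (E → ℝ) × (E' → ℝ) =>
      oddSubst (fun o => φ (.inr o) p.1) (F p.2)) (U ×ˢ V) := by
  let B := Module.finBasis ℝ (Gr O')
  have h1 : ∀ i, ContDiffOn ℝ ∞ (fun p : (E → ℝ) × (E' → ℝ) =>
      oddSubst (fun o => φ (.inr o) p.1) (B i)) (U ×ˢ V) := fun i =>
    (contDiffOn_oddSubst_param (fun o => hφ.smooth (.inr o)) (fun o => hφ.parity (.inr o))
      (B i)).comp contDiffOn_fst fun p hp => hp.1
  have h2 : ∀ i, ContDiffOn ℝ ∞ (fun p : (E → ℝ) × (E' → ℝ) => B.coord i (F p.2)) (U ×ˢ V) :=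
    fun i => ((LinearMap.toContinuousLinearMap (B.coord i)).contDiff.comp_contDiffOn hF).comp
      contDiffOn_snd fun p hp => hp.2
  have h3 : ContDiffOn ℝ ∞ (fun p : (E → ℝ) × (E' → ℝ) => ∑ i,
      algebraMap ℝ (Gr O) (B.coord i (F p.2)) * oddSubst (fun o => φ (.inr o) p.1) (B i))
      (U ×ˢ V) :=
    ContDiffOn.sum fun i _ => contDiffOn_mul (contDiffOn_algebraMap (h2 i)) (h1 i)
  refine h3.congr fun p _ => ?_
  conv_lhs => rw [← B.sum_repr (F p.2)]
  simp only [map_sum, map_smul, ← Algebra.smul_def]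
  rfl

theorem IsMorphism.contDiffOn_dirD_iterate (hφ : IsMorphism φ U V) (hF : ContDiffOn ℝ ∞ F V)
    {n : E' → (E → ℝ) → Gr O} (hn : ∀ e, ContDiffOn ℝ ∞ (n e) U) (k : ℕ) :
    ContDiffOn ℝ ∞ (fun x => (dirD fun e => n e x)^[k]
      (fun y => oddSubst (fun o => φ (.inr o) x) (F y)) (bodyMap φ x)) U := by
  have hk : ContDiffOn ℝ ∞ (fun p : (E → ℝ) × (E' → ℝ) => (dirD fun e => n e p.1)^[k]
      (fun y => oddSubst (fun o => φ (.inr o) p.1) (F y)) p.2) (U ×ˢ V) := by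
    induction k with
    | zero => exact hφ.contDiffOn_oddSubst hF
    | succ k ih =>
      simp only [Function.iterate_succ_apply']
      exact contDiffOn_dirD_param (H := fun x => (dirD fun e => n e x)^[k]
        (fun y => oddSubst (fun o => φ (.inr o) x) (F y))) hφ.isOpen_source hφ.isOpen_target hn ih
  have hbody : ContDiffOn ℝ ∞ (bodyMap φ) U :=
    contDiffOn_pi.2 fun e => contDiffOn_body (hφ.smooth (.inl e))
  exact hk.comp (contDiffOn_id.prodMk hbody) fun x hx => ⟨hx, hφ.mapsTo hx⟩

theorem IsMorphism.contDiffOn_pull (hφ : IsMorphism φ U V) (hF : ContDiffOn ℝ ∞ F V) :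
    ContDiffOn ℝ ∞ (pull φ F) U := by
  have hn : ∀ e, ContDiffOn ℝ ∞
      (fun x => φ (.inl e) x - algebraMap ℝ (Gr O) (body (φ (.inl e) x))) U := fun e =>
    (hφ.smooth (.inl e)).sub (contDiffOn_algebraMap (contDiffOn_body (hφ.smooth (.inl e))))
  have hT := ContDiffOn.sum (s := Finset.range (Fintype.card O + 1)) fun k _ =>
    contDiffOn_linear (((k.factorial : ℝ)⁻¹) • LinearMap.id) (hφ.contDiffOn_dirD_iterate hF hn k)
  exact hT.congr fun x _ => rfl

theorem IsMorphism.body_pull (hφ : IsMorphism φ U V) (hx : x ∈ U) (F : SFun E' O') :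
    body (pull φ F x) = body (F (bodyMap φ x)) :=
  body_subst (fun c => hφ.parity c x hx) F

theorem IsMorphism.pull_congr (hφ : IsMorphism φ U V) (hx : x ∈ U) (h : Set.EqOn F G V) :
    pull φ F x = pull φ G x :=
  subst_congr hφ.isOpen_target (hφ.mapsTo hx) h

theorem pull_congr_left {ψ : E' ⊕ O' → SFun E O} (h : ∀ c, φ c x = ψ c x) (F : SFun E' O') :
    pull φ F x = pull ψ F x := by
  simp only [pull, h]

theorem IsMorphism.pull_mul (hφ : IsMorphism φ U V) (hx : x ∈ U) (hF : ContDiffOn ℝ ∞ F V)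
    (hG : ContDiffOn ℝ ∞ G V) : pull φ (fun y => F y * G y) x = pull φ F x * pull φ G x :=
  subst_mul hφ.isOpen_target (hφ.mapsTo hx) (fun c => hφ.parity c x hx) hF hG

theorem IsMorphism.pull_sum (hφ : IsMorphism φ U V) (hx : x ∈ U) {ι : Type*} (s : Finset ι)
    {F : ι → SFun E' O'} (hF : ∀ i ∈ s, ContDiffOn ℝ ∞ (F i) V) :
    pull φ (fun y => ∑ i ∈ s, F i y) x = ∑ i ∈ s, pull φ (F i) x :=
  subst_sum (a := fun c => φ c x) hφ.isOpen_target (hφ.mapsTo hx) s hF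

theorem IsMorphism.pull_coord (hφ : IsMorphism φ U V) (hx : x ∈ U) (c : E' ⊕ O') :
    pull φ (coord c) x = φ c x :=
  subst_coord (fun c => hφ.parity c x hx) c

theorem IsMorphism.pull_one (hφ : IsMorphism φ U V) (hx : x ∈ U) :
    pull φ (fun _ => 1) x = 1 :=
  subst_one fun c => hφ.parity c x hx

theorem IsMorphism.pull_algebraMap (hφ : IsMorphism φ U V) (hx : x ∈ U) (r : ℝ) :
    pull φ (fun _ => algebraMap ℝ (Gr O') r) x = algebraMap ℝ (Gr O) r :=
  subst_algebraMap (fun c => hφ.parity c x hx) r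

theorem IsMorphism.pull_mem (hφ : IsMorphism φ U V) (hx : x ∈ U) (hF : ContDiffOn ℝ ∞ F V)
    {p : ZMod 2} (hp : ∀ y ∈ V, F y ∈ parityPart O' p) : pull φ F x ∈ parityPart O p :=
  subst_mem (a := fun c => φ c x) hφ.isOpen_target (hφ.mapsTo hx) (fun c => hφ.parity c x hx) hF hp

theorem IsMorphism.pull_neg (hφ : IsMorphism φ U V) (hx : x ∈ U) (hF : ContDiffOn ℝ ∞ F V) :
    pull φ (-F) x = -pull φ F x := by
  have h := hφ.pull_mul hx (F := fun _ => algebraMap ℝ (Gr O') (-1)) contDiffOn_const hF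
  rw [hφ.pull_algebraMap hx] at h
  simp only [map_neg, map_one, neg_mul, one_mul] at h
  exact h

/-! ### The chain rule and functoriality -/

theorem body_fderiv {W : Type*} [NormedAddCommGroup W] [NormedSpace ℝ W] {F : W → Gr O} {x : W}
    (hF : DifferentiableAt ℝ F x) (v : W) :
    body (fderiv ℝ F x v) = fderiv ℝ (fun y => body (F y)) x v := by
  have h := ((LinearMap.toContinuousLinearMap (bodyHom O).toLinearMap).hasFDerivAt
    (x := F x)).comp x hF.hasFDerivAt
  have h' : HasFDerivAt (fun y => body (F y)) _ x := h
  rw [h'.fderiv]; rfl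

/-- On bodies, a pullback is composition with the underlying map, so this is the classical chain
rule. It starts the induction for even derivatives. -/
theorem IsMorphism.body_fderiv_pull (hφ : IsMorphism φ U V) (hx : x ∈ U)
    (hF : ContDiffOn ℝ ∞ F V) (v : E → ℝ) :
    body (fderiv ℝ (pull φ F) x v)
      = ∑ e, body (fderiv ℝ (φ (.inl e)) x v) * body (pd (.inl e) F (bodyMap φ x)) := by
  rw [body_fderiv (differentiableAt_of_contDiffOn hφ.isOpen_source (hφ.contDiffOn_pull hF) hx)]
  have h1 : (fun y => body (pull φ F y)) =ᶠ[𝓝 x] fun y => body (F (bodyMap φ y)) :=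
    eventuallyEq_of_eqOn hφ.isOpen_source (fun y hy => hφ.body_pull hy F) hx
  have hdF : DifferentiableAt ℝ F (bodyMap φ x) :=
    differentiableAt_of_contDiffOn hφ.isOpen_target hF (hφ.mapsTo hx)
  have hdφ : ∀ e, DifferentiableAt ℝ (φ (.inl e)) x := fun e =>
    differentiableAt_of_contDiffOn hφ.isOpen_source (hφ.smooth (.inl e)) hx
  have hb : HasFDerivAt (fun y => body (F y)) (fderiv ℝ (fun y => body (F y)) (bodyMap φ x))
      (bodyMap φ x) := DifferentiableAt.hasFDerivAt
    ((LinearMap.toContinuousLinearMap (bodyHom O').toLinearMap).differentiableAt.comp _ hdF)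
  have hbφ : ∀ e, DifferentiableAt ℝ (fun y => body (φ (.inl e) y)) x := fun e =>
    (LinearMap.toContinuousLinearMap (bodyHom O).toLinearMap).differentiableAt.comp _ (hdφ e)
  have hc : HasFDerivAt (bodyMap φ)
      (ContinuousLinearMap.pi fun e => fderiv ℝ (fun y => body (φ (.inl e) y)) x) x :=
    hasFDerivAt_pi.2 fun e => (hbφ e).hasFDerivAt
  have h2 : HasFDerivAt (fun y => body (F (bodyMap φ y))) _ x := hb.comp x hc
  rw [h1.fderiv_eq, h2.fderiv]
  simp only [body_fderiv (hdφ _), pd_inl, body_fderiv hdF]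
  rw [ContinuousLinearMap.comp_apply]
  set w := (ContinuousLinearMap.pi fun e => fderiv ℝ (fun y => body (φ (.inl e) y)) x) v with hw
  have hsum : w = ∑ e, w e • (Pi.single e 1 : E' → ℝ) := by
    ext e'
    simp [Finset.sum_apply, Pi.single_apply]
  conv_lhs => rw [hsum]
  rw [map_sum]
  refine Finset.sum_congr rfl fun e _ => ?_
  rw [map_smul, smul_eq_mul]
  rfl

theorem IsMorphism.pd_inr_pull (hφ : IsMorphism φ U V) (hx : x ∈ U) (hF : ContDiffOn ℝ ∞ F V)
    (o : O) : pd (.inr o) (pull φ F) x = ∑ c, pd (.inr o) (φ c) x * pull φ (pd c F) x :=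
  oddD_subst (a := fun c => φ c x) hφ.isOpen_target (hφ.mapsTo hx) (fun c => hφ.parity c x hx) hF o

/-- The defect of the formula has no body by the classical chain rule. As `∂_e` commutes with odd
derivatives, the odd chain rule writes the odd derivatives of the defect for `F` as combinations of
the defects for the `pd d F`. -/
theorem IsMorphism.pd_inl_pull (hφ : IsMorphism φ U V) (hx : x ∈ U) (hF : ContDiffOn ℝ ∞ F V)
    (e : E) : pd (.inl e) (pull φ F) x = ∑ c, pd (.inl e) (φ c) x * pull φ (pd c F) x := by
  have hU := hφ.isOpen_source
  have key : ∀ F : {F : SFun E' O' // ContDiffOn ℝ ∞ F V},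
      pd (.inl e) (pull φ F.1) x - ∑ c, pd (.inl e) (φ c) x * pull φ (pd c F.1) x = 0 := by
    refine family_eq_zero _ (fun ⟨F, hF⟩ => ?_) fun k hk ⟨F, hF⟩ o => ?_
    · rw [body_sub, body_sum, pd_inl, hφ.body_fderiv_pull hx hF, Fintype.sum_sum_type, sub_eq_zero]
      have h0 : ∀ o, body (pd (.inl e) (φ (.inr o)) x * pull φ (pd (.inr o) F) x) = 0 := by
        intro o
        have h := pd_mem hU (hφ.smooth (.inr o)) (hφ.parity (.inr o)) hx (.inl e)
        rw [par_inl, par_inr, add_zero] at h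
        rw [body_mul, body_of_odd h, zero_mul]
      rw [Finset.sum_congr rfl fun o _ => h0 o, Finset.sum_const_zero, add_zero]
      refine Finset.sum_congr rfl fun e' _ => ?_
      rw [body_mul, hφ.body_pull hx]; rfl
    · have hpF : ∀ c, ContDiffOn ℝ ∞ (pd c F) V := fun c => pd_contDiffOn hφ.isOpen_target hF c
      have hdφ : ∀ a c, DifferentiableAt ℝ (pd a (φ c)) x := fun a c =>
        differentiableAt_of_contDiffOn hU (pd_contDiffOn hU (hφ.smooth c) a) hx
      have hdp : ∀ {H : SFun E' O'}, ContDiffOn ℝ ∞ H V → DifferentiableAt ℝ (pull φ H) x :=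
        fun hH => differentiableAt_of_contDiffOn hU (hφ.contDiffOn_pull hH) hx
      have h1 : oddD o (pd (.inl e) (pull φ F) x)
          = ∑ c, (pd (.inl e) (pd (.inr o) (φ c)) x * pull φ (pd c F) x
            + pd (.inr o) (φ c) x * pd (.inl e) (pull φ (pd c F)) x) := by
        have h2 := pd_comm hU (hφ.contDiffOn_pull hF) hx (.inr o) (.inl e)
        rw [par_inl, mul_zero, sgn_zero, one_smul] at h2
        rw [← pd_inr, h2, pd_congr (.inl e)
          (eventuallyEq_of_eqOn hU (fun y hy => hφ.pd_inr_pull hy hF o) hx), pd_sum]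
        · refine Finset.sum_congr rfl fun c _ => ?_
          rw [pd_mul _ (hdφ _ c) (hdp (hpF c)), par_inl, twist_zero]
        · intro c _
          exact differentiableAt_of_contDiffOn hU (contDiffOn_mul
            (pd_contDiffOn hU (hφ.smooth c) _) (hφ.contDiffOn_pull (hpF c))) hx
      have h3 : ∀ c, oddD o (pd (.inl e) (φ c) x * pull φ (pd c F) x)
          = pd (.inl e) (pd (.inr o) (φ c)) x * pull φ (pd c F) x
            + ∑ d, pd (.inr o) (φ d) x * (pd (.inl e) (φ c) x * pull φ (pd c (pd d F)) x) := by
        intro c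
        have h4 := pd_comm hU (hφ.smooth c) hx (.inr o) (.inl e)
        rw [par_inl, mul_zero, sgn_zero, one_smul] at h4
        rw [oddD_mul, ← pd_inr, h4, ← pd_inr o (pull φ (pd c F)), hφ.pd_inr_pull hx (hpF c),
          Finset.mul_sum]
        congr 1
        refine Finset.sum_congr rfl fun d _ => ?_
        have hc := pd_mem hU (hφ.smooth c) (hφ.parity c) hx (.inl e)
        have hd := pd_mem hU (hφ.smooth d) (hφ.parity d) hx (.inr o)
        rw [par_inl, add_zero] at hc
        rw [par_inr] at hd
        -- The sign from exchanging derivatives of `F` is taken through the pullback as a constant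
        -- superfunction, by multiplicativity. It cancels the sign from exchanging the coefficients.
        have h5 : pull φ (pd c (pd d F)) x = sgn (par c * par d) • pull φ (pd d (pd c F)) x := by
          have h6 := hφ.pull_mul hx
            (F := fun _ => algebraMap ℝ (Gr O') (sgn (par c * par d))) contDiffOn_const
            (pd_contDiffOn hφ.isOpen_target (hpF c) d)
          rw [hφ.pull_algebraMap hx, ← Algebra.smul_def] at h6
          rw [← h6]
          refine hφ.pull_congr hx fun y hy => ?_
          rw [pd_comm hφ.isOpen_target hF hy c d, Algebra.smul_def]
        rw [twist_of_mem hc, ← mul_assoc (pd (.inr o) (φ d) x), mul_comm_of_mem hd hc, h5]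
        simp only [smul_mul_assoc, mul_smul_comm, smul_smul, ← sgn_add, mul_assoc]
        congr 2
        have h2 : (2 : ZMod 2) = 0 := rfl
        linear_combination (-(par d * par c)) * h2
      have h7 : oddD o (pd (.inl e) (pull φ F) x - ∑ c, pd (.inl e) (φ c) x * pull φ (pd c F) x)
          = ∑ d, pd (.inr o) (φ d) x * (pd (.inl e) (pull φ (pd d F)) x
            - ∑ c, pd (.inl e) (φ c) x * pull φ (pd c (pd d F)) x) := by
        rw [map_sub, h1, map_sum, Finset.sum_congr rfl fun c _ => h3 c]
        simp only [Finset.sum_add_distrib, mul_sub, Finset.sum_sub_distrib, Finset.mul_sum]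
        rw [add_sub_add_left_eq_sub]
        congr 1
        exact Finset.sum_comm
      simp only
      rw [h7]
      exact Submodule.sum_mem _ fun d _ => mul_mem_filt _ (hk ⟨pd d F, hpF d⟩)
  exact sub_eq_zero.1 (key ⟨F, hF⟩)

/-- The chain rule. -/
theorem IsMorphism.pd_pull (hφ : IsMorphism φ U V) (hx : x ∈ U) (hF : ContDiffOn ℝ ∞ F V)
    (a : E ⊕ O) : pd a (pull φ F) x = ∑ c, pd a (φ c) x * pull φ (pd c F) x := by
  rcases a with e | o
  · exact hφ.pd_inl_pull hx hF e
  · exact hφ.pd_inr_pull hx hF o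

theorem IsMorphism.act_pull (hφ : IsMorphism φ U V) (hx : x ∈ U) (hF : ContDiffOn ℝ ∞ F V)
    (X : VField E O) : act X (pull φ F) x = ∑ c, act X (φ c) x * pull φ (pd c F) x := by
  simp only [act, hφ.pd_pull hx hF, Finset.mul_sum, Finset.sum_mul, mul_assoc]
  exact Finset.sum_comm

/-- Related vector fields act compatibly on functions. -/
theorem IsMorphism.act_pull_of_related (hφ : IsMorphism φ U V) (hx : x ∈ U)
    (hF : ContDiffOn ℝ ∞ F V) {X : VField E O} {Y : VField E' O'}
    (hY : ∀ c, ContDiffOn ℝ ∞ (Y c) V) (h : ∀ c, act X (φ c) x = pull φ (Y c) x) :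
    act X (pull φ F) x = pull φ (act Y F) x := by
  have h1 : pull φ (act Y F) x = ∑ c, pull φ (fun y => Y c y * pd c F y) x :=
    hφ.pull_sum hx _ fun c _ => contDiffOn_mul (hY c) (pd_contDiffOn hφ.isOpen_target hF c)
  rw [hφ.act_pull hx hF, h1]
  refine Finset.sum_congr rfl fun c _ => ?_
  rw [hφ.pull_mul hx (hY c) (pd_contDiffOn hφ.isOpen_target hF c), h]

theorem IsMorphism.bodyMap_pull {ψ : E'' ⊕ O'' → SFun E' O'} (hφ : IsMorphism φ U V)
    (hx : x ∈ U) : bodyMap (fun c => pull φ (ψ c)) x = bodyMap ψ (bodyMap φ x) :=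
  funext fun e => hφ.body_pull hx (ψ (.inl e))

theorem IsMorphism.comp {ψ : E'' ⊕ O'' → SFun E' O'} {W : Set (E'' → ℝ)}
    (hφ : IsMorphism φ U V) (hψ : IsMorphism ψ V W) :
    IsMorphism (fun c => pull φ (ψ c)) U W where
  isOpen_source := hφ.isOpen_source
  isOpen_target := hψ.isOpen_target
  mapsTo x hx := by rw [hφ.bodyMap_pull hx]; exact hψ.mapsTo (hφ.mapsTo hx)
  smooth c := hφ.contDiffOn_pull (hψ.smooth c)
  parity c x hx := hφ.pull_mem hx (hψ.smooth c) (hψ.parity c)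

/-- Functoriality of the pullback. -/
theorem IsMorphism.pull_pull {ψ : E'' ⊕ O'' → SFun E' O'} {W : Set (E'' → ℝ)}
    (hφ : IsMorphism φ U V) (hψ : IsMorphism ψ V W) (hx : x ∈ U) {F : SFun E'' O''}
    (hF : ContDiffOn ℝ ∞ F W) :
    pull φ (pull ψ F) x = pull (fun c => pull φ (ψ c)) F x := by
  have hχ := hφ.comp hψ
  -- The chain rule for the two successive pullbacks and for the composite has the same
  -- coefficients, so the derivatives of the defect for `F` are combinations of the defects for the
  -- `pd d F`.
  have key : ∀ F : {F : SFun E'' O'' // ContDiffOn ℝ ∞ F W},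
      pull φ (pull ψ F.1) x - pull (fun c => pull φ (ψ c)) F.1 x = 0 := by
    refine family_eq_zero _ (fun ⟨F, hF⟩ => ?_) fun k hk ⟨F, hF⟩ o => ?_
    · rw [body_sub, hφ.body_pull hx, hψ.body_pull (hφ.mapsTo hx), hχ.body_pull hx,
        hφ.bodyMap_pull hx, sub_self]
    · have hpF : ∀ c, ContDiffOn ℝ ∞ (pd c F) W := fun c => pd_contDiffOn hψ.isOpen_target hF c
      have h : oddD o (pull φ (pull ψ F) x - pull (fun c => pull φ (ψ c)) F x)
          = ∑ d, pd (.inr o) (pull φ (ψ d)) x *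
            (pull φ (pull ψ (pd d F)) x - pull (fun c => pull φ (ψ c)) (pd d F) x) := by
        rw [map_sub, ← pd_inr, ← pd_inr, hφ.pd_pull hx (hψ.contDiffOn_pull hF), hχ.pd_pull hx hF]
        simp only [mul_sub, Finset.sum_sub_distrib]
        congr 1
        simp only [hφ.pd_pull hx (hψ.smooth _), Finset.sum_mul]
        rw [Finset.sum_comm]
        refine Finset.sum_congr rfl fun c _ => ?_
        have h1 : pull φ (pd c (pull ψ F)) x
            = pull φ (fun y => ∑ d, pd c (ψ d) y * pull ψ (pd d F) y) x :=
          hφ.pull_congr hx fun y hy => hψ.pd_pull hy hF c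
        rw [h1, hφ.pull_sum hx _ fun d _ => contDiffOn_mul
          (pd_contDiffOn hφ.isOpen_target (hψ.smooth d) c) (hψ.contDiffOn_pull (hpF d)),
          Finset.mul_sum]
        refine Finset.sum_congr rfl fun d _ => ?_
        rw [hφ.pull_mul hx (pd_contDiffOn hφ.isOpen_target (hψ.smooth d) c)
          (hψ.contDiffOn_pull (hpF d)), mul_assoc]
      simp only
      rw [h]
      exact Submodule.sum_mem _ fun d _ => mul_mem_filt _ (hk ⟨pd d F, hpF d⟩)
  exact sub_eq_zero.1 (key ⟨F, hF⟩)

end Pullback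

/-! ## Calculus on the antitangent bundle -/

section Antitangent

open Filter Topology

variable {E O E' O' E'' O'' : Type*} [Fintype E] [DecidableEq E] [Fintype O] [DecidableEq O]
  [Fintype E'] [DecidableEq E'] [Fintype O'] [DecidableEq O']
  [Fintype E''] [DecidableEq E''] [Fintype O''] [DecidableEq O'']

theorem antiElim_baseIdx {α : Type*} (s t : E ⊕ O → α) (c : E ⊕ O) :
    antiElim s t (baseIdx c) = s c := by rcases c with e | o <;> rfl

theorem antiElim_diffIdx {α : Type*} (s t : E ⊕ O → α) (c : E ⊕ O) :
    antiElim s t (diffIdx c) = t c := by rcases c with e | o <;> rfl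

theorem forall_antitangent_idx {P : (E ⊕ O) ⊕ (O ⊕ E) → Prop} :
    (∀ a, P a) ↔ (∀ c, P (baseIdx c)) ∧ ∀ c, P (diffIdx c) := by
  refine ⟨fun h => ⟨fun c => h _, fun c => h _⟩, fun h a => ?_⟩
  rcases a with (e | o) | (o | e)
  · exact h.1 (.inl e)
  · exact h.2 (.inr o)
  · exact h.1 (.inr o)
  · exact h.2 (.inl e)

theorem par_baseIdx (c : E ⊕ O) : par (baseIdx c) = par c := by rcases c with e | o <;> rfl

theorem par_diffIdx (c : E ⊕ O) : par (diffIdx c) = par c + 1 := by rcases c with e | o <;> rfl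

theorem sum_antitangent_idx {A : Type*} [AddCommMonoid A] (f : (E ⊕ O) ⊕ (O ⊕ E) → A) :
    ∑ a, f a = ∑ c, f (baseIdx c) + ∑ c, f (diffIdx c) := by
  simp only [Fintype.sum_sum_type, baseIdx, diffIdx]
  abel

theorem diffIdx_injective : Function.Injective (diffIdx : E ⊕ O → (E ⊕ O) ⊕ (O ⊕ E)) := by
  rintro (e | o) (e' | o') h <;> simp_all [diffIdx]

theorem baseIdx_ne_diffIdx (c c' : E ⊕ O) : baseIdx c ≠ diffIdx c' := by
  rcases c with e | o <;> rcases c' with e' | o' <;> simp [baseIdx, diffIdx]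

/-- The projection of the reduced antitangent bundle to the base. -/
def basePt (y : E ⊕ O → ℝ) : E → ℝ := fun e => y (.inl e)

/-- The part of the reduced antitangent bundle over `V`. -/
def above (O : Type*) (V : Set (E → ℝ)) : Set (E ⊕ O → ℝ) := {y | basePt y ∈ V}

theorem contDiff_basePt : ContDiff ℝ ∞ (basePt : (E ⊕ O → ℝ) → E → ℝ) :=
  contDiff_pi.2 fun e => contDiff_apply ℝ ℝ (Sum.inl e)

theorem isOpen_above {V : Set (E → ℝ)} (hV : IsOpen V) : IsOpen (above O V) :=
  hV.preimage contDiff_basePt.continuous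

/-- The inclusion of the odd coordinates of `M` into those of `ΠTM`. -/
def inclMap (E O : Type*) : (O → ℝ) →ₗ[ℝ] (O ⊕ E → ℝ) :=
  LinearMap.pi (Sum.elim (fun o => LinearMap.proj o) fun _ => 0)

theorem incl_apply (f : SFun E O) (y : E ⊕ O → ℝ) :
    incl f y = ExteriorAlgebra.map (inclMap E O) (f (basePt y)) := rfl

/-! ### Functions that do not depend on the differentials -/

variable {V : Set (E → ℝ)} {f g : SFun E O} {y : E ⊕ O → ℝ}

theorem incl_congr (h : f (basePt y) = g (basePt y)) : incl f y = incl g y := by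
  rw [incl_apply, incl_apply, h]

theorem incl_congr_of_mem {f g : SFun E O} (h : ∀ x ∈ V, f x = g x) (hy : y ∈ above O V) :
    incl f y = incl g y := incl_congr (h _ hy)

theorem incl_mul (f g : SFun E O) (y : E ⊕ O → ℝ) :
    incl (fun x => f x * g x) y = incl f y * incl g y := by
  simp only [incl_apply, map_mul]

theorem incl_sum {ι : Type*} (s : Finset ι) (f : ι → SFun E O) (y : E ⊕ O → ℝ) :
    incl (fun x => ∑ i ∈ s, f i x) y = ∑ i ∈ s, incl (f i) y := by
  simp only [incl_apply, map_sum]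

theorem incl_nsmul (n : ℕ) (f : SFun E O) (y : E ⊕ O → ℝ) : incl (n • f) y = n • incl f y := by
  simp only [incl_apply, Pi.smul_apply, map_nsmul]

theorem incl_zero (y : E ⊕ O → ℝ) : incl (0 : SFun E O) y = 0 := by
  rw [incl_apply, Pi.zero_apply, map_zero]

theorem incl_mem {p : ZMod 2} (h : f (basePt y) ∈ parityPart O p) :
    incl f y ∈ parityPart (O ⊕ E) p := map_mem_parityPart _ h

theorem body_incl (f : SFun E O) (y : E ⊕ O → ℝ) : body (incl f y) = body (f (basePt y)) :=
  body_map _ _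

theorem incl_contDiffOn (hf : ContDiffOn ℝ ∞ f V) : ContDiffOn ℝ ∞ (incl f) (above O V) :=
  contDiffOn_linear (ExteriorAlgebra.map (inclMap E O)).toLinearMap
    (hf.comp contDiff_basePt.contDiffOn fun _ hy => hy)

theorem incl_coord (c : E ⊕ O) : (incl (coord c) : SFun (E ⊕ O) (O ⊕ E)) = coord (baseIdx c) := by
  funext y
  rcases c with e | o
  · exact AlgHom.commutes _ _
  · rw [incl_apply, coord, ExteriorAlgebra.map_apply_ι]
    change ExteriorAlgebra.ι ℝ _ = ExteriorAlgebra.ι ℝ (Pi.single (Sum.inl o) 1)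
    congr 1
    ext a
    rcases a with o' | e
    · simp [inclMap, Pi.single_apply]
    · simp [inclMap]

theorem fderiv_incl (hf : DifferentiableAt ℝ f (basePt y)) (v : E ⊕ O → ℝ) :
    fderiv ℝ (incl f) y v
      = ExteriorAlgebra.map (inclMap E O) (fderiv ℝ f (basePt y) (basePt v)) := by
  have hb : HasFDerivAt (basePt : (E ⊕ O → ℝ) → E → ℝ)
      (ContinuousLinearMap.pi fun e => ContinuousLinearMap.proj (R := ℝ) (Sum.inl e)) y :=
    (ContinuousLinearMap.pi fun e => ContinuousLinearMap.proj (R := ℝ) (φ := fun _ => ℝ)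
      (Sum.inl e) : (E ⊕ O → ℝ) →L[ℝ] (E → ℝ)).hasFDerivAt
  have h1 : HasFDerivAt (fun z => f (basePt z)) _ y := hf.hasFDerivAt.comp y hb
  have h2 := fderiv_linear_apply (ExteriorAlgebra.map (inclMap E O)).toLinearMap
    h1.differentiableAt v
  rw [h1.fderiv] at h2
  exact h2

theorem pd_baseIdx_incl (hf : DifferentiableAt ℝ f (basePt y)) (c : E ⊕ O) :
    pd (baseIdx c) (incl f) y = incl (pd c f) y := by
  rcases c with e | o
  · change fderiv ℝ (incl f) y (Pi.single (Sum.inl e) 1) = _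
    rw [fderiv_incl hf]
    have h : basePt (Pi.single (Sum.inl e) 1 : E ⊕ O → ℝ) = Pi.single e 1 := by
      ext e'; simp [basePt, Pi.single_apply]
    rw [h]; rfl
  · change contr (LinearMap.proj (Sum.inl o)) (incl f y) = _
    rw [incl_apply, contr_map]
    rfl

theorem pd_diffIdx_incl (hf : DifferentiableAt ℝ f (basePt y)) (c : E ⊕ O) :
    pd (diffIdx c) (incl f) y = 0 := by
  rcases c with e | o
  · change contr (LinearMap.proj (Sum.inr e)) (incl f y) = _
    rw [incl_apply, contr_map]
    have h : (LinearMap.proj (Sum.inr e) : (O ⊕ E → ℝ) →ₗ[ℝ] ℝ) ∘ₗ inclMap E O = 0 := by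
      ext; rfl
    rw [h, contr]
    simp
  · change fderiv ℝ (incl f) y (Pi.single (Sum.inr o) 1) = _
    rw [fderiv_incl hf]
    have h : basePt (Pi.single (Sum.inr o) 1 : E ⊕ O → ℝ) = 0 := by
      ext e'; simp [basePt]
    rw [h, map_zero, map_zero]

theorem act_incl (X : VField (E ⊕ O) (O ⊕ E)) (hf : DifferentiableAt ℝ f (basePt y)) :
    act X (incl f) y = ∑ c, X (baseIdx c) y * incl (pd c f) y := by
  simp only [act]
  rw [sum_antitangent_idx]
  simp only [pd_baseIdx_incl hf, pd_diffIdx_incl hf, mul_zero, Finset.sum_const_zero, add_zero]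

/-! ### The de Rham differential -/

theorem deRhamLocal_baseIdx (c : E ⊕ O) : deRhamLocal E O (baseIdx c) = coord (diffIdx c) :=
  antiElim_baseIdx _ _ c

theorem deRhamLocal_diffIdx (c : E ⊕ O) : deRhamLocal E O (diffIdx c) = 0 :=
  antiElim_diffIdx _ _ c

theorem deRhamLocal_contDiff (a : (E ⊕ O) ⊕ (O ⊕ E)) : ContDiff ℝ ∞ (deRhamLocal E O a) := by
  revert a
  rw [forall_antitangent_idx]
  refine ⟨fun c => ?_, fun c => ?_⟩
  · rw [deRhamLocal_baseIdx]; exact contDiff_coord _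
  · rw [deRhamLocal_diffIdx]; exact contDiff_const

theorem deRhamLocal_mem (a : (E ⊕ O) ⊕ (O ⊕ E)) (y : E ⊕ O → ℝ) :
    deRhamLocal E O a y ∈ parityPart (O ⊕ E) (1 + par a) := by
  revert a
  rw [forall_antitangent_idx]
  refine ⟨fun c => ?_, fun c => ?_⟩
  · rw [deRhamLocal_baseIdx, par_baseIdx, add_comm, ← par_diffIdx]; exact coord_mem _ _
  · rw [deRhamLocal_diffIdx]; exact zero_mem _

theorem deRhamLocal_sq (a : (E ⊕ O) ⊕ (O ⊕ E)) (y : E ⊕ O → ℝ) :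
    act (deRhamLocal E O) (deRhamLocal E O a) y = 0 := by
  revert a
  rw [forall_antitangent_idx]
  refine ⟨fun c => ?_, fun c => ?_⟩
  · rw [deRhamLocal_baseIdx, act_coord, deRhamLocal_diffIdx]; rfl
  · rw [deRhamLocal_diffIdx, act_zero]

theorem act_deRham (G : SFun (E ⊕ O) (O ⊕ E)) (y : E ⊕ O → ℝ) :
    act (deRhamLocal E O) G y = ∑ c, coord (diffIdx c) y * pd (baseIdx c) G y := by
  simp only [act]
  rw [sum_antitangent_idx]
  simp only [deRhamLocal_baseIdx, deRhamLocal_diffIdx, Pi.zero_apply, zero_mul,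
    Finset.sum_const_zero, add_zero]

theorem deRham_contDiffOn {S : Set (E ⊕ O → ℝ)} {G : SFun (E ⊕ O) (O ⊕ E)} (hS : IsOpen S)
    (hG : ContDiffOn ℝ ∞ G S) : ContDiffOn ℝ ∞ (act (deRhamLocal E O) G) S :=
  act_contDiffOn hS (fun a => (deRhamLocal_contDiff a).contDiffOn) hG

theorem deRham_deRham {S : Set (E ⊕ O → ℝ)} {G : SFun (E ⊕ O) (O ⊕ E)} (hS : IsOpen S)
    (hG : ContDiffOn ℝ ∞ G S) (hy : y ∈ S) :
    act (deRhamLocal E O) (act (deRhamLocal E O) G) y = 0 := by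
  rw [act_act_self_of_odd hS (fun a => (deRhamLocal_contDiff a).contDiffOn) hG
    (fun a => deRhamLocal_mem a y) hy]
  simp only [act] at *
  exact Finset.sum_eq_zero fun a _ => by
    have h := deRhamLocal_sq a y
    simp only [act] at h
    rw [h, zero_mul]

/-! ### The antitangent map of a morphism -/

/-- The coordinate expressions of the antitangent map. -/
def antitangentMap (φ : E' ⊕ O' → SFun E O) :
    (E' ⊕ O') ⊕ (O' ⊕ E') → SFun (E ⊕ O) (O ⊕ E) :=
  antiElim (fun c => incl (φ c)) fun c => act (deRhamLocal E O) (incl (φ c))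

variable {φ : E' ⊕ O' → SFun E O} {U : Set (E → ℝ)} {V' : Set (E' → ℝ)}

theorem antitangentMap_baseIdx (φ : E' ⊕ O' → SFun E O) (c : E' ⊕ O') :
    antitangentMap φ (baseIdx c) = incl (φ c) := antiElim_baseIdx _ _ c

theorem antitangentMap_diffIdx (φ : E' ⊕ O' → SFun E O) (c : E' ⊕ O') :
    antitangentMap φ (diffIdx c) = act (deRhamLocal E O) (incl (φ c)) := antiElim_diffIdx _ _ c

theorem basePt_bodyMap (φ : E' ⊕ O' → SFun E O) (y : E ⊕ O → ℝ) :
    basePt (bodyMap (antitangentMap φ) y) = bodyMap φ (basePt y) :=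
  funext fun e => body_incl (φ (.inl e)) y

theorem IsMorphism.antitangent (hφ : IsMorphism φ U V') :
    IsMorphism (antitangentMap φ) (above O U) (above O' V') where
  isOpen_source := isOpen_above hφ.isOpen_source
  isOpen_target := isOpen_above hφ.isOpen_target
  mapsTo y hy := by
    change basePt _ ∈ V'
    rw [basePt_bodyMap]
    exact hφ.mapsTo hy
  smooth := by
    rw [forall_antitangent_idx]
    refine ⟨fun c => ?_, fun c => ?_⟩
    · rw [antitangentMap_baseIdx]; exact incl_contDiffOn (hφ.smooth c)
    · rw [antitangentMap_diffIdx]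
      exact deRham_contDiffOn (isOpen_above hφ.isOpen_source) (incl_contDiffOn (hφ.smooth c))
  parity := by
    rw [forall_antitangent_idx]
    refine ⟨fun c y hy => ?_, fun c y hy => ?_⟩
    · rw [antitangentMap_baseIdx, par_baseIdx]; exact incl_mem (hφ.parity c _ hy)
    · rw [antitangentMap_diffIdx, par_diffIdx, add_comm]
      exact act_mem (isOpen_above hφ.isOpen_source) (fun a => deRhamLocal_mem a y)
        (incl_contDiffOn (hφ.smooth c)) (fun z hz => incl_mem (hφ.parity c _ hz)) hy

/-- Both sides satisfy a chain rule with the coefficients `pd a (incl (φ c))`, so the defect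
argument applies. -/
theorem IsMorphism.pull_incl (hφ : IsMorphism φ U V') (hy : y ∈ above O U) {F : SFun E' O'}
    (hF : ContDiffOn ℝ ∞ F V') : pull (antitangentMap φ) (incl F) y = incl (pull φ F) y := by
  have hΦ := hφ.antitangent
  have hd : ∀ {f : SFun E O}, ContDiffOn ℝ ∞ f U → DifferentiableAt ℝ f (basePt y) := fun hf =>
    differentiableAt_of_contDiffOn hφ.isOpen_source hf hy
  have key : ∀ F : {F : SFun E' O' // ContDiffOn ℝ ∞ F V'},
      pull (antitangentMap φ) (incl F.1) y - incl (pull φ F.1) y = 0 := by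
    refine family_eq_zero _ (fun ⟨F, hF⟩ => ?_) fun k hk ⟨F, hF⟩ o => ?_
    · rw [body_sub, hΦ.body_pull hy, body_incl, body_incl, basePt_bodyMap, hφ.body_pull hy,
        sub_self]
    · have hpF : ∀ c, ContDiffOn ℝ ∞ (pd c F) V' := fun c => pd_contDiffOn hφ.isOpen_target hF c
      have h1 : ∀ a, pd a (pull (antitangentMap φ) (incl F)) y
          = ∑ c, pd a (incl (φ c)) y * pull (antitangentMap φ) (incl (pd c F)) y := by
        intro a
        rw [hΦ.pd_pull hy (incl_contDiffOn hF), sum_antitangent_idx]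
        -- `incl F` does not depend on the `dx`, so only the base coordinates contribute to the
        -- chain rule.
        have h0 : ∀ c, pull (antitangentMap φ) (pd (diffIdx c) (incl F)) y = 0 := fun c => by
          rw [hΦ.pull_congr hy (G := 0) fun z hz => pd_diffIdx_incl
            (differentiableAt_of_contDiffOn hφ.isOpen_target hF hz) c]
          exact subst_zero
        simp only [h0, mul_zero, Finset.sum_const_zero, add_zero, antitangentMap_baseIdx]
        refine Finset.sum_congr rfl fun c _ => ?_
        congr 1
        exact hΦ.pull_congr hy fun z hz => pd_baseIdx_incl
          (differentiableAt_of_contDiffOn hφ.isOpen_target hF hz) c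
      have h2 : ∀ a, pd a (incl (pull φ F)) y
          = ∑ c, pd a (incl (φ c)) y * incl (pull φ (pd c F)) y := by
        rw [forall_antitangent_idx]
        refine ⟨fun b => ?_, fun b => ?_⟩
        · rw [pd_baseIdx_incl (hd (hφ.contDiffOn_pull hF)), incl_congr_of_mem
            (fun x hx => hφ.pd_pull hx hF b) hy, incl_sum]
          refine Finset.sum_congr rfl fun c _ => ?_
          rw [incl_mul, pd_baseIdx_incl (hd (hφ.smooth c))]
        · rw [pd_diffIdx_incl (hd (hφ.contDiffOn_pull hF))]
          exact (Finset.sum_eq_zero fun c _ => by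
            rw [pd_diffIdx_incl (hd (hφ.smooth c)), zero_mul]).symm
      have h3 : oddD o (pull (antitangentMap φ) (incl F) y - incl (pull φ F) y)
          = ∑ c, pd (.inr o) (incl (φ c)) y *
            (pull (antitangentMap φ) (incl (pd c F)) y - incl (pull φ (pd c F)) y) := by
        rw [map_sub, ← pd_inr, ← pd_inr, h1, h2]
        simp only [mul_sub, Finset.sum_sub_distrib]
      simp only
      rw [h3]
      exact Submodule.sum_mem _ fun c _ => mul_mem_filt _ (hk ⟨pd c F, hpF c⟩)
  exact sub_eq_zero.1 (key ⟨F, hF⟩)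

/-- The de Rham differentials are related by the antitangent map. -/
theorem IsMorphism.deRham_related (hφ : IsMorphism φ U V') (hy : y ∈ above O U)
    (a : (E' ⊕ O') ⊕ (O' ⊕ E')) : act (deRhamLocal E O) (antitangentMap φ a) y
      = pull (antitangentMap φ) (deRhamLocal E' O' a) y := by
  have hΦ := hφ.antitangent
  revert a
  rw [forall_antitangent_idx]
  refine ⟨fun c => ?_, fun c => ?_⟩
  · rw [deRhamLocal_baseIdx, hΦ.pull_coord hy, antitangentMap_diffIdx, antitangentMap_baseIdx]
  · rw [antitangentMap_diffIdx, deRhamLocal_diffIdx,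
      deRham_deRham hΦ.isOpen_source (incl_contDiffOn (hφ.smooth c)) hy]
    exact subst_zero.symm

theorem IsMorphism.deRham_pull (hφ : IsMorphism φ U V') (hy : y ∈ above O U)
    {G : SFun (E' ⊕ O') (O' ⊕ E')} (hG : ContDiffOn ℝ ∞ G (above O' V')) :
    act (deRhamLocal E O) (pull (antitangentMap φ) G) y
      = pull (antitangentMap φ) (act (deRhamLocal E' O') G) y :=
  hφ.antitangent.act_pull_of_related hy hG (fun a => (deRhamLocal_contDiff a).contDiffOn)
    fun a => hφ.deRham_related hy a

/-- Functoriality of the antitangent map. -/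
theorem IsMorphism.antitangentMap_comp {ψ : E'' ⊕ O'' → SFun E' O'} {W : Set (E'' → ℝ)}
    (hφ : IsMorphism φ U V') (hψ : IsMorphism ψ V' W) {χ : E'' ⊕ O'' → SFun E O}
    (hχ : ∀ c, ∀ x ∈ U, χ c x = pull φ (ψ c) x) (hy : y ∈ above O U)
    (a : (E'' ⊕ O'') ⊕ (O'' ⊕ E'')) :
    antitangentMap χ a y = pull (antitangentMap φ) (antitangentMap ψ a) y := by
  have hincl : ∀ c, ∀ z ∈ above O U,
      incl (χ c) z = pull (antitangentMap φ) (incl (ψ c)) z := fun c z hz => by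
    rw [hφ.pull_incl hz (hψ.smooth c), incl_congr_of_mem (hχ c) hz]
  revert a
  rw [forall_antitangent_idx]
  refine ⟨fun c => ?_, fun c => ?_⟩
  · rw [antitangentMap_baseIdx, antitangentMap_baseIdx, hincl c y hy]
  · rw [antitangentMap_diffIdx, antitangentMap_diffIdx, ← hφ.deRham_pull hy
      (incl_contDiffOn (hψ.smooth c))]
    exact act_congr _ (eventuallyEq_of_eqOn (isOpen_above hφ.isOpen_source) (hincl c) hy)

theorem antitangentMap_id {χ : E ⊕ O → SFun E O} (hU : IsOpen U)
    (hχ : ∀ c, ∀ x ∈ U, χ c x = coord c x) (hy : y ∈ above O U) (a : (E ⊕ O) ⊕ (O ⊕ E)) :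
    antitangentMap χ a y = coord a y := by
  have hincl : ∀ c, ∀ z ∈ above O U, incl (χ c) z = coord (baseIdx c) z := fun c z hz => by
    rw [incl_congr_of_mem (hχ c) hz, incl_coord]
  revert a
  rw [forall_antitangent_idx]
  refine ⟨fun c => ?_, fun c => ?_⟩
  · rw [antitangentMap_baseIdx, hincl c y hy]
  · rw [antitangentMap_diffIdx,
      act_congr _ (eventuallyEq_of_eqOn (isOpen_above hU) (hincl c) hy), act_coord,
      deRhamLocal_baseIdx]

/-! ### The Lie derivative along an odd vector field -/

/-- The components of the Lie derivative along an odd vector field. -/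
def lieLocal (X : VField E O) : VField (E ⊕ O) (O ⊕ E) :=
  antiElim (fun c => incl (X c)) fun c => -act (deRhamLocal E O) (incl (X c))

theorem lieLocal_baseIdx (X : VField E O) (c : E ⊕ O) : lieLocal X (baseIdx c) = incl (X c) :=
  antiElim_baseIdx _ _ c

theorem lieLocal_diffIdx (X : VField E O) (c : E ⊕ O) :
    lieLocal X (diffIdx c) = -act (deRhamLocal E O) (incl (X c)) := antiElim_diffIdx _ _ c

/-- For odd `X` the field `i_X` is even, so the bracket is an ordinary commutator. The minus sign in
`i_X` makes the component along `x^c` come out as `+X^c`, and the one along `dx^c` as `-d(X^c)`. -/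
theorem bracket_deRham_interior (X : VField E O) :
    bracket 1 (1 + 1) (deRhamLocal E O) (interiorLocal 1 X) = lieLocal X := by
  have hb : ∀ c, interiorLocal 1 X (baseIdx c) = 0 := fun c => antiElim_baseIdx _ _ c
  have hd : ∀ c, interiorLocal 1 X (diffIdx c) = -incl (X c) := fun c => by
    rw [interiorLocal, antiElim_diffIdx, sgn_one, neg_one_smul]
  have h1 : sgn (1 * (1 + 1)) = 1 := by rw [one_add_one_zmod_two, mul_zero, sgn_zero]
  funext a y
  revert a
  rw [forall_antitangent_idx]
  refine ⟨fun c => ?_, fun c => ?_⟩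
  · simp only [bracket, Pi.sub_apply, Pi.smul_apply]
    rw [hb, deRhamLocal_baseIdx, act_coord, hd, act_zero, h1, lieLocal_baseIdx, one_smul,
      Pi.neg_apply, zero_sub, neg_neg]
  · simp only [bracket, Pi.sub_apply, Pi.smul_apply]
    rw [hd, deRhamLocal_diffIdx, act_zero, smul_zero, sub_zero, act_neg, lieLocal_diffIdx,
      Pi.neg_apply]

variable {X : VField E O}

theorem lieLocal_contDiffOn (hV : IsOpen V) (hX : ∀ c, ContDiffOn ℝ ∞ (X c) V)
    (a : (E ⊕ O) ⊕ (O ⊕ E)) : ContDiffOn ℝ ∞ (lieLocal X a) (above O V) := by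
  revert a
  rw [forall_antitangent_idx]
  refine ⟨fun c => ?_, fun c => ?_⟩
  · rw [lieLocal_baseIdx]; exact incl_contDiffOn (hX c)
  · rw [lieLocal_diffIdx]
    exact (deRham_contDiffOn (isOpen_above hV) (incl_contDiffOn (hX c))).neg

theorem lieLocal_mem (hV : IsOpen V) (hX : ∀ c, ContDiffOn ℝ ∞ (X c) V)
    (hXp : ∀ c, ∀ x ∈ V, X c x ∈ parityPart O (1 + par c)) (hy : y ∈ above O V)
    (a : (E ⊕ O) ⊕ (O ⊕ E)) : lieLocal X a y ∈ parityPart (O ⊕ E) (1 + par a) := by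
  revert a
  rw [forall_antitangent_idx]
  refine ⟨fun c => ?_, fun c => ?_⟩
  · rw [lieLocal_baseIdx, par_baseIdx]; exact incl_mem (hXp c _ hy)
  · rw [lieLocal_diffIdx, par_diffIdx, add_comm (par c)]
    exact neg_mem (act_mem (isOpen_above hV) (fun a => deRhamLocal_mem a y)
      (incl_contDiffOn (hX c)) (fun z hz => incl_mem (hXp c _ hz)) hy)

theorem act_lieLocal_incl (hf : DifferentiableAt ℝ f (basePt y)) :
    act (lieLocal X) (incl f) y = incl (act X f) y := by
  rw [act_incl _ hf]
  have h : incl (act X f) y = ∑ c, incl (X c) y * incl (pd c f) y := by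
    have := incl_sum Finset.univ (fun c x => X c x * pd c f x) y
    simp only [incl_mul] at this
    exact this
  rw [h]
  simp only [lieLocal_baseIdx]

/-- On `x^c` this is how the `dx^c` component of the Lie derivative was formed; on `dx^c` it is `d²
= 0`. -/
theorem bracket_lieLocal_deRham (hV : IsOpen V) (hX : ∀ c, ContDiffOn ℝ ∞ (X c) V)
    (hy : y ∈ above O V) (a : (E ⊕ O) ⊕ (O ⊕ E)) :
    bracket 1 1 (lieLocal X) (deRhamLocal E O) a y = 0 := by
  revert a
  rw [forall_antitangent_idx]
  have h1 : sgn (1 * 1) = -1 := by rw [mul_one, sgn_one]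
  refine ⟨fun c => ?_, fun c => ?_⟩
  · simp only [bracket, Pi.sub_apply, Pi.smul_apply]
    rw [deRhamLocal_baseIdx, act_coord, lieLocal_diffIdx, lieLocal_baseIdx, h1, neg_one_smul,
      Pi.neg_apply, sub_neg_eq_add, neg_add_cancel]
  · simp only [bracket, Pi.sub_apply, Pi.smul_apply]
    rw [deRhamLocal_diffIdx, lieLocal_diffIdx, act_zero, act_neg,
      deRham_deRham (isOpen_above hV) (incl_contDiffOn (hX c)) hy, neg_zero, smul_zero, sub_zero]

theorem act_lieLocal_deRham (hV : IsOpen V) (hX : ∀ c, ContDiffOn ℝ ∞ (X c) V)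
    (hXp : ∀ c, ∀ x ∈ V, X c x ∈ parityPart O (1 + par c)) {G : SFun (E ⊕ O) (O ⊕ E)}
    (hG : ContDiffOn ℝ ∞ G (above O V)) (hy : y ∈ above O V) :
    act (lieLocal X) (act (deRhamLocal E O) G) y
      = -act (deRhamLocal E O) (act (lieLocal X) G) y := by
  have h := act_bracket (isOpen_above hV) (lieLocal_contDiffOn hV hX)
    (fun a => (deRhamLocal_contDiff a).contDiffOn) hG (lieLocal_mem hV hX hXp hy)
    (fun a => deRhamLocal_mem a y) hy
  have h0 : act (bracket 1 1 (lieLocal X) (deRhamLocal E O)) G y = 0 :=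
    Finset.sum_eq_zero fun a _ => by rw [bracket_lieLocal_deRham hV hX hy, zero_mul]
  rw [h0, mul_one, sgn_one, neg_one_smul, sub_neg_eq_add] at h
  exact eq_neg_of_add_eq_zero_left h

theorem act_lieLocal_deRham_incl (hV : IsOpen V) (hX : ∀ c, ContDiffOn ℝ ∞ (X c) V)
    (hXp : ∀ c, ∀ x ∈ V, X c x ∈ parityPart O (1 + par c)) (hf : ContDiffOn ℝ ∞ f V)
    (hy : y ∈ above O V) :
    act (lieLocal X) (act (deRhamLocal E O) (incl f)) y
      = -act (deRhamLocal E O) (incl (act X f)) y := by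
  rw [act_lieLocal_deRham hV hX hXp (incl_contDiffOn hf) hy, act_congr _ (eventuallyEq_of_eqOn
    (isOpen_above hV) (fun z hz => act_lieLocal_incl
      (differentiableAt_of_contDiffOn hV hf hz)) hy)]

/-- On `x^c` the square is `X(X^c) = 0`. On `dx^c` it reduces to the differential of `X(X^c)`,
because the Lie derivative anticommutes with `d`. -/
theorem lieLocal_sq (hV : IsOpen V) (hX : ∀ c, ContDiffOn ℝ ∞ (X c) V)
    (hXp : ∀ c, ∀ x ∈ V, X c x ∈ parityPart O (1 + par c))
    (hsq : ∀ c, ∀ x ∈ V, act X (X c) x = 0) (hy : y ∈ above O V) (a : (E ⊕ O) ⊕ (O ⊕ E)) :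
    act (lieLocal X) (lieLocal X a) y = 0 := by
  revert a
  rw [forall_antitangent_idx]
  have h0 : ∀ c, ∀ z ∈ above O V, incl (act X (X c)) z = (0 : SFun (E ⊕ O) (O ⊕ E)) z :=
    fun c z hz => by
      rw [incl_congr_of_mem (g := 0) (hsq c) hz, incl_zero]; rfl
  refine ⟨fun c => ?_, fun c => ?_⟩
  · rw [lieLocal_baseIdx, act_lieLocal_incl (differentiableAt_of_contDiffOn hV (hX c) hy),
      h0 c y hy]; rfl
  · rw [lieLocal_diffIdx, act_neg, act_lieLocal_deRham_incl hV hX hXp (hX c) hy, neg_neg,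
      act_congr _ (eventuallyEq_of_eqOn (isOpen_above hV) (h0 c) hy), act_zero]

/-- Lie derivatives along related vector fields are related. -/
theorem IsMorphism.lieLocal_related (hφ : IsMorphism φ U V') {Y : VField E' O'}
    (hX : ∀ c, ContDiffOn ℝ ∞ (X c) U)
    (hXp : ∀ c, ∀ x ∈ U, X c x ∈ parityPart O (1 + par c)) (hY : ∀ c, ContDiffOn ℝ ∞ (Y c) V')
    (h : ∀ c, ∀ x ∈ U, act X (φ c) x = pull φ (Y c) x) (hy : y ∈ above O U)
    (a : (E' ⊕ O') ⊕ (O' ⊕ E')) :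
    act (lieLocal X) (antitangentMap φ a) y = pull (antitangentMap φ) (lieLocal Y a) y := by
  have hU := hφ.isOpen_source
  have hincl : ∀ c, ∀ z ∈ above O U,
      incl (act X (φ c)) z = pull (antitangentMap φ) (incl (Y c)) z := fun c z hz => by
    rw [hφ.pull_incl hz (hY c), incl_congr_of_mem (h c) hz]
  revert a
  rw [forall_antitangent_idx]
  refine ⟨fun c => ?_, fun c => ?_⟩
  · rw [antitangentMap_baseIdx, lieLocal_baseIdx,
      act_lieLocal_incl (differentiableAt_of_contDiffOn hU (hφ.smooth c) hy), hincl c y hy]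
  · rw [antitangentMap_diffIdx, lieLocal_diffIdx, act_lieLocal_deRham_incl hU hX hXp (hφ.smooth c)
      hy, hφ.antitangent.pull_neg hy (deRham_contDiffOn (isOpen_above hφ.isOpen_target)
        (incl_contDiffOn (hY c))), ← hφ.deRham_pull hy (incl_contDiffOn (hY c)),
      act_congr _ (eventuallyEq_of_eqOn (isOpen_above hU) (hincl c) hy)]

/-! ### Weights -/

theorem euler_contDiff (w : E ⊕ O → ℕ) (c : E ⊕ O) : ContDiff ℝ ∞ (euler w c) := by
  simp only [euler, ← Nat.cast_smul_eq_nsmul ℝ]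
  exact (contDiffOn_univ.1 (contDiffOn_linear ((w c : ℝ) • LinearMap.id)
    (contDiff_coord c).contDiffOn))

theorem euler_mem (w : E ⊕ O → ℕ) (c : E ⊕ O) (x : E → ℝ) :
    euler w c x ∈ parityPart O (0 + par c) := by
  rw [zero_add]
  exact nsmul_mem (coord_mem c x) (w c)

theorem bracket_euler (p : ZMod 2) (w : E ⊕ O → ℕ) (X : VField E O) (c : E ⊕ O) (x : E → ℝ) :
    bracket 0 p (euler w) X c x = act (euler w) (X c) x - w c • X c x := by
  simp only [bracket, Pi.sub_apply, zero_mul, sgn_zero, one_smul, euler]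
  rw [act_nsmul _ _ (differentiableAt_coord c x), act_coord]

theorem act_euler_coord (w : E ⊕ O → ℕ) (c : E ⊕ O) (x : E → ℝ) :
    act (euler w) (coord c) x = w c • coord c x := by
  rw [act_coord]; rfl

theorem formWeight_baseIdx (c : E ⊕ O) : formWeight E O (baseIdx c) = 0 := antiElim_baseIdx _ _ c

theorem formWeight_diffIdx (c : E ⊕ O) : formWeight E O (diffIdx c) = 1 := antiElim_diffIdx _ _ c

theorem liftWeight_baseIdx (w : E ⊕ O → ℕ) (c : E ⊕ O) : liftWeight w (baseIdx c) = w c :=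
  antiElim_baseIdx _ _ c

theorem liftWeight_diffIdx (w : E ⊕ O → ℕ) (c : E ⊕ O) : liftWeight w (diffIdx c) = w c :=
  antiElim_diffIdx _ _ c

theorem bracket_formWeight_deRham (p : ZMod 2) (a : (E ⊕ O) ⊕ (O ⊕ E)) (y : E ⊕ O → ℝ) :
    bracket 0 p (euler (formWeight E O)) (deRhamLocal E O) a y = deRhamLocal E O a y := by
  revert a
  rw [forall_antitangent_idx]
  refine ⟨fun c => ?_, fun c => ?_⟩
  · rw [bracket_euler, deRhamLocal_baseIdx, act_euler_coord, formWeight_baseIdx,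
      formWeight_diffIdx, one_smul, zero_smul, sub_zero]
  · rw [bracket_euler, deRhamLocal_diffIdx, act_zero, Pi.zero_apply, smul_zero, sub_zero]

theorem bracket_liftWeight_deRham (p : ZMod 2) (w : E ⊕ O → ℕ) (a : (E ⊕ O) ⊕ (O ⊕ E))
    (y : E ⊕ O → ℝ) : bracket 0 p (euler (liftWeight w)) (deRhamLocal E O) a y = 0 := by
  revert a
  rw [forall_antitangent_idx]
  refine ⟨fun c => ?_, fun c => ?_⟩
  · rw [bracket_euler, deRhamLocal_baseIdx, act_euler_coord, liftWeight_baseIdx,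
      liftWeight_diffIdx, sub_self]
  · rw [bracket_euler, deRhamLocal_diffIdx, act_zero, Pi.zero_apply, smul_zero, sub_zero]

theorem act_formWeight_incl (hf : DifferentiableAt ℝ f (basePt y)) :
    act (euler (formWeight E O)) (incl f) y = 0 := by
  rw [act_incl _ hf]
  exact Finset.sum_eq_zero fun c _ => by
    simp only [euler, formWeight_baseIdx, zero_smul, Pi.zero_apply, zero_mul]

theorem act_liftWeight_incl (w : E ⊕ O → ℕ) (hf : DifferentiableAt ℝ f (basePt y)) :
    act (euler (liftWeight w)) (incl f) y = incl (act (euler w) f) y := by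
  rw [act_incl _ hf]
  have h : incl (act (euler w) f) y = ∑ c, incl (euler w c) y * incl (pd c f) y := by
    have := incl_sum Finset.univ (fun c x => euler w c x * pd c f x) y
    simp only [incl_mul] at this
    exact this
  rw [h]
  simp only [euler, liftWeight_baseIdx, incl_nsmul, incl_coord, Pi.smul_apply]

/-- The Euler field satisfies `[ε, d] = d` and kills functions of the base coordinates, so
differentials of such functions have weight one. -/
theorem act_formWeight_deRham_incl (hV : IsOpen V) (hf : ContDiffOn ℝ ∞ f V) (hy : y ∈ above O V) :
    act (euler (formWeight E O)) (act (deRhamLocal E O) (incl f)) y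
      = act (deRhamLocal E O) (incl f) y := by
  have h := act_bracket (p := 0) (q := 1) (isOpen_above hV)
    (fun a => (euler_contDiff (formWeight E O) a).contDiffOn)
    (fun a => (deRhamLocal_contDiff a).contDiffOn) (incl_contDiffOn hf)
    (fun a => euler_mem _ a y) (fun a => deRhamLocal_mem a y) hy
  rw [act_congr_field _ fun a => bracket_formWeight_deRham 1 a y, zero_mul, sgn_zero, one_smul,
    act_congr (deRhamLocal E O) (G := 0) (eventuallyEq_of_eqOn (isOpen_above hV)
      (fun z hz => act_formWeight_incl (differentiableAt_of_contDiffOn hV hf hz)) hy),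
    act_zero, sub_zero] at h
  exact h

/-- The lifted Euler field commutes with `d`, because `x^a` and `dx^a` carry the same weight. -/
theorem act_liftWeight_deRham_incl (w : E ⊕ O → ℕ) (hV : IsOpen V) (hf : ContDiffOn ℝ ∞ f V)
    (hy : y ∈ above O V) :
    act (euler (liftWeight w)) (act (deRhamLocal E O) (incl f)) y
      = act (deRhamLocal E O) (incl (act (euler w) f)) y := by
  have h := act_bracket (p := 0) (q := 1) (isOpen_above hV)
    (fun a => (euler_contDiff (liftWeight w) a).contDiffOn)
    (fun a => (deRhamLocal_contDiff a).contDiffOn) (incl_contDiffOn hf)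
    (fun a => euler_mem _ a y) (fun a => deRhamLocal_mem a y) hy
  have h0 : act (bracket 0 1 (euler (liftWeight w)) (deRhamLocal E O)) (incl f) y = 0 :=
    Finset.sum_eq_zero fun a _ => by rw [bracket_liftWeight_deRham, zero_mul]
  rw [h0, zero_mul, sgn_zero, one_smul, sub_eq_zero] at h
  rw [h]
  exact act_congr _ (eventuallyEq_of_eqOn (isOpen_above hV)
    (fun z hz => act_liftWeight_incl w (differentiableAt_of_contDiffOn hV hf hz)) hy)

end Antitangent

/-! ## The antitangent bundle as a supermanifold -/

section Gluing

open Filter Topology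

variable {E O E' O' : Type*} [Fintype E] [DecidableEq E] [Fintype O] [DecidableEq O]
  [Fintype E'] [DecidableEq E'] [Fintype O'] [DecidableEq O']

theorem IsMorphism.continuousOn_bodyMap {φ : E' ⊕ O' → SFun E O} {U : Set (E → ℝ)}
    {V : Set (E' → ℝ)} (hφ : IsMorphism φ U V) : ContinuousOn (bodyMap φ) U :=
  continuousOn_pi.2 fun e => (contDiffOn_body (hφ.smooth (.inl e))).continuousOn

/-- The restriction of a morphism to the preimage of an open set. -/
theorem IsMorphism.restrict {φ : E' ⊕ O' → SFun E O} {U : Set (E → ℝ)} {V V' : Set (E' → ℝ)}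
    (hφ : IsMorphism φ U V) (hV' : IsOpen V') : IsMorphism φ (U ∩ bodyMap φ ⁻¹' V') V' where
  isOpen_source := hφ.continuousOn_bodyMap.isOpen_inter_preimage hφ.isOpen_source hV'
  isOpen_target := hV'
  mapsTo _ hx := hx.2
  smooth c := (hφ.smooth c).mono Set.inter_subset_left
  parity c x hx := hφ.parity c x hx.1

/-- The conditions on gluing data, without those on the topology of the reduced space. -/
structure IsGluing (M : SuperAtlas.{u} E O) : Prop where
  isOpen_dom : ∀ i, IsOpen (M.dom i)
  isOpen_overlap : ∀ i j, IsOpen (M.overlap i j)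
  overlap_subset : ∀ i j, M.overlap i j ⊆ M.dom i
  overlap_self : ∀ i, M.overlap i i = M.dom i
  mapsTo : ∀ i j, Set.MapsTo (bodyMap (M.trans i j)) (M.overlap i j) (M.overlap j i)
  smooth : ∀ i j c, ContDiffOn ℝ ∞ (M.trans i j c) (M.overlap i j)
  parity : ∀ i j c, ∀ x ∈ M.overlap i j, M.trans i j c x ∈ parityPart O (par c)
  trans_self : ∀ i c, ∀ x ∈ M.dom i, M.trans i i c x = coord c x
  cocycle : ∀ i j k, ∀ x ∈ M.overlap i j, bodyMap (M.trans i j) x ∈ M.overlap j k →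
    x ∈ M.overlap i k ∧ ∀ c, M.trans i k c x = pull (M.trans i j) (M.trans j k c) x

/-! ### Gluing data of the antitangent bundle -/

variable {M : SuperAtlas.{u} E O}

theorem IsSupermanifold.isGluing (hM : IsSupermanifold M) : IsGluing M :=
  ⟨hM.isOpen_dom, hM.isOpen_overlap, hM.overlap_subset, hM.overlap_self, hM.mapsTo, hM.smooth,
    hM.parity, hM.trans_self, hM.cocycle⟩

theorem IsGluing.isMorphism (hM : IsGluing M) (i j : M.Idx) :
    IsMorphism (M.trans i j) (M.overlap i j) (M.overlap j i) :=
  ⟨hM.isOpen_overlap i j, hM.isOpen_overlap j i, hM.mapsTo i j, hM.smooth i j, hM.parity i j⟩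

theorem antitangent_trans (M : SuperAtlas.{u} E O) (i j : (antitangent M).Idx) :
    (antitangent M).trans i j = antitangentMap (M.trans i j) := rfl

theorem IsGluing.isGluing_antitangent (hM : IsGluing M) : IsGluing (antitangent M) where
  isOpen_dom i := isOpen_above (hM.isOpen_dom i)
  isOpen_overlap i j := isOpen_above (hM.isOpen_overlap i j)
  overlap_subset i j _ hy := hM.overlap_subset i j hy
  overlap_self i := congrArg (above O) (hM.overlap_self i)
  mapsTo i j := (hM.isMorphism i j).antitangent.mapsTo
  smooth i j := (hM.isMorphism i j).antitangent.smooth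
  parity i j := (hM.isMorphism i j).antitangent.parity
  trans_self i c y hy := antitangentMap_id (hM.isOpen_dom i) (hM.trans_self i) hy c
  cocycle i j k y hy hy' := by
    have hb : bodyMap (M.trans i j) (basePt y) ∈ M.overlap j k := by
      rw [← basePt_bodyMap]; exact hy'
    refine ⟨(hM.cocycle i j k _ hy hb).1, fun c => ?_⟩
    -- The composite is defined only on the open part of the overlap that is mapped into the third
    -- chart. The first coordinate change is restricted to that part.
    exact IsMorphism.antitangentMap_comp ((hM.isMorphism i j).restrict (hM.isOpen_overlap j k))
      (hM.isMorphism j k) (fun c x hx => (hM.cocycle i j k x hx.1 hx.2).2 c) ⟨hy, hb⟩ c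

/-- The identification of points of the charts. -/
def SuperAtlas.Rel (M : SuperAtlas.{u} E O) (p q : Σ i, M.dom i) : Prop :=
  (p.2 : E → ℝ) ∈ M.overlap p.1 q.1 ∧ bodyMap (M.trans p.1 q.1) p.2 = q.2

/-- The quotient map to the reduced space. -/
def SuperAtlas.toReduced (M : SuperAtlas.{u} E O) (p : Σ i, M.dom i) : M.Reduced :=
  Quot.mk _ p

/-! ### Topology of the reduced spaces -/

theorem IsGluing.bodyMap_self (hM : IsGluing M) (i : M.Idx) {x : E → ℝ} (hx : x ∈ M.dom i) :
    bodyMap (M.trans i i) x = x := by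
  funext e
  rw [bodyMap, hM.trans_self i _ x hx, coord, body_algebraMap]

theorem IsGluing.bodyMap_trans (hM : IsGluing M) {i j k : M.Idx} {x : E → ℝ}
    (hx : x ∈ M.overlap i j) (hx' : bodyMap (M.trans i j) x ∈ M.overlap j k) :
    bodyMap (M.trans i k) x = bodyMap (M.trans j k) (bodyMap (M.trans i j) x) := by
  funext e
  rw [bodyMap, (hM.cocycle i j k x hx hx').2, (hM.isMorphism i j).body_pull hx]
  rfl

theorem IsGluing.equivalence (hM : IsGluing M) : Equivalence M.Rel where
  refl p := ⟨by rw [hM.overlap_self]; exact p.2.2, hM.bodyMap_self p.1 p.2.2⟩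
  symm {p q} h := by
    have hm : (q.2 : E → ℝ) ∈ M.overlap q.1 p.1 := by rw [← h.2]; exact hM.mapsTo _ _ h.1
    refine ⟨hm, ?_⟩
    have h1 := hM.bodyMap_trans h.1 (by rw [h.2]; exact hm)
    rw [h.2, hM.bodyMap_self _ p.2.2] at h1
    exact h1.symm
  trans {p q s} h h' := by
    have hm : bodyMap (M.trans p.1 q.1) p.2 ∈ M.overlap q.1 s.1 := by rw [h.2]; exact h'.1
    exact ⟨(hM.cocycle _ _ _ _ h.1 hm).1, by rw [hM.bodyMap_trans h.1 hm, h.2, h'.2]⟩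

theorem IsGluing.toReduced_eq_iff (hM : IsGluing M) (p q : Σ i, M.dom i) :
    M.toReduced p = M.toReduced q ↔ M.Rel p q := hM.equivalence.quot_mk_eq_iff p q

theorem SuperAtlas.isQuotientMap_toReduced (M : SuperAtlas.{u} E O) : IsQuotientMap M.toReduced :=
  isQuotientMap_quot_mk

theorem SuperAtlas.toReduced_surjective (M : SuperAtlas.{u} E O) :
    Function.Surjective M.toReduced :=
  M.isQuotientMap_toReduced.surjective

/-- Coordinate changes are continuous on open overlaps, so the set of all points identified with
points of an open set is open. -/
theorem IsGluing.isOpenMap_toReduced (hM : IsGluing M) : IsOpenMap M.toReduced := by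
  intro U hU
  rw [← M.isQuotientMap_toReduced.isOpen_preimage, isOpen_sigma_iff]
  intro i
  rw [isOpen_iff_mem_nhds]
  rintro x ⟨q, hq, hqx⟩
  have hr := (hM.toReduced_eq_iff _ _).1 hqx.symm
  have hmem : Sigma.mk q.1 ⁻¹' U ∈ 𝓝 q.2 := (isOpen_sigma_iff.1 hU q.1).mem_nhds hq
  obtain ⟨W, hW, hWU⟩ := mem_nhds_subtype _ _ _ |>.1 hmem
  have hc : ContinuousAt (bodyMap (M.trans i q.1)) x :=
    (hM.isMorphism i q.1).continuousOn_bodyMap.continuousAt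
      ((hM.isOpen_overlap i q.1).mem_nhds hr.1)
  have hW' : bodyMap (M.trans i q.1) ⁻¹' W ∈ 𝓝 (x : E → ℝ) := hc (by
    have h2 : bodyMap (M.trans i q.1) x = q.2 := hr.2
    rw [h2]; exact hW)
  have h1 := (continuous_subtype_val (p := (· ∈ M.dom i))).continuousAt (x := x)
    (Filter.inter_mem hW' ((hM.isOpen_overlap i q.1).mem_nhds hr.1))
  filter_upwards [h1] with z hz
  have hz2 : bodyMap (M.trans i q.1) z ∈ M.dom q.1 :=
    hM.overlap_subset _ _ (hM.mapsTo _ _ hz.2)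
  refine ⟨⟨q.1, ⟨_, hz2⟩⟩, hWU hz.1, ?_⟩
  exact ((hM.toReduced_eq_iff ⟨i, z⟩ ⟨q.1, ⟨_, hz2⟩⟩).2 ⟨hz.2, rfl⟩).symm

theorem IsGluing.toReduced_injective_chart (hM : IsGluing M) (i : M.Idx) :
    Function.Injective fun x : M.dom i => M.toReduced ⟨i, x⟩ := by
  intro x y h
  have hr := ((hM.toReduced_eq_iff _ _).1 h).2
  rw [hM.bodyMap_self i x.2] at hr
  exact Subtype.ext hr

/-- The projection of the antitangent bundle on the level of reduced spaces. -/
def reducedProj (M : SuperAtlas.{u} E O) : (antitangent M).Reduced → M.Reduced :=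
  Quot.map (fun p => ⟨p.1, ⟨basePt p.2.1, p.2.2⟩⟩) fun _ _ h =>
    ⟨h.1, (basePt_bodyMap _ _).symm.trans (congrArg basePt h.2)⟩

theorem continuous_reducedProj (M : SuperAtlas.{u} E O) : Continuous (reducedProj M) := by
  rw [(antitangent M).isQuotientMap_toReduced.continuous_iff]
  refine continuous_sigma fun i => ?_
  have h : Continuous fun y : (antitangent M).dom i => (⟨basePt y.1, y.2⟩ : M.dom i) :=
    (contDiff_basePt.continuous.comp continuous_subtype_val).subtype_mk _
  exact M.isQuotientMap_toReduced.continuous.comp (continuous_sigmaMk.comp h)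

/-- Points over different base points are separated by preimages of open sets of the base. Points
over the same base point lie in a common chart, because overlaps contain full fibres; they are
separated there, and the chart embeds as an open set. -/
theorem IsGluing.t2Space_antitangent (hM : IsGluing M) (ht : T2Space M.Reduced) :
    T2Space (antitangent M).Reduced := by
  have hA := hM.isGluing_antitangent
  refine ⟨fun p q hpq => ?_⟩
  by_cases hb : reducedProj M p = reducedProj M q
  · obtain ⟨⟨i, x⟩, rfl⟩ := (antitangent M).toReduced_surjective p
    obtain ⟨⟨j, y⟩, rfl⟩ := (antitangent M).toReduced_surjective q
    have hr := (hM.toReduced_eq_iff _ _).1 hb.symm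
    have hy : (y : E ⊕ O → ℝ) ∈ (antitangent M).overlap j i := hr.1
    have hy2 : bodyMap ((antitangent M).trans j i) y ∈ (antitangent M).dom i :=
      hA.overlap_subset _ _ (hA.mapsTo _ _ hy)
    have hyz : (antitangent M).toReduced ⟨j, y⟩ = (antitangent M).toReduced ⟨i, ⟨_, hy2⟩⟩ :=
      (hA.toReduced_eq_iff _ _).2 ⟨hy, rfl⟩
    rw [hyz] at hpq ⊢
    have hne : x ≠ ⟨_, hy2⟩ := fun h => hpq (by rw [← h])
    obtain ⟨U, W, hU, hW, hxU, hzW, hd⟩ := t2_separation hne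
    have hop : ∀ U : Set ((antitangent M).dom i), IsOpen U →
        IsOpen ((fun z => (antitangent M).toReduced ⟨i, z⟩) '' U) := fun U hU =>
      (hA.isOpenMap_toReduced.comp isOpenMap_sigmaMk) U hU
    exact ⟨_, _, hop U hU, hop W hW, ⟨x, hxU, rfl⟩, ⟨_, hzW, rfl⟩,
      (Set.disjoint_image_iff (hA.toReduced_injective_chart i)).2 hd⟩
  · obtain ⟨U, W, hU, hW, hpU, hqW, hd⟩ := t2_separation hb
    exact ⟨_, _, hU.preimage (continuous_reducedProj M), hW.preimage (continuous_reducedProj M),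
      hpU, hqW, hd.preimage _⟩

/-- Countably many charts already cover the base, and the charts above them cover the antitangent
bundle. It is thus an open quotient of a countable disjoint union of second countable spaces. -/
theorem IsGluing.secondCountable_antitangent (hM : IsGluing M)
    (hs : SecondCountableTopology M.Reduced) :
    SecondCountableTopology (antitangent M).Reduced := by
  have hA := hM.isGluing_antitangent
  obtain ⟨T, hT, hTU⟩ := TopologicalSpace.isOpen_iUnion_countable
    (fun i : M.Idx => Set.range fun x : M.dom i => M.toReduced ⟨i, x⟩)
    (fun i => (hM.isOpenMap_toReduced.comp isOpenMap_sigmaMk).isOpen_range)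
  have hcount : Countable T := hT.to_subtype
  let q : (Σ i : T, (antitangent M).dom i.1) → (antitangent M).Reduced := fun p =>
    (antitangent M).toReduced ⟨p.1.1, p.2⟩
  have hqc : Continuous q := continuous_sigma fun i =>
    (antitangent M).isQuotientMap_toReduced.continuous.comp
      (continuous_sigmaMk (σ := fun i => (antitangent M).dom i))
  have hqo : IsOpenMap q := isOpenMap_sigma.2 fun i =>
    hA.isOpenMap_toReduced.comp (isOpenMap_sigmaMk (σ := fun i => (antitangent M).dom i))
  have hqs : Function.Surjective q := by
    intro p
    obtain ⟨⟨i, y⟩, rfl⟩ := (antitangent M).toReduced_surjective p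
    have hmem : M.toReduced ⟨i, ⟨basePt y.1, y.2⟩⟩
        ∈ ⋃ i : M.Idx, Set.range fun x : M.dom i => M.toReduced ⟨i, x⟩ :=
      Set.mem_iUnion.2 ⟨i, ⟨basePt y.1, y.2⟩, rfl⟩
    rw [← hTU] at hmem
    obtain ⟨j, hj, x, hx⟩ := Set.mem_iUnion₂.1 hmem
    have hr := (hM.toReduced_eq_iff _ _).1 hx.symm
    have hy : (y : E ⊕ O → ℝ) ∈ (antitangent M).overlap i j := hr.1
    have hy2 : bodyMap ((antitangent M).trans i j) y ∈ (antitangent M).dom j :=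
      hA.overlap_subset _ _ (hA.mapsTo _ _ hy)
    exact ⟨⟨⟨j, hj⟩, ⟨_, hy2⟩⟩, ((hA.toReduced_eq_iff ⟨i, y⟩ ⟨j, ⟨_, hy2⟩⟩).2 ⟨hy, rfl⟩).symm⟩
  exact (IsOpenQuotientMap.mk hqs hqc hqo).isQuotientMap.secondCountableTopology hqo

theorem IsSupermanifold.isSupermanifold_antitangent (hM : IsSupermanifold M) :
    IsSupermanifold (antitangent M) :=
  have hA := hM.isGluing.isGluing_antitangent
  ⟨hA.isOpen_dom, hA.isOpen_overlap, hA.overlap_subset, hA.overlap_self, hA.mapsTo, hA.smooth,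
    hA.parity, hA.trans_self, hA.cocycle, hM.isGluing.t2Space_antitangent hM.t2,
    hM.isGluing.secondCountable_antitangent hM.secondCountable⟩

/-! ### Double vector bundle structure and homological vector fields -/

theorem IsSupermanifold.isVectorBundle_formWeight (hM : IsSupermanifold M) :
    IsVectorBundle (antitangent M) (formWeight E O) where
  weight_le := by
    rw [forall_antitangent_idx]
    exact ⟨fun c => by rw [formWeight_baseIdx]; exact zero_le_one,
      fun c => by rw [formWeight_diffIdx]⟩
  dom_full i x hx y hy := by
    have h : basePt y = basePt x := funext fun e => hy (.inl e) rfl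
    change basePt y ∈ M.dom i
    rw [h]; exact hx
  overlap_full i j x hx y hy := by
    have h : basePt y = basePt x := funext fun e => hy (.inl e) rfl
    change basePt y ∈ M.overlap i j
    rw [h]; exact hx
  homogeneous i j := by
    rw [forall_antitangent_idx, antitangent_trans M i j]
    refine ⟨fun c y hy => ?_, fun c y hy => ?_⟩
    · rw [antitangentMap_baseIdx, formWeight_baseIdx, zero_smul, act_formWeight_incl
        (differentiableAt_of_contDiffOn (hM.isOpen_overlap i j) (hM.smooth i j c) hy)]
    · rw [antitangentMap_diffIdx, formWeight_diffIdx, one_smul,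
        act_formWeight_deRham_incl (hM.isOpen_overlap i j) (hM.smooth i j c) hy]

theorem IsSupermanifold.isVectorBundle_liftWeight (hM : IsSupermanifold M) {w : E ⊕ O → ℕ}
    (hw : IsVectorBundle M w) : IsVectorBundle (antitangent M) (liftWeight w) where
  weight_le := by
    rw [forall_antitangent_idx]
    exact ⟨fun c => by rw [liftWeight_baseIdx]; exact hw.weight_le c,
      fun c => by rw [liftWeight_diffIdx]; exact hw.weight_le c⟩
  dom_full i x hx y hy := hw.dom_full i (basePt x) hx (basePt y) fun e he => hy (.inl e) he
  overlap_full i j x hx y hy :=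
    hw.overlap_full i j (basePt x) hx (basePt y) fun e he => hy (.inl e) he
  homogeneous i j := by
    rw [forall_antitangent_idx, antitangent_trans M i j]
    have h : ∀ c, ∀ z ∈ above O (M.overlap i j), incl (act (euler w) (M.trans i j c)) z
        = (w c • incl (M.trans i j c)) z := fun c z hz => by
      rw [incl_congr_of_mem (g := w c • M.trans i j c) (hw.homogeneous i j c) hz, incl_nsmul]; rfl
    refine ⟨fun c y hy => ?_, fun c y hy => ?_⟩
    · rw [antitangentMap_baseIdx, liftWeight_baseIdx, act_liftWeight_incl w
        (differentiableAt_of_contDiffOn (hM.isOpen_overlap i j) (hM.smooth i j c) hy), h c y hy]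
      rfl
    · have hO := isOpen_above (O := O) (hM.isOpen_overlap i j)
      rw [antitangentMap_diffIdx, liftWeight_diffIdx,
        act_liftWeight_deRham_incl w (hM.isOpen_overlap i j) (hM.smooth i j c) hy,
        act_congr _ (eventuallyEq_of_eqOn hO (h c) hy), act_nsmul _ _
          (differentiableAt_of_contDiffOn hO (incl_contDiffOn (hM.smooth i j c)) hy)]

theorem lieDerivative_eq (X : M.Idx → VField E O) (i : (antitangent M).Idx) :
    lieDerivative M 1 X i = lieLocal (X i) := bracket_deRham_interior (X i)

theorem IsSupermanifold.isHomological_deRham (hM : IsSupermanifold M) :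
    IsHomological (antitangent M) (deRham M) where
  isVectorField :=
    { smooth := fun _ c => (deRhamLocal_contDiff c).contDiffOn
      parity := fun _ c y _ => deRhamLocal_mem c y
      compat := fun i j c _ hy => (hM.isGluing.isMorphism i j).deRham_related hy c }
  sq_zero _ c y _ := deRhamLocal_sq c y

theorem IsSupermanifold.isHomological_lieDerivative (hM : IsSupermanifold M)
    {X : M.Idx → VField E O} (hX : IsHomological M X) :
    IsHomological (antitangent M) (lieDerivative M 1 X) where
  isVectorField :=
    { smooth := fun i c => by
        rw [lieDerivative_eq X i]
        exact lieLocal_contDiffOn (hM.isOpen_dom i) (hX.isVectorField.smooth i) c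
      parity := fun i c y hy => by
        rw [lieDerivative_eq X i]
        exact lieLocal_mem (hM.isOpen_dom i) (hX.isVectorField.smooth i)
          (hX.isVectorField.parity i) hy c
      compat := fun i j c y hy => by
        rw [lieDerivative_eq X i, lieDerivative_eq X j]
        have hs : ∀ i j c, ContDiffOn ℝ ∞ (X i c) (M.overlap i j) := fun i j c =>
          (hX.isVectorField.smooth i c).mono (hM.overlap_subset i j)
        exact (hM.isGluing.isMorphism i j).lieLocal_related (hs i j)
          (fun c x hx => hX.isVectorField.parity i c x (hM.overlap_subset i j hx)) (hs j i)
          (hX.isVectorField.compat i j) hy c }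
  sq_zero i c y hy := by
    rw [lieDerivative_eq X i]
    exact lieLocal_sq (hM.isOpen_dom i) (hX.isVectorField.smooth i) (hX.isVectorField.parity i)
      (hX.sq_zero i) hy c

theorem IsSupermanifold.commute_lieDerivative_deRham (hM : IsSupermanifold M)
    {X : M.Idx → VField E O} (hX : IsVectorField M 1 X) :
    Commute (antitangent M) 1 1 (lieDerivative M 1 X) (deRham M) := by
  intro i c y hy
  rw [lieDerivative_eq X i]
  exact bracket_lieLocal_deRham (hM.isOpen_dom i) (hX.smooth i) hy c

/-- The square of the sum is `Q² + [Q, R] + R²`, and each term vanishes. -/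
theorem IsHomological.add {Q R : M.Idx → VField E O} (hd : ∀ i, IsOpen (M.dom i))
    (hφ : ∀ i j, IsMorphism (M.trans i j) (M.overlap i j) (M.overlap j i))
    (hsub : ∀ i j, M.overlap i j ⊆ M.dom i) (hQ : IsHomological M Q) (hR : IsHomological M R)
    (h : Commute M 1 1 Q R) : IsHomological M (Q + R) where
  isVectorField :=
    { smooth := fun i c => (hQ.isVectorField.smooth i c).add (hR.isVectorField.smooth i c)
      parity := fun i c x hx =>
        add_mem (hQ.isVectorField.parity i c x hx) (hR.isVectorField.parity i c x hx)
      compat := fun i j c x hx => by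
        have h1 : pull (M.trans i j) ((Q + R) j c) x
            = pull (M.trans i j) (Q j c) x + pull (M.trans i j) (R j c) x :=
          subst_add (a := fun c => M.trans i j c x) (hφ i j).isOpen_target ((hφ i j).mapsTo hx)
            ((hQ.isVectorField.smooth j c).mono (hsub j i))
            ((hR.isVectorField.smooth j c).mono (hsub j i))
        rw [h1, ← hQ.isVectorField.compat i j c x hx, ← hR.isVectorField.compat i j c x hx]
        exact act_add_field _ _ _ _ }
  sq_zero i c x hx := by
    have hdQ := differentiableAt_of_contDiffOn (hd i) (hQ.isVectorField.smooth i c) hx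
    have hdR := differentiableAt_of_contDiffOn (hd i) (hR.isVectorField.smooth i c) hx
    have h1 : act (Q i) (R i c) x - (sgn (1 * 1) • act (R i) (Q i c)) x = 0 := h i c x hx
    rw [mul_one, sgn_one, neg_one_smul, Pi.neg_apply, sub_neg_eq_add] at h1
    change act (Q i + R i) (Q i c + R i c) x = 0
    rw [act_add_field, act_add _ hdQ hdR, act_add _ hdQ hdR, hQ.sq_zero i c x hx,
      hR.sq_zero i c x hx, zero_add, add_zero, h1]

theorem IsSupermanifold.hasWeight_formWeight_lieDerivative (hM : IsSupermanifold M)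
    {X : M.Idx → VField E O} (hX : IsVectorField M 1 X) :
    HasWeight (antitangent M) (formWeight E O) 1 0 (lieDerivative M 1 X) := by
  intro i
  rw [forall_antitangent_idx, lieDerivative_eq X i]
  refine ⟨fun c y hy => ?_, fun c y hy => ?_⟩
  · rw [bracket_euler, lieLocal_baseIdx, act_formWeight_incl
      (differentiableAt_of_contDiffOn (hM.isOpen_dom i) (hX.smooth i c) hy), formWeight_baseIdx,
      zero_smul, sub_zero]
  · rw [bracket_euler, lieLocal_diffIdx, act_neg,
      act_formWeight_deRham_incl (hM.isOpen_dom i) (hX.smooth i c) hy, formWeight_diffIdx,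
      one_smul, zero_smul, Pi.neg_apply, sub_self]

theorem IsSupermanifold.hasWeight_liftWeight_lieDerivative (hM : IsSupermanifold M)
    {w : E ⊕ O → ℕ} {k : ℕ} {X : M.Idx → VField E O} (hX : IsVectorField M 1 X)
    (hw : HasWeight M w 1 k X) :
    HasWeight (antitangent M) (liftWeight w) 1 k (lieDerivative M 1 X) := by
  intro i
  have h : ∀ c, ∀ z ∈ above O (M.dom i), incl (act (euler w) (X i c)) z
      = ((k + w c) • incl (X i c)) z := fun c z hz => by
    have h1 : ∀ x ∈ M.dom i, act (euler w) (X i c) x = ((k + w c) • X i c) x := fun x hx => by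
      have h2 := hw i c x hx
      rw [bracket_euler, sub_eq_iff_eq_add, ← add_smul] at h2
      exact h2
    rw [incl_congr_of_mem h1 hz, incl_nsmul]; rfl
  rw [forall_antitangent_idx, lieDerivative_eq X i]
  refine ⟨fun c y hy => ?_, fun c y hy => ?_⟩
  · rw [bracket_euler, lieLocal_baseIdx, act_liftWeight_incl w
      (differentiableAt_of_contDiffOn (hM.isOpen_dom i) (hX.smooth i c) hy), liftWeight_baseIdx,
      h c y hy, Pi.smul_apply, add_smul, add_sub_cancel_right]
  · have hO := isOpen_above (O := O) (hM.isOpen_dom i)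
    rw [bracket_euler, lieLocal_diffIdx, act_neg,
      act_liftWeight_deRham_incl w (hM.isOpen_dom i) (hX.smooth i c) hy, liftWeight_diffIdx,
      act_congr _ (eventuallyEq_of_eqOn hO (h c) hy), act_nsmul _ _
        (differentiableAt_of_contDiffOn hO (incl_contDiffOn (hX.smooth i c)) hy), Pi.neg_apply,
      smul_neg, smul_neg, add_smul]
    abel

theorem IsLieAlgebroid.isDoubleLieAlgebroid {w : E ⊕ O → ℕ} {Q : M.Idx → VField E O}
    (h : IsLieAlgebroid M w Q) :
    IsDoubleLieAlgebroid (antitangent M) (formWeight E O) (liftWeight w) (lieDerivative M 1 Q)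
      (deRham M) where
  isSupermanifold := h.isSupermanifold.isSupermanifold_antitangent
  isVectorBundle₁ := h.isSupermanifold.isVectorBundle_formWeight
  isVectorBundle₂ := h.isSupermanifold.isVectorBundle_liftWeight h.isVectorBundle
  homological₀₁ := h.isSupermanifold.isHomological_lieDerivative h.isHomological
  homological₁₀ := h.isSupermanifold.isHomological_deRham
  commute := h.isSupermanifold.commute_lieDerivative_deRham h.isHomological.isVectorField
  weight₀₁ :=
    ⟨h.isSupermanifold.hasWeight_formWeight_lieDerivative h.isHomological.isVectorField,
      h.isSupermanifold.hasWeight_liftWeight_lieDerivative h.isHomological.isVectorField h.weight⟩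
  weight₁₀ :=
    ⟨fun _ c y _ => by rw [one_smul]; exact bracket_formWeight_deRham 1 c y,
      fun _ c y _ => by rw [zero_smul]; exact bracket_liftWeight_deRham 1 w c y⟩

theorem IsSupermanifold.isHomological_add (hM : IsSupermanifold M) {Q : M.Idx → VField E O}
    (hQ : IsHomological M Q) : IsHomological (antitangent M) (lieDerivative M 1 Q + deRham M) :=
  have hA := hM.isGluing.isGluing_antitangent
  IsHomological.add hA.isOpen_dom hA.isMorphism hA.overlap_subset
    (hM.isHomological_lieDerivative hQ) hM.isHomological_deRham
    (hM.commute_lieDerivative_deRham hQ.isVectorField)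

end Gluing

/-! ## Determinants of products of odd matrices -/

section Det

open Polynomial Matrix

/-- This is Jacobi's formula: the determinant is differentiated row by row, and each term is
expanded along the differentiated row. -/
theorem derivative_det {n R : Type*} [Fintype n] [DecidableEq n] [CommRing R]
    (M : Matrix n n R[X]) :
    derivative M.det = trace (adjugate M * M.map derivative) := by
  have h1 : derivative M.det = ∑ i, (M.updateRow i fun j => derivative (M i j)).det := by
    have h0 : M.det = ∑ σ : Equiv.Perm n, Equiv.Perm.sign σ • ∏ i, M i (σ i) := by
      rw [← det_transpose, det_apply]; rfl
    rw [h0]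
    simp only [derivative_sum, derivative_smul, derivative_prod_finset]
    rw [Finset.sum_congr rfl fun σ _ => Finset.smul_sum, Finset.sum_comm]
    refine Finset.sum_congr rfl fun i _ => ?_
    rw [← det_transpose, det_apply]
    refine Finset.sum_congr rfl fun σ _ => congrArg _ ?_
    rw [← Finset.mul_prod_erase Finset.univ _ (Finset.mem_univ i), mul_comm, transpose_apply,
      updateRow_self]
    refine congrArg _ (Finset.prod_congr rfl fun k hk => ?_)
    rw [transpose_apply, updateRow_ne (Finset.ne_of_mem_erase hk)]
  rw [h1, Matrix.trace_mul_comm]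
  refine Finset.sum_congr rfl fun i _ => ?_
  rw [← cramer_transpose_apply, diag_apply, Matrix.mul_apply, cramer_eq_adjugate_mulVec,
    ← adjugate_transpose]
  exact Finset.sum_congr rfl fun j _ => mul_comm _ _

variable {m n R S : Type*} [Fintype m] [Fintype n] [CommRing R] [Ring S]

theorem trace_mul_of_anticommute {p : Matrix m n S} {q : Matrix n m S}
    (h : ∀ i j k l, p i j * q k l = -(q k l * p i j)) : trace (p * q) = -trace (q * p) := by
  simp only [trace, diag_apply, Matrix.mul_apply, h, Finset.sum_neg_distrib]
  rw [Finset.sum_comm]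

variable [DecidableEq m] [DecidableEq n]

/-- If `q` intertwines `u` and `v`, the traces of `adj u * p * q` and `adj v * q * p` are
proportional. -/
theorem det_mul_trace_adjugate_mul {f : R →+* S} (hf : Function.Injective f)
    (hc : ∀ r s, f r * s = s * f r) {p : Matrix m n S} {q : Matrix n m S}
    (h : ∀ i j k l, p i j * q k l = -(q k l * p i j)) {P u : Matrix m m R} {Q v : Matrix n n R}
    (hP : P.map f = p * q) (hQ : Q.map f = q * p) (hu : q * u.map f = v.map f * q) :
    v.det * trace (adjugate u * P) = -(u.det * trace (adjugate v * Q)) := by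
  have hl : ∀ (r : R) (A : Matrix n m S),
      (r • (1 : Matrix n n R)).map f * A = A.map (f r * ·) := fun r A => by
    ext i j
    simp [Matrix.mul_apply, Matrix.smul_apply, one_apply, apply_ite f, ite_mul]
  have hr : ∀ (r : R) (A : Matrix n m S),
      A * (r • (1 : Matrix m m R)).map f = A.map (f r * ·) := fun r A => by
    ext i j
    simp [Matrix.mul_apply, Matrix.smul_apply, one_apply, apply_ite f, mul_ite, hc]
  -- With `q u = v q`, the product `adj v * v * q * adj u = adj v * q * u * adj u` is `det v` times
  -- `q * adj u` on one side and `det u` times `adj v * q` on the other.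
  have key : (q * (adjugate u).map f).map (f v.det * ·)
      = ((adjugate v).map f * q).map (f u.det * ·) := by
    rw [← hl, ← hr, ← adjugate_mul, ← mul_adjugate, Matrix.map_mul, Matrix.map_mul,
      Matrix.mul_assoc, ← Matrix.mul_assoc (v.map f), ← hu]
    simp only [Matrix.mul_assoc]
  have hanti : ∀ i j k l, ((adjugate u).map f * p) i j * q k l
      = -(q k l * ((adjugate u).map f * p) i j) := fun i j k l => by
    simp only [Matrix.mul_apply, Finset.sum_mul, Finset.mul_sum, ← Finset.sum_neg_distrib]
    refine Finset.sum_congr rfl fun a _ => ?_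
    rw [mul_assoc, h, mul_neg, ← mul_assoc, map_apply, hc, mul_assoc]
  have hmap : ∀ (r : R) (A : Matrix n m S), f r * trace (A * p) = trace (A.map (f r * ·) * p) :=
    fun r A => by
      simp only [trace, diag_apply, Matrix.mul_apply, Finset.mul_sum, map_apply, mul_assoc]
  apply hf
  rw [map_neg, map_mul, map_mul, AddMonoidHom.map_trace, AddMonoidHom.map_trace,
    Matrix.map_mul, Matrix.map_mul, hP, hQ,
    ← Matrix.mul_assoc, ← Matrix.mul_assoc, trace_mul_of_anticommute hanti, ← Matrix.mul_assoc,
    mul_neg, hmap, hmap, key]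

/-- For matrices `p`, `q` of odd elements, `det (1 - p q)` and `det (1 - q p)` are inverse to each
other. -/
theorem det_one_sub_mul_det_one_sub [IsAddTorsionFree R] {f : R →+* S}
    (hf : Function.Injective f) (hc : ∀ r s, f r * s = s * f r) {p : Matrix m n S}
    {q : Matrix n m S} (h : ∀ i j k l, p i j * q k l = -(q k l * p i j)) {P : Matrix m m R}
    {Q : Matrix n n R} (hP : P.map f = p * q) (hQ : Q.map f = q * p) :
    (1 - P).det * (1 - Q).det = 1 := by
  -- A formal parameter `X` is inserted. The product of the two determinants will be a constant
  -- polynomial, so its values at `1` and `0` agree.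
  set u : Matrix m m R[X] := 1 - (X : R[X]) • P.map C with hu
  set v : Matrix n n R[X] := 1 - (X : R[X]) • Q.map C with hv
  have hdu : u.map derivative = -P.map C := by
    ext1 i j
    simp [hu, one_apply, apply_ite derivative]
  have hdv : v.map derivative = -Q.map C := by
    ext1 i j
    simp [hv, one_apply, apply_ite derivative]
  have hP' : (P.map C).map (mapRingHom f) = p.map C * q.map C := by
    rw [← Matrix.map_mul, ← hP]; ext1 i j; simp
  have hQ' : (Q.map C).map (mapRingHom f) = q.map C * p.map C := by
    rw [← Matrix.map_mul, ← hQ]; ext1 i j; simp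
  have hu' : u.map (mapRingHom f) = 1 - (p.map C * q.map C).map (X * ·) := by
    rw [← hP']; ext1 i j; simp [hu, one_apply, apply_ite (Polynomial.map f)]
  have hv' : v.map (mapRingHom f) = 1 - (q.map C * p.map C).map (X * ·) := by
    rw [← hQ']; ext1 i j; simp [hv, one_apply, apply_ite (Polynomial.map f)]
  -- This is `q (1 - X p q) = (1 - X q p) q`.
  have hint : q.map C * u.map (mapRingHom f) = v.map (mapRingHom f) * q.map C := by
    rw [hu', hv', Matrix.mul_sub, Matrix.sub_mul, Matrix.mul_one, Matrix.one_mul]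
    congr 1
    trans (q.map C * p.map C * q.map C).map (X * ·)
    · rw [Matrix.mul_assoc]
      ext1 i j
      simp only [Matrix.mul_apply (M := q.map C), map_apply, ← mul_assoc, X_mul, Finset.sum_mul]
    · ext1 i j
      simp only [Matrix.mul_apply (N := q.map C), map_apply, Finset.mul_sum, ← mul_assoc]
  have key := det_mul_trace_adjugate_mul (f := mapRingHom f) (p := p.map C) (q := q.map C)
    (P := P.map C) (Q := Q.map C) (u := u) (v := v) (map_injective f hf)
    (fun r s => by
      ext k
      rw [coeff_mul, coeff_mul, ← Finset.Nat.sum_antidiagonal_swap]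
      refine Finset.sum_congr rfl fun x _ => ?_
      simp only [coe_mapRingHom, coeff_map, hc, Prod.fst_swap, Prod.snd_swap]) (fun i j k l => by
      simp only [map_apply, ← C_mul, h, C_neg]) hP' hQ' hint
  -- By Jacobi's formula the derivative is minus the sum of the two trace terms, each multiplied by
  -- the other determinant; `key` says that they cancel. That a zero derivative forces a constant
  -- uses that `R` is torsion-free.
  have hd : derivative (u.det * v.det) = 0 := by
    rw [derivative_mul, derivative_det, derivative_det, hdu, hdv, Matrix.mul_neg, Matrix.mul_neg,
      trace_neg, trace_neg]
    linear_combination -key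
  have he : ∀ r : R, eval r (u.det * v.det) = (1 - r • P).det * (1 - r • Q).det := fun r => by
    rw [eval_mul, ← coe_evalRingHom, RingHom.map_det, RingHom.map_det]
    congr 2 <;> ext1 i j <;> simp [hu, hv, one_apply, apply_ite (eval r)] <;> exact mul_comm _ _
  have h0 := he 0
  have h1 := he 1
  rw [eq_C_of_derivative_eq_zero hd, eval_C] at h0 h1
  simpa using h1.symm.trans h0

end Det

section Berezinian

open Matrix

variable {N : Type*}

variable (N) in
/-- The inclusion of the even subalgebra. -/
def evenHom : GrEven N →+* Gr N := (GrEven N).subtype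

theorem evenHom_injective : Function.Injective (evenHom N) := Subtype.val_injective

theorem evenHom_mul_comm (r : GrEven N) (s : Gr N) : evenHom N r * s = s * evenHom N r :=
  even_mul_comm r.1 r.2 s

theorem evenHom_toEven {a : Gr N} (ha : a ∈ parityPart N 0) : evenHom N (toEven a) = a := by
  rw [toEven, dif_pos (show a ∈ GrEven N from ha)]; rfl

theorem evenHom_map_toEven {k l : Type*} {A : Matrix k l (Gr N)}
    (hA : ∀ i j, A i j ∈ parityPart N 0) : (A.map toEven).map (evenHom N) = A := by
  ext1 i j; exact evenHom_toEven (hA i j)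

theorem toEven_map_evenHom {k l : Type*} (A : Matrix k l (GrEven N)) :
    (A.map (evenHom N)).map toEven = A := by
  ext1 i j; exact evenHom_injective (evenHom_toEven (A i j).2)

theorem toEven_zero : toEven (0 : Gr N) = 0 :=
  evenHom_injective ((evenHom_toEven (zero_mem _)).trans (map_zero _).symm)

/-- The inverse in the full Grassmann algebra is even: its image under the grading involution is an
inverse of the same element. -/
theorem isUnit_of_body_evenHom_ne_zero [Fintype N] [DecidableEq N] {a : GrEven N}
    (h : body (evenHom N a) ≠ 0) : IsUnit a := by
  obtain ⟨b, hb⟩ := (isUnit_of_body_ne_zero h).exists_right_inv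
  have ha : twist 1 (evenHom N a) = evenHom N a := by
    rw [twist_of_mem (q := 0) (a := evenHom N a) a.2, mul_zero, sgn_zero, one_smul]
  have h1 : evenHom N a * twist 1 b = 1 := by
    rw [← ha, ← map_mul, hb, map_one]
  have h2 : twist 1 b = b := (isUnit_of_body_ne_zero h).mul_left_cancel (h1.trans hb.symm)
  have h3 : b ∈ parityPart N 0 :=
    mem_parityPart_of_twist_one (by rw [h2, sgn_zero, one_smul])
  refine IsUnit.of_mul_eq_one (toEven b) (evenHom_injective ?_)
  rw [map_mul, evenHom_toEven h3, hb, map_one]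

theorem matrix_mul_mem {k l m : Type*} [Fintype l] {p q r : ZMod 2} (hr : p + q = r)
    {A : Matrix k l (Gr N)} {B : Matrix l m (Gr N)} (hA : ∀ i j, A i j ∈ parityPart N p)
    (hB : ∀ i j, B i j ∈ parityPart N q) (i : k) (j : m) : (A * B) i j ∈ parityPart N r :=
  hr ▸ sum_mem fun x _ => mul_mem_parityPart (hA i x) (hB x j)

theorem map_evenHom_mem {k l : Type*} (A : Matrix k l (GrEven N)) (i : k) (j : l) :
    A.map (evenHom N) i j ∈ parityPart N 0 := (A i j).2

instance instIsAddTorsionFreeGrEven : IsAddTorsionFree (GrEven N) :=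
  let _ : Module ℚ (GrEven N) := Module.compHom _ (algebraMap ℚ ℝ)
  IsAddTorsionFree.of_module_rat _

variable {k l : Type*} [Fintype k] [DecidableEq k] [Fintype l] [DecidableEq l]
  {a : Matrix k k (GrEven N)} {d : Matrix l l (GrEven N)} {b : Matrix k l (Gr N)}
  {c : Matrix l k (Gr N)}

/-- The factor `a` is taken out of the Schur complement, leaving `1 - p q` with the odd matrices `p
= a⁻¹ b` and `q = d⁻¹ c`. -/
theorem toEven_schur (ha : IsUnit a.det) (hb : ∀ i j, b i j ∈ parityPart N 1)
    (hc : ∀ i j, c i j ∈ parityPart N 1) :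
    (a.map (evenHom N) - b * d⁻¹.map (evenHom N) * c).map toEven
      = a * (1 - ((a⁻¹.map (evenHom N) * b) * (d⁻¹.map (evenHom N) * c)).map toEven) := by
  have hp := matrix_mul_mem (zero_add 1) (map_evenHom_mem a⁻¹) hb
  have hq := matrix_mul_mem (zero_add 1) (map_evenHom_mem d⁻¹) hc
  have h1 : a.map (evenHom N) * a⁻¹.map (evenHom N) = 1 := by
    rw [← Matrix.map_mul, Matrix.mul_nonsing_inv a ha, Matrix.map_one _ (map_zero _) (map_one _)]
  have h2 : (a * (1 - ((a⁻¹.map (evenHom N) * b) * (d⁻¹.map (evenHom N) * c)).map toEven)).map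
      (evenHom N) = a.map (evenHom N) - b * d⁻¹.map (evenHom N) * c := by
    rw [Matrix.map_mul, Matrix.map_sub _ (map_sub _), Matrix.map_one _ (map_zero _) (map_one _),
      evenHom_map_toEven (matrix_mul_mem one_add_one_zmod_two hp hq), Matrix.mul_sub,
      Matrix.mul_one, ← Matrix.mul_assoc, ← Matrix.mul_assoc (a.map _), h1, Matrix.one_mul,
      ← Matrix.mul_assoc]
  rw [← h2, toEven_map_evenHom]

theorem det_schur_mul_det_schur (ha : IsUnit a.det) (hd : IsUnit d.det)
    (hb : ∀ i j, b i j ∈ parityPart N 1) (hc : ∀ i j, c i j ∈ parityPart N 1) :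
    ((a.map (evenHom N) - b * d⁻¹.map (evenHom N) * c).map toEven).det
      * ((d.map (evenHom N) - c * a⁻¹.map (evenHom N) * b).map toEven).det = a.det * d.det := by
  have hp := matrix_mul_mem (zero_add 1) (map_evenHom_mem a⁻¹) hb
  have hq := matrix_mul_mem (zero_add 1) (map_evenHom_mem d⁻¹) hc
  rw [toEven_schur ha hb hc, toEven_schur hd hc hb, Matrix.det_mul, Matrix.det_mul,
    mul_mul_mul_comm, det_one_sub_mul_det_one_sub evenHom_injective evenHom_mul_comm
      (p := a⁻¹.map (evenHom N) * b) (q := d⁻¹.map (evenHom N) * c), mul_one]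
  · intro i j i' j'
    rw [mul_comm_of_mem (hp i j) (hq i' j'), mul_one, sgn_one, neg_one_smul]
  · exact evenHom_map_toEven (matrix_mul_mem one_add_one_zmod_two hp hq)
  · exact evenHom_map_toEven (matrix_mul_mem one_add_one_zmod_two hq hp)

/-- The Berezinian of the block matrices that occur as Jacobian matrices of antitangent maps. -/
theorem ber_eq_one {E O : Type*} [Fintype E] [DecidableEq E] [Fintype O] [DecidableEq O]
    {M : Matrix ((E ⊕ O) ⊕ (O ⊕ E)) ((E ⊕ O) ⊕ (O ⊕ E)) (Gr (O ⊕ E))}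
    {a : Matrix E E (GrEven (O ⊕ E))} {d : Matrix O O (GrEven (O ⊕ E))}
    {b : Matrix E O (Gr (O ⊕ E))} {c : Matrix O E (Gr (O ⊕ E))} (ha : IsUnit a.det)
    (hd : IsUnit d.det) (hb : ∀ i j, b i j ∈ parityPart _ 1) (hc : ∀ i j, c i j ∈ parityPart _ 1)
    {s₁ : Matrix E O (Gr (O ⊕ E))} {s₂ : Matrix E E (Gr (O ⊕ E))} {s₃ : Matrix O O (Gr (O ⊕ E))}
    {s₄ : Matrix O E (Gr (O ⊕ E))}
    (h₁₁ : M.toBlocks₁₁ = fromBlocks (a.map (evenHom _)) s₁ 0 (d.map (evenHom _)))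
    (h₁₂ : M.toBlocks₁₂ = fromBlocks b s₂ 0 c) (h₂₁ : M.toBlocks₂₁ = fromBlocks c s₃ 0 b)
    (h₂₂ : M.toBlocks₂₂ = fromBlocks (d.map (evenHom _)) s₄ 0 (a.map (evenHom _))) :
    ber M = 1 := by
  have hz' : (0 : Matrix E O (Gr (O ⊕ E))).map toEven = 0 := Matrix.map_zero _ toEven_zero
  have hz'' : (0 : Matrix O E (Gr (O ⊕ E))).map toEven = 0 := Matrix.map_zero _ toEven_zero
  have hz3 : (0 : Matrix E O (GrEven (O ⊕ E))).map (evenHom _) = 0 :=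
    Matrix.map_zero _ (map_zero _)
  have hD : (M.toBlocks₂₂.map toEven)⁻¹
      = fromBlocks d⁻¹ (-(d⁻¹ * s₄.map toEven * a⁻¹)) 0 a⁻¹ := by
    rw [h₂₂, fromBlocks_map, toEven_map_evenHom, toEven_map_evenHom, hz',
      inv_fromBlocks_zero₂₁_of_isUnit_iff _ _ _ (iff_of_true ((isUnit_iff_isUnit_det d).2 hd)
        ((isUnit_iff_isUnit_det a).2 ha))]
  have hdet : (M.toBlocks₂₂.map toEven)⁻¹.det * (a.det * d.det) = 1 := by
    rw [hD, det_fromBlocks_zero₂₁, mul_comm a.det, mul_mul_mul_comm, ← det_mul, ← det_mul,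
      nonsing_inv_mul d hd, nonsing_inv_mul a ha, det_one, det_one, mul_one]
  change ((M.toBlocks₁₁ - M.toBlocks₁₂ * (M.toBlocks₂₂.map toEven)⁻¹.map (evenHom _)
    * M.toBlocks₂₁).map toEven).det * (M.toBlocks₂₂.map toEven)⁻¹.det = 1
  rw [← hdet, mul_comm]
  congr 1
  -- All blocks are upper triangular, hence so is the Schur complement. Its diagonal blocks are `a -
  -- b d⁻¹ c` and `d - c a⁻¹ b`, and the `s` blocks drop out of the determinant.
  rw [hD, h₁₁, h₁₂, h₂₁, fromBlocks_map, hz3, fromBlocks_multiply, fromBlocks_multiply,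
    sub_eq_add_neg, fromBlocks_neg, fromBlocks_add, fromBlocks_map]
  simp only [Matrix.mul_zero, Matrix.zero_mul, add_zero, zero_add, neg_zero, ← sub_eq_add_neg]
  rw [hz'', det_fromBlocks_zero₂₁, det_schur_mul_det_schur ha hd hb hc]

end Berezinian

/-! ## The Berezinian of a coordinate change of the antitangent bundle -/

section Volume

variable {E O : Type*} [Fintype E] [DecidableEq E] [Fintype O] [DecidableEq O]

/-- `df = dx^b ∂_b f` is linear in the differentials, and `∂_b f` does not depend on them. This
gives the second diagonal block of the Jacobian matrix as well as the cancellation in the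
divergence. -/
theorem pd_diffIdx_deRham_incl {V : Set (E → ℝ)} {f : SFun E O} {y : E ⊕ O → ℝ} (hV : IsOpen V)
    (hf : ContDiffOn ℝ ∞ f V) (hy : y ∈ above O V) (c : E ⊕ O) :
    pd (diffIdx c) (act (deRhamLocal E O) (incl f)) y = incl (pd c f) y := by
  have hO := isOpen_above (O := O) hV
  have hd : ∀ b, DifferentiableAt ℝ (incl (pd b f)) y := fun b =>
    differentiableAt_of_contDiffOn hO (incl_contDiffOn (pd_contDiffOn hV hf b)) hy
  have h1 : Set.EqOn (act (deRhamLocal E O) (incl f))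
      (fun z => ∑ b, coord (diffIdx b) z * incl (pd b f) z) (above O V) := fun z hz => by
    rw [act_deRham]
    exact Finset.sum_congr rfl fun b _ => by
      rw [pd_baseIdx_incl (differentiableAt_of_contDiffOn hV hf hz)]
  rw [pd_congr _ (eventuallyEq_of_eqOn hO h1 hy), pd_sum _ fun b _ =>
    differentiableAt_of_contDiffOn hO (contDiffOn_mul (contDiff_coord _).contDiffOn
      (incl_contDiffOn (pd_contDiffOn hV hf b))) hy]
  simp only [pd_mul _ (differentiableAt_coord _ y) (hd _), pd_coord, diffIdx_injective.eq_iff,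
    pd_diffIdx_incl (differentiableAt_of_contDiffOn hV (pd_contDiffOn hV hf _) hy), mul_zero,
    add_zero, ite_mul, one_mul, zero_mul, Finset.sum_ite_eq, Finset.mem_univ, if_true]

/-- An even element is a unit if its body is nonzero, and taking bodies commutes with determinants.
-/
theorem isUnit_det_of_body_mul_eq_one {N k : Type*} [Fintype N] [DecidableEq N] [Fintype k]
    [DecidableEq k] {A : Matrix k k (GrEven N)} {B : Matrix k k ℝ}
    (h : A.map (fun a => body (evenHom N a)) * B = 1) : IsUnit A.det := by
  apply isUnit_of_body_evenHom_ne_zero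
  have h1 : body (evenHom N A.det) = (A.map fun a => body (evenHom N a)).det :=
    RingHom.map_det ((bodyHom N).toRingHom.comp (evenHom N)) A
  have h2 := congrArg Matrix.det h
  rw [Matrix.det_mul, Matrix.det_one] at h2
  rw [h1]
  exact left_ne_zero_of_mul_eq_one h2

open Matrix in
/-- Coordinate changes of the antitangent bundle have Berezinian `1`. -/
theorem IsMorphism.ber_antitangentMap {φ ψ : E ⊕ O → SFun E O} {U V : Set (E → ℝ)}
    (hφ : IsMorphism φ U V) (hψ : ∀ c, ContDiffOn ℝ ∞ (ψ c) V)
    (hψp : ∀ c, ∀ x ∈ V, ψ c x ∈ parityPart O (par c))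
    (hψφ : ∀ c, ∀ x ∈ U, coord c x = pull φ (ψ c) x) {y : E ⊕ O → ℝ} (hy : y ∈ above O U) :
    ber (jac (antitangentMap φ) y) = 1 := by
  have hU := hφ.isOpen_source
  have hJ : ∀ a b, pd a (φ b) (basePt y) ∈ parityPart O (par b + par a) := fun a b =>
    pd_mem hU (hφ.smooth b) (hφ.parity b) hy a
  have hK : ∀ a b, pull φ (pd a (ψ b)) (basePt y) ∈ parityPart O (par b + par a) := fun a b =>
    hφ.pull_mem hy (pd_contDiffOn hφ.isOpen_target (hψ b) a) fun z hz =>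
      pd_mem hφ.isOpen_target (hψ b) (hψp b) hz a
  have hchain : ∀ a c, (if a = c then 1 else 0 : Gr O)
      = ∑ b, pd a (φ b) (basePt y) * pull φ (pd b (ψ c)) (basePt y) := fun a c => by
    rw [← hφ.pd_pull hy (hψ c), ← pd_coord a c (basePt y)]
    exact pd_congr a (eventuallyEq_of_eqOn hU (hψφ c) hy)
  -- The Jacobian matrices of `φ` and of its inverse multiply to `1`. On bodies the entries of mixed
  -- parity vanish, so the even-even and odd-odd blocks are invertible separately.
  have hbody : ∀ a c, (if a = c then 1 else 0 : ℝ)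
      = ∑ b, body (pd a (φ b) (basePt y)) * body (pull φ (pd b (ψ c)) (basePt y)) := fun a c => by
    have h := congrArg (bodyHom O) (hchain a c)
    simp only [map_sum, map_mul, apply_ite (bodyHom O), map_one, map_zero] at h
    exact h
  set a : Matrix E E (GrEven (O ⊕ E)) := .of fun i j => toEven (incl (pd (.inl i) (φ (.inl j))) y)
    with ha
  set d : Matrix O O (GrEven (O ⊕ E)) := .of fun i j => toEven (incl (pd (.inr i) (φ (.inr j))) y)
    with hd
  have hae : ∀ i j, evenHom _ (a i j) = incl (pd (.inl i) (φ (.inl j))) y := fun i j =>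
    evenHom_toEven (incl_mem (hJ (.inl i) (.inl j)))
  have hde : ∀ i j, evenHom _ (d i j) = incl (pd (.inr i) (φ (.inr j))) y := fun i j =>
    evenHom_toEven (incl_mem (hJ (.inr i) (.inr j)))
  have hau : IsUnit a.det := by
    apply isUnit_det_of_body_mul_eq_one
      (B := .of fun i j => body (pull φ (pd (.inl i) (ψ (.inl j))) (basePt y)))
    ext1 i j
    have h := hbody (.inl i) (.inl j)
    rw [Fintype.sum_sum_type, Finset.sum_eq_zero (s := (Finset.univ : Finset O)) fun o _ => by
      rw [body_of_odd (hJ (.inl i) (.inr o)), zero_mul], add_zero] at h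
    simp only [Matrix.mul_apply, map_apply, of_apply, hae, body_incl, one_apply, ← h,
      Sum.inl.injEq]
  have hdu : IsUnit d.det := by
    apply isUnit_det_of_body_mul_eq_one
      (B := .of fun i j => body (pull φ (pd (.inr i) (ψ (.inr j))) (basePt y)))
    ext1 i j
    have h := hbody (.inr i) (.inr j)
    rw [Fintype.sum_sum_type, Finset.sum_eq_zero (s := (Finset.univ : Finset E)) fun o _ => by
      rw [body_of_odd (hJ (.inr i) (.inl o)), zero_mul], zero_add] at h
    simp only [Matrix.mul_apply, map_apply, of_apply, hde, body_incl, one_apply, ← h,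
      Sum.inr.injEq]
  have e1 : ∀ i j, jac (antitangentMap φ) y (baseIdx i) (baseIdx j)
      = incl (pd i (φ j)) y := fun i j => by
    rw [jac, of_apply, antitangentMap_baseIdx,
      pd_baseIdx_incl (differentiableAt_of_contDiffOn hU (hφ.smooth j) hy)]
  have e2 : ∀ i j, jac (antitangentMap φ) y (diffIdx i) (baseIdx j) = 0 := fun i j => by
    rw [jac, of_apply, antitangentMap_baseIdx,
      pd_diffIdx_incl (differentiableAt_of_contDiffOn hU (hφ.smooth j) hy)]
  have e3 : ∀ i j, jac (antitangentMap φ) y (diffIdx i) (diffIdx j)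
      = incl (pd i (φ j)) y := fun i j => by
    rw [jac, of_apply, antitangentMap_diffIdx, pd_diffIdx_deRham_incl hU (hφ.smooth j) hy]
  -- The blocks `s₁` to `s₄` hold the derivatives of `dx'` with respect to `x`. They contain second
  -- derivatives of `φ`, and their values do not matter.
  refine ber_eq_one hau hdu
    (b := .of fun i j => incl (pd (.inl i) (φ (.inr j))) y)
    (c := .of fun i j => incl (pd (.inr i) (φ (.inl j))) y)
    (fun i j => incl_mem (hJ (.inl i) (.inr j))) (fun i j => incl_mem (hJ (.inr i) (.inl j)))
    (s₁ := ((jac (antitangentMap φ) y).toBlocks₁₁).toBlocks₁₂)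
    (s₂ := ((jac (antitangentMap φ) y).toBlocks₁₂).toBlocks₁₂)
    (s₃ := ((jac (antitangentMap φ) y).toBlocks₂₁).toBlocks₁₂)
    (s₄ := ((jac (antitangentMap φ) y).toBlocks₂₂).toBlocks₁₂) ?_ ?_ ?_ ?_
  all_goals
    ext1 i j
    rcases i with i | i <;> rcases j with j | j
  · exact (e1 (.inl i) (.inl j)).trans (hae i j).symm
  · rfl
  · exact e2 (.inr i) (.inl j)
  · exact (e3 (.inr i) (.inr j)).trans (hde i j).symm
  · exact e1 (.inl i) (.inr j)
  · rfl
  · exact e2 (.inr i) (.inr j)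
  · exact e3 (.inr i) (.inl j)
  · exact e1 (.inr i) (.inl j)
  · rfl
  · exact e2 (.inl i) (.inl j)
  · exact e3 (.inl i) (.inr j)
  · exact (e1 (.inr i) (.inr j)).trans (hde i j).symm
  · rfl
  · exact e2 (.inl i) (.inr j)
  · exact (e3 (.inl i) (.inl j)).trans (hae i j).symm

/-! ### The global coordinate volume -/

variable {M : SuperAtlas.{u} E O}

theorem IsGluing.ber_antitangent (hM : IsGluing M) (i j : (antitangent M).Idx)
    {y : E ⊕ O → ℝ} (hy : y ∈ (antitangent M).overlap i j) :
    ber (jac ((antitangent M).trans i j) y) = 1 := by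
  refine (hM.isMorphism i j).ber_antitangentMap (hM.smooth j i) (hM.parity j i)
    (fun c x hx => ?_) hy
  rw [← hM.trans_self i c x (hM.overlap_subset i j hx)]
  exact (hM.cocycle i j i x hx (hM.mapsTo i j hx)).2 c

/-- The coordinate volumes of an antitangent bundle form a Berezin volume. -/
theorem IsGluing.isBerezinVolume_coordVolume (hM : IsGluing M) :
    IsBerezinVolume (antitangent M) (coordVolume (antitangent M)) where
  smooth _ := contDiffOn_const
  even _ _ _ := (GrEven (O ⊕ E)).one_mem
  isUnit _ _ _ := isUnit_one
  compat i j y hy := by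
    rw [hM.ber_antitangent i j hy]
    exact ((one_mul _).trans ((hM.isGluing_antitangent.isMorphism i j).pull_one hy)).symm

/-! ## Divergence and the modular class -/

theorem sgn_mul_one_add_one (p : ZMod 2) : sgn (p * (1 + 1)) = 1 := by
  rw [one_add_one_zmod_two, mul_zero, sgn_zero]

/-- For an odd field the sign exponent contains the factor `1 + 1`, so the divergence is a sum
without signs. -/
theorem divergence_one_one (X : VField E O) (x : E → ℝ) :
    divergence 1 (fun _ => 1) X x = ∑ c, pd c (X c) x := by
  simp only [divergence, sgn_mul_one_add_one, Ring.inverse_one, mul_one, one_mul, one_smul]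

/-- The divergence for an arbitrary density in terms of the one for the coordinate volume. -/
theorem divergence_one_eq {V : Set (E → ℝ)} {X : VField E O} {ρ : SFun E O} {x : E → ℝ}
    (hV : IsOpen V) (hX : ∀ c, ContDiffOn ℝ ∞ (X c) V)
    (hXp : ∀ c, X c x ∈ parityPart O (1 + par c)) (hρ : ContDiffOn ℝ ∞ ρ V)
    (hρ0 : ρ x ∈ parityPart O 0) (hu : IsUnit (ρ x)) (hx : x ∈ V) :
    divergence 1 ρ X x = divergence 1 (fun _ => 1) X x + Ring.inverse (ρ x) * act X ρ x := by
  rw [divergence_one_one, act, Finset.mul_sum, ← Finset.sum_add_distrib, divergence]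
  refine Finset.sum_congr rfl fun c _ => ?_
  -- `X c x` has parity `1 + par c`, and `par c * (1 + par c)` is always even.
  have ht : twist (par c) (X c x) = X c x := by
    rw [twist_of_mem (hXp c)]
    rcases zmod_two_cases (par c) with h | h <;> rw [h]
    · rw [zero_mul, sgn_zero, one_smul]
    · rw [one_add_one_zmod_two, mul_zero, sgn_zero, one_smul]
  rw [sgn_mul_one_add_one, one_smul, pd_mul c (differentiableAt_of_contDiffOn hV (hX c) hx)
    (differentiableAt_of_contDiffOn hV hρ hx), ht, mul_add, ← even_mul_comm _ hρ0,
    ← mul_assoc, Ring.inverse_mul_cancel _ hu, one_mul]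

/-- The contributions `∂_c X^c` of `x^c` and `-∂(d X^c)/∂(dx^c) = -∂_c X^c` of `dx^c` cancel. The
component `dx^c` of `d` does not depend on `x^c`, and its other components are zero. -/
theorem divergence_lieLocal_add_deRham {V : Set (E → ℝ)} {X : VField E O} {y : E ⊕ O → ℝ}
    (hV : IsOpen V) (hX : ∀ c, ContDiffOn ℝ ∞ (X c) V) (hy : y ∈ above O V) :
    divergence 1 (fun _ => 1) (lieLocal X + deRhamLocal E O) y = 0 := by
  have hd : ∀ c, DifferentiableAt ℝ (lieLocal X c) y := fun c =>
    differentiableAt_of_contDiffOn (isOpen_above hV) (lieLocal_contDiffOn hV hX c) hy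
  have hd' : ∀ c, DifferentiableAt ℝ (deRhamLocal E O c) y := fun c =>
    (deRhamLocal_contDiff c).differentiable (by simp) y
  rw [divergence_one_one, sum_antitangent_idx, ← Finset.sum_add_distrib]
  refine Finset.sum_eq_zero fun c _ => ?_
  rw [Pi.add_apply, Pi.add_apply, pd_add _ (hd _) (hd' _), pd_add _ (hd _) (hd' _),
    lieLocal_baseIdx, lieLocal_diffIdx, deRhamLocal_baseIdx, deRhamLocal_diffIdx, pd_neg,
    pd_diffIdx_deRham_incl hV (hX c) hy, pd_zero, pd_coord, if_neg (baseIdx_ne_diffIdx _ _),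
    pd_baseIdx_incl (differentiableAt_of_contDiffOn hV (hX c) hy)]
  abel

end Volume

/-! ## Logarithms of even invertible superfunctions -/

section Log

variable {E O E' O' : Type*} [Fintype E] [DecidableEq E] [Fintype O] [DecidableEq O]
  [Fintype E'] [DecidableEq E'] [Fintype O'] [DecidableEq O']

/-- The function `log |t|` of one even coordinate. -/
def logFun : SFun PUnit.{1} PEmpty.{1} := fun t => algebraMap ℝ _ (Real.log (t ⟨⟩))

/-- An even superfunction, as a map to the line. -/
def toLine (ρ : SFun E O) : PUnit.{1} ⊕ PEmpty.{1} → SFun E O := Sum.elim (fun _ => ρ) PEmpty.elim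

/-- The logarithm of (the absolute value of) an even invertible superfunction. -/
def superLog (ρ : SFun E O) : SFun E O := pull (toLine ρ) logFun

/-- The reduced line without its origin. -/
def punctured : Set (PUnit.{1} → ℝ) := {t | t ⟨⟩ ≠ 0}

theorem isOpen_punctured : IsOpen punctured := isOpen_ne_fun (continuous_apply _) continuous_const

/-- `Real.log` is `log |t|`, smooth on both half-lines, so densities of either sign are covered. -/
theorem logFun_contDiffOn : ContDiffOn ℝ ∞ logFun punctured :=
  contDiffOn_algebraMap ((contDiff_apply ℝ ℝ _).contDiffOn.log fun _ ht => ht)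

theorem pd_logFun_mul_coord {t : PUnit.{1} → ℝ} (ht : t ∈ punctured) :
    pd (.inl ⟨⟩) logFun t * coord (.inl ⟨⟩) t = 1 := by
  have h1 : HasFDerivAt (fun t : PUnit.{1} → ℝ => Real.log (t ⟨⟩))
      ((t ⟨⟩)⁻¹ • (ContinuousLinearMap.proj (R := ℝ) (φ := fun _ => ℝ) PUnit.unit)) t :=
    (ContinuousLinearMap.proj (R := ℝ) (φ := fun _ : PUnit.{1} => ℝ) PUnit.unit).hasFDerivAt.log ht
  have h2 := ((LinearMap.toContinuousLinearMap
    (Algebra.linearMap ℝ (Gr PEmpty.{1}))).hasFDerivAt (x := Real.log (t ⟨⟩))).comp t h1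
  have h3 : HasFDerivAt logFun _ t := h2
  rw [pd_inl, h3.fderiv]
  change algebraMap ℝ (Gr PEmpty.{1})
      ((t ⟨⟩)⁻¹ * (Pi.single PUnit.unit 1 : PUnit.{1} → ℝ) PUnit.unit)
    * algebraMap ℝ (Gr PEmpty.{1}) (t ⟨⟩) = 1
  rw [Pi.single_eq_same, mul_one, ← map_mul, inv_mul_cancel₀ ht, map_one]

variable {U : Set (E → ℝ)} {ρ : SFun E O} {x : E → ℝ}

theorem isMorphism_toLine (hU : IsOpen U) (hρ : ContDiffOn ℝ ∞ ρ U)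
    (hρ0 : ∀ x ∈ U, ρ x ∈ parityPart O 0) (hu : ∀ x ∈ U, IsUnit (ρ x)) :
    IsMorphism (toLine ρ) U punctured where
  isOpen_source := hU
  isOpen_target := isOpen_punctured
  mapsTo x hx := isUnit_iff_body_ne_zero.1 (hu x hx)
  smooth c := by rcases c with c | c; exacts [hρ, c.elim]
  parity c := by rcases c with c | c; exacts [hρ0, c.elim]

theorem superLog_contDiffOn (hU : IsOpen U) (hρ : ContDiffOn ℝ ∞ ρ U)
    (hρ0 : ∀ x ∈ U, ρ x ∈ parityPart O 0) (hu : ∀ x ∈ U, IsUnit (ρ x)) :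
    ContDiffOn ℝ ∞ (superLog ρ) U :=
  (isMorphism_toLine hU hρ hρ0 hu).contDiffOn_pull logFun_contDiffOn

theorem superLog_mem (hU : IsOpen U) (hρ : ContDiffOn ℝ ∞ ρ U)
    (hρ0 : ∀ x ∈ U, ρ x ∈ parityPart O 0) (hu : ∀ x ∈ U, IsUnit (ρ x)) (hx : x ∈ U) :
    superLog ρ x ∈ parityPart O 0 :=
  (isMorphism_toLine hU hρ hρ0 hu).pull_mem hx logFun_contDiffOn
    fun _ _ => algebraMap_mem_parityPart _

/-- The chain rule along the map `ρ` to the line leaves the pullback of `(log |t|)'`. Pulling back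
`(log |t|)' * t = 1` identifies it with `ρ⁻¹`. -/
theorem act_superLog (hU : IsOpen U) (hρ : ContDiffOn ℝ ∞ ρ U)
    (hρ0 : ∀ x ∈ U, ρ x ∈ parityPart O 0) (hu : ∀ x ∈ U, IsUnit (ρ x)) (hx : x ∈ U)
    (X : VField E O) : act X (superLog ρ) x = Ring.inverse (ρ x) * act X ρ x := by
  have hm := isMorphism_toLine hU hρ hρ0 hu
  have hpd := pd_contDiffOn isOpen_punctured logFun_contDiffOn (.inl ⟨⟩)
  have h1 : pull (toLine ρ) (pd (.inl ⟨⟩) logFun) x * ρ x = 1 := by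
    have h := hm.pull_mul hx hpd (contDiff_coord (.inl ⟨⟩)).contDiffOn
    rw [hm.pull_coord hx] at h
    have hE : Set.EqOn (fun t => pd (.inl ⟨⟩) logFun t * coord (.inl ⟨⟩) t) (fun _ => 1)
      punctured := fun t ht => pd_logFun_mul_coord ht
    exact h.symm.trans ((hm.pull_congr hx hE).trans (hm.pull_one hx))
  have h2 : pull (toLine ρ) (pd (.inl ⟨⟩) logFun) x = Ring.inverse (ρ x) := by
    rw [← mul_one (pull _ _ _), ← Ring.mul_inverse_cancel _ (hu x hx), ← mul_assoc, h1, one_mul]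
  have h3 : pull (toLine ρ) (pd (.inl ⟨⟩) logFun) x ∈ parityPart O 0 :=
    hm.pull_mem hx hpd fun t ht => by
      have h := pd_mem isOpen_punctured logFun_contDiffOn (p := 0)
        (fun _ _ => algebraMap_mem_parityPart _) ht (.inl ⟨⟩)
      rwa [par_inl, add_zero] at h
  rw [superLog, hm.act_pull hx logFun_contDiffOn, Fintype.sum_sum_type, Finset.univ_eq_empty
    (α := PEmpty), Finset.sum_empty, add_zero, Fintype.sum_unique]
  change act X ρ x * pull (toLine ρ) (pd (.inl ⟨⟩) logFun) x = _
  rw [← even_mul_comm _ h3, h2]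

/-- As `superLog` is itself a pullback, this is functoriality. It makes the local logarithms a
global function. -/
theorem IsMorphism.superLog_pull {φ : E' ⊕ O' → SFun E O} {V : Set (E' → ℝ)} {ρ' : SFun E' O'}
    (hφ : IsMorphism φ U V) (hρ : ContDiffOn ℝ ∞ ρ' V)
    (hρ0 : ∀ x ∈ V, ρ' x ∈ parityPart O' 0) (hu : ∀ x ∈ V, IsUnit (ρ' x)) (hx : x ∈ U)
    (h : ρ x = pull φ ρ' x) : superLog ρ x = pull φ (superLog ρ') x := by
  rw [superLog, superLog, hφ.pull_pull (isMorphism_toLine hφ.isOpen_target hρ hρ0 hu) hx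
    logFun_contDiffOn]
  refine pull_congr_left (fun c => ?_) _
  rcases c with c | c
  exacts [h, c.elim]

end Log

/-! ## The modular class -/

section Modular

variable {E O : Type*} [Fintype E] [DecidableEq E] [Fintype O] [DecidableEq O]
  {M : SuperAtlas.{u} E O}

/-- A homological vector field that preserves a global coordinate volume is unimodular. -/
theorem IsGluing.isUnimodular (hM : IsGluing M) {Q : M.Idx → VField E O} (hQ : IsHomological M Q)
    (hvol : IsBerezinVolume M (coordVolume M))
    (hdiv : ∀ i, ∀ x ∈ M.dom i, Div M 1 (coordVolume M) Q i x = 0) : IsUnimodular M Q := by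
  refine ⟨⟨_, hvol⟩, fun ρ hρ => ?_⟩
  -- Since the constants `1` form a volume, every Berezinian of a coordinate change is `1`. The
  -- density of any other volume then transforms as a function.
  have hcompat : ∀ i j, ∀ x ∈ M.overlap i j, ρ i x = pull (M.trans i j) (ρ j) x :=
    fun i j x hx => by
      have h1 := hvol.compat i j x hx
      have h2 : pull (M.trans i j) (coordVolume M j) x = 1 := (hM.isMorphism i j).pull_one hx
      rw [h2, mul_one] at h1
      rw [hρ.compat i j x hx, ← h1]
      exact one_mul _
  have hlog : ∀ i, ContDiffOn ℝ ∞ (superLog (ρ i)) (M.dom i) := fun i =>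
    superLog_contDiffOn (hM.isOpen_dom i) (hρ.smooth i) (hρ.even i) (hρ.isUnit i)
  have hlog0 : ∀ i, ∀ x ∈ M.dom i, superLog (ρ i) x ∈ parityPart O 0 := fun i x hx =>
    superLog_mem (hM.isOpen_dom i) (hρ.smooth i) (hρ.even i) (hρ.isUnit i) hx
  have hlogc : ∀ i j, ∀ x ∈ M.overlap i j,
      superLog (ρ i) x = pull (M.trans i j) (superLog (ρ j)) x := fun i j x hx =>
    (hM.isMorphism i j).superLog_pull ((hρ.smooth j).mono (hM.overlap_subset j i))
      (fun z hz => hρ.even j z (hM.overlap_subset j i hz))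
      (fun z hz => hρ.isUnit j z (hM.overlap_subset j i hz)) hx (hcompat i j x hx)
  have hQs := hQ.isVectorField.smooth
  have hQp := hQ.isVectorField.parity
  -- The divergence for the coordinate volume is zero, which leaves `ρ⁻¹ Q(ρ) = Q(log |ρ|)`.
  have key : ∀ i, ∀ x ∈ M.dom i, Div M 1 ρ Q i x = act (Q i) (superLog (ρ i)) x :=
    fun i x hx => by
      have h1 : divergence 1 (fun _ => 1) (Q i) x = 0 := hdiv i x hx
      rw [act_superLog (hM.isOpen_dom i) (hρ.smooth i) (hρ.even i) (hρ.isUnit i) hx, Div,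
        divergence_one_eq (hM.isOpen_dom i) (hQs i) (fun c => hQp i c x hx) (hρ.smooth i)
          (hρ.even i x hx) (hρ.isUnit i x hx) hx, h1, zero_add]
  refine ⟨⟨⟨fun i => (act_contDiffOn (hM.isOpen_dom i) (hQs i) (hlog i)).congr (key i),
    fun i x hx => ?_, fun i j x hx => ?_⟩, fun i x hx => ?_⟩,
    fun i => superLog (ρ i), ⟨hlog, one_add_one_zmod_two.symm ▸ hlog0, hlogc⟩, key⟩
  · rw [key i x hx]
    have h := act_mem (hM.isOpen_dom i) (fun c => hQp i c x hx) (hlog i) (hlog0 i) hx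
    rwa [add_zero] at h
  · have hm := hM.isMorphism i j
    have hE : Set.EqOn (Div M 1 ρ Q j) (act (Q j) (superLog (ρ j))) (M.overlap j i) :=
      fun z hz => key j z (hM.overlap_subset j i hz)
    rw [key i x (hM.overlap_subset i j hx), hm.pull_congr hx hE,
      act_congr _ (eventuallyEq_of_eqOn hm.isOpen_source (hlogc i j) hx)]
    exact hm.act_pull_of_related hx ((hlog j).mono (hM.overlap_subset j i))
      (fun c => (hQs j c).mono (hM.overlap_subset j i))
      fun c => hQ.isVectorField.compat i j c x hx
  -- Closedness is `Q(Q(log |ρ|)) = 0`, from `Q² = 0` on coordinates.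
  · rw [act_congr _ (eventuallyEq_of_eqOn (hM.isOpen_dom i) (key i) hx),
      act_act_self_of_odd (hM.isOpen_dom i) (hQs i) (hlog i) (fun c => hQp i c x hx) hx]
    exact Finset.sum_eq_zero fun c _ => by
      beta_reduce; rw [hQ.sq_zero i c x hx, zero_mul]

theorem IsSupermanifold.div_lieDerivative_add_deRham (hM : IsSupermanifold M)
    {X : M.Idx → VField E O} (hX : IsVectorField M 1 X) (i : (antitangent M).Idx)
    {y : E ⊕ O → ℝ} (hy : y ∈ (antitangent M).dom i) :
    Div (antitangent M) 1 (coordVolume (antitangent M)) (lieDerivative M 1 X + deRham M) i y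
      = 0 := by
  have h := divergence_lieLocal_add_deRham (hM.isOpen_dom i) (hX.smooth i) hy
  rw [← lieDerivative_eq X i] at h
  exact h

end Modular

end Super

end

open Super in
theorem mainTheorem2 {E O : Type*} [Fintype E] [DecidableEq E] [Fintype O] [DecidableEq O]
    (A : SuperAtlas E O) (w : E ⊕ O → ℕ) (dA : A.Idx → VField E O)
    (hA : IsLieAlgebroid A w dA) :
    IsDoubleLieAlgebroid (antitangent A) (formWeight E O) (liftWeight w)
        (lieDerivative A 1 dA) (deRham A) ∧
      IsHomological (antitangent A) (lieDerivative A 1 dA + deRham A) ∧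
      IsUnimodular (antitangent A) (lieDerivative A 1 dA + deRham A) ∧
      IsBerezinVolume (antitangent A) (coordVolume (antitangent A)) ∧
      ∀ i, ∀ x ∈ (antitangent A).dom i,
        Div (antitangent A) 1 (coordVolume (antitangent A))
          (lieDerivative A 1 dA + deRham A) i x = 0 := by
  have hM := hA.isSupermanifold
  have hQ := hM.isHomological_add hA.isHomological
  have hvol := hM.isGluing.isBerezinVolume_coordVolume
  have hdiv := fun i y (hy : y ∈ (antitangent A).dom i) =>
    hM.div_lieDerivative_add_deRham hA.isHomological.isVectorField i hy
  exact ⟨hA.isDoubleLieAlgebroid, hQ, hM.isGluing.isGluing_antitangent.isUnimodular hQ hvol hdiv,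
    hvol, hdiv⟩
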